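/- \textbf{Setting.} A free algebra $\mathbb{A}$ is a finite list of constructors $c_1,\dots,c_{k(\mathbb{A})}$ with arities $\mathcal{R}(c_i)\in\mathbb{N}$; it is a word algebra if exactly one constructor has arity $0$ and all others have arity $1$. Fix a finite family $\mathscr{A}$ of free algebras. $|t|$ denotes the number of constructors in a free algebra term $t$. Types are $A::=\mathbb{A}^i\mid A\multimap A$ with $\mathbb{A}\in\mathscr{A}$, $i\in\mathbb{N}$; $A\multimap^0B=B$, $A\multimap^{n+1}B=A\multimap(A\multimap^nB)$; the level $V(A)$ is the largest index $i$ occurring in $A$. Terms are $M::=x\mid c\mid MM\mid\lambda x.M\mid M\{\!\{M_1,\dots,M_k\}\!\}\mid M\langle\!\langle M_1,\dots,M_k\rangle\!\rangle$ (conditional and recursion), up to renaming of bound variables, with size $|x|=|c|=1$, $|\lambda x.M|=|M|+1$, $|MN|=|M|+|N|$, $|M\{\!\{M_1,\dots,M_k\}\!\}|=|M\langle\!\langle M_1,\dots,M_k\rangle\!\rangle|=|M|+\sum_i|M_i|+k$. Contexts are finite sets of declarations $x:A$ of distinct variables; a comma is a union with disjoint domains. The typing rules of $\mathsf{RH}(\mathsf{W})$,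 where $\mathsf{W}=\{\mathbb{A}^i\mid\mathbb{A}\in\mathscr{A}\text{ a word algebra}\}$, are: \begin{itemize} \item axiom $x:A\vdash x:A$; weakening: from $\Gamma\vdash M:B$ infer $\Gamma,x:A\vdash M:B$; contraction: from $\Gamma,x:A,y:A\vdash M:B$ infer $\Gamma,z:A\vdash M\{z/x,z/y\}:B$, provided $A\in\mathsf{W}$; \item from $\Gamma,x:A\vdash M:B$ infer $\Gamma\vdash\lambda x.M:A\multimap B$; from $\Gamma\vdash M:A\multimap B$ and $\Delta\vdash N:A$ infer $\Gamma,\Delta\vdash MN:B$; $\vdash c:\mathbb{A}^i\multimap^{\mathcal{R}(c)}\mathbb{A}^i$ for every constructor $c$ of $\mathbb{A}$; \item conditional: from $\Delta\vdash L:\mathbb{A}^m$ and $\Gamma_i\vdash M_i:\mathbb{A}^m\multimap^{\mathcal{R}(c_i)}C$ for $1\le i\le k(\mathbb{A})$ infer $\Gamma_1,\dots,\Gamma_{k(\mathbb{A})},\Delta\vdash L\{\!\{M_1,\dots,M_{k(\mathbb{A})}\}\!\}:C$; \item recursion: from $\Delta\vdash L:\mathbb{A}^m$ and $\Gamma_i\vdash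 M_i:\mathbb{A}^m\multimap^{\mathcal{R}(c_i)}(C\multimap^{\mathcal{R}(c_i)}C)$ for $1\le i\le k(\mathbb{A})$ infer $\Gamma_1,\dots,\Gamma_{k(\mathbb{A})},\Delta\vdash L\langle\!\langle M_1,\dots,M_{k(\mathbb{A})}\rangle\!\rangle:C$, provided all types in the $\Gamma_i$ are in $\mathsf{W}$ and $m>V(C)$. \end{itemize} For a derivation $\pi$, the recursion depth $R(\pi)$ is the largest number of recursion rules on a path from the root to a leaf, and the highest tier $I(\pi)$ is the largest $m$ in an instance of the recursion rule in $\pi$ ($0$ if there is none). \textbf{Interaction graphs.} The graph $G=G_\pi$ of $\pi$ is built along $\pi$. It has a directed edge for each declaration of the context of its conclusion, and a directed conclusion edge; edges are labelled by types. An axiom is one edge from the premise to the conclusion; in every other rule the conclusion edges and premise edges of the subgraphs are attached as follows. Weakening adds a vertex $W$ entered by the edge of $x$. Contraction adds a vertex $X$ entered by the edge $h$ of $z$ and left by the edges $e,g$ of $x,y$. Abstraction adds $I_\multimap$ left by the edge $e:A$ of $x$ and by the conclusion $h:A\multimap B$, and entered by $g:B$ from the body. Application adds $E_\multimap$ entered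 by $e:A\multimap B$ from the function and $g:A$ from the argument, left by $h:B$. A constructor $c$ is a vertex $I^c_{\mathbb{A}}$ left by one edge. A conditional adds $C^N_{\mathbb{A}}$ entered by $e_0:\mathbb{A}^m$ from $L$ and by $e_i$ from $M_i$, left by $g:C$. A recursion adds in the same way $v$ labelled $C^R_{\mathbb{A}}$ with edges $e_0,e_i,g$, and for each declaration of each $\Gamma_i$ a vertex $P^R_{\mathbb{A}}$ entered by the outer edge and left by the edge inside; all edges of the graphs of the $M_i$ form the box of $v$. $\rho(v)=e_0$, and $\theta(e)$ is the $C^R$-vertex of the innermost box containing $e$, if any. \textbf{Context semantics.} Term contexts $u$ are algebra terms with one hole $[\cdot]$; type contexts are $L::=[\cdot]\mid L\multimap A\mid A\multimap L$, where $[\cdot]$ is positive, $A\multimap L$ has the polarity of $L$ and $L\multimap A$ the opposite one; $L$ is a focus for $A$ if $A=L[\mathbb{A}^i]$ for some $\mathbb{A}^i$. Labels are tuples $(t,e,U,L)$ with $t$ a term of an algebra of $\mathscr{A}$, $e$ an edge, $U$ a finite sequence (stack) of triples $(u,s,v)$ ($u$ a term context, $s$ a term of the same algebra, $v$ a vertex),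 $L$ a type context. For a finite tree $T$ of labels, $L(T)$ is the term in the root label. If $L(T)=u[s]$, then $B(T,u,s)$ is the smallest subtree of $T$ whose root carries the occurrence of $s$ singled out by $u$. $T(G)$ is the smallest set of finite trees closed under the following rules, where $l\leftarrow l_1,\dots,l_k$ means that trees of $T(G)$ with root labels $l_1,\dots,l_k$ may be joined below a new root $l$, where $P_A$ ($N_A$) ranges over positive (negative) focuses for $A$, and where, for $1\le j\le r$, $\mathrm{arg}^r_j(A,L,B)=A\multimap^{j-1}(L\multimap(A\multimap^{r-j}B))$: \begin{itemize} \item $I_\multimap$: $(t,e,U,P_A)\leftarrow(t,h,U,P_A\multimap B)$; $(t,h,U,N_A\multimap B)\leftarrow(t,e,U,N_A)$; $(t,h,U,A\multimap P_B)\leftarrow(t,g,U,P_B)$; $(t,g,U,N_B)\leftarrow(t,h,U,A\multimap N_B)$. \item $E_\multimap$: $(t,e,U,P_A\multimap B)\leftarrow(t,g,U,P_A)$; $(t,g,U,N_A)\leftarrow(t,e,U,N_A\multimap B)$; $(t,e,U,A\multimap N_B)\leftarrow(t,h,U,N_B)$; $(t,h,U,P_B)\leftarrow(t,e,U,A\multimap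 P_B)$. \item $X$: $(t,e,U,[\cdot])\leftarrow(t,h,U,[\cdot])$ and $(t,g,U,[\cdot])\leftarrow(t,h,U,[\cdot])$. \item $I^c_{\mathbb{A}}$ with edge $e$, $\mathcal{R}(c)=0$: $(c,e,\varepsilon,[\cdot])\leftarrow$ if $\theta(e)$ is undefined; $(c,e,(u,t,v)U,[\cdot])\leftarrow$ if $\theta(e)=v$ and some tree in $T(G)$ has root $(u[t],\rho(v),U,[\cdot])$. \item $I^c_{\mathbb{A}}$ with edge $e$ of type $\mathbb{A}^i\multimap^r\mathbb{A}^i$, $r=\mathcal{R}(c)>0$: $(ct_1\cdots t_r,e,U,\mathbb{A}^i\multimap^r[\cdot])\leftarrow(t_j,e,U,\mathrm{arg}^r_j(\mathbb{A}^i,[\cdot],\mathbb{A}^i))_{1\le j\le r}$. \item $C^N_{\mathbb{A}}$, if $T\in T(G)$ has root $(c_it_1\cdots t_r,e_0,U,[\cdot])$: $(t,g,U,P_C)\leftarrow(t,e_i,U,\mathbb{A}^m\multimap^rP_C)$; $(t,e_i,U,\mathbb{A}^m\multimap^rN_C)\leftarrow(t,g,U,N_C)$; and, with $S_j=B(T,c_it_1\cdots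 t_{j-1}[\cdot]t_{j+1}\cdots t_r,t_j)$, the tree with root $(t_j,e_i,U,\mathrm{arg}^r_j(\mathbb{A}^m,[\cdot],C))$ and only immediate subtree $S_j$ is in $T(G)$. \item $v$ labelled $C^R_{\mathbb{A}}$, if $T\in T(G)$ has root $(u[s],e_0,U,[\cdot])$, $s=c_it_1\cdots t_r$, and $u_j=u[c_it_1\cdots t_{j-1}[\cdot]t_{j+1}\cdots t_r]$: for $t_k=c_js_1\cdots s_q$, $(r',e_i,(u,s,v)U,\mathbb{A}^m\multimap^r\mathrm{arg}^r_k(C,P_C,C))\leftarrow(r',e_j,(u_k,t_k,v)U,\mathbb{A}^m\multimap^q(C\multimap^qP_C))$ and $(r',e_j,(u_k,t_k,v)U,\mathbb{A}^m\multimap^q(C\multimap^qN_C))\leftarrow(r',e_i,(u,s,v)U,\mathbb{A}^m\multimap^r\mathrm{arg}^r_k(C,N_C,C))$; if $u=[\cdot]$, $(r',g,U,P_C)\leftarrow(r',e_i,([\cdot],s,v)U,\mathbb{A}^m\multimap^r(C\multimap^rP_C))$ and $(r',e_i,([\cdot],s,v)U,\mathbb{A}^m\multimap^r(C\multimap^rN_C))\leftarrow(r',g,U,N_C)$;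 and the tree with root $(t_j,e_i,(u,s,v)U,\mathrm{arg}^r_j(\mathbb{A}^m,[\cdot],C\multimap^rC))$ and only immediate subtree $B(T,u_j,t_j)$ is in $T(G)$, for $1\le j\le r$. \item $P^R_{\mathbb{A}}$ with outer edge $e$ and inner edge $g$, $\theta(g)=v$, if some tree in $T(G)$ has root $(u[s],\rho(v),U,[\cdot])$: $(t,g,(u,s,v)U,[\cdot])\leftarrow(t,e,U,[\cdot])$. \end{itemize} \textbf{Theorem.} For all $d,e\in\mathbb{N}$ there are polynomials $p^d_e:\mathbb{N}\to\mathbb{N}$ (depending only on $d$, $e$ and $\mathscr{A}$) such that for every type derivation $\pi:\Gamma\vdash M:A$ in $\mathsf{RH}(\mathsf{W})$ and every tree $T\in T(G_\pi)$, $$|L(T)|\le p^{I(\pi)}_{R(\pi)}(|M|).$$ -/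

import Mathlib

namespace LinRec

/-! ### Free algebras, their terms and term contexts -/

/-- A free algebra: `k` constructors `c₁, …, c_k`, each with an arity. -/
structure FreeAlg where
  k : ℕ
  arity : Fin k → ℕ

/-- Word algebras: exactly one constructor of arity `0`, all the others of arity `1`. -/
def FreeAlg.IsWord (B : FreeAlg) : Prop :=
  ∃ i, B.arity i = 0 ∧ ∀ j, j ≠ i → B.arity j = 1

/-- Terms of a free algebra. -/
inductive AlgTerm (B : FreeAlg) : Type
  | mk (c : Fin B.k) (ts : Fin (B.arity c) → AlgTerm B) : AlgTerm B

/-- The number of constructors in a term of a free algebra. -/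
def AlgTerm.size {B : FreeAlg} : AlgTerm B → ℕ
  | .mk _ ts => 1 + ∑ j, (ts j).size

/-- Term contexts: terms with exactly one hole. In `node c j ts u` the hole is in the argument
at position `j`, which is `u`; the other arguments are given by `ts`. -/
inductive AlgCtx (B : FreeAlg) : Type
  | hole : AlgCtx B
  | node (c : Fin B.k) (j : Fin (B.arity c)) (ts : {l // l ≠ j} → AlgTerm B) (u : AlgCtx B) :
      AlgCtx B

/-- `u[t]` for a context `u` and a term `t`. -/
def AlgCtx.plug {B : FreeAlg} : AlgCtx B → AlgTerm B → AlgTerm B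
  | .hole, t => t
  | .node c j ts u, t => .mk c fun l => if h : l = j then u.plug t else ts ⟨l, h⟩

/-- `u[w]` for contexts `u` and `w`. -/
def AlgCtx.comp {B : FreeAlg} : AlgCtx B → AlgCtx B → AlgCtx B
  | .hole, w => w
  | .node c j ts u, w => .node c j ts (u.comp w)

/-- The context `c t₁ … t_{j-1} [·] t_{j+1} … t_n`. -/
def AlgCtx.arg {B : FreeAlg} (c : Fin B.k) (ts : Fin (B.arity c) → AlgTerm B)
    (j : Fin (B.arity c)) : AlgCtx B :=
  .node c j (fun l => ts l) .hole

/-! ### Types and type contexts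

A finite family of free algebras is given as `𝒜 : Fin n → FreeAlg`. -/

/-- Types: `base a i` is the base type `𝔸^i` for the algebra `𝔸 = 𝒜 a` at tier `i`; `arr` is the
linear arrow. -/
inductive Ty {n : ℕ} (𝒜 : Fin n → FreeAlg) : Type
  | base (a : Fin n) (i : ℕ) : Ty 𝒜
  | arr (A B : Ty 𝒜) : Ty 𝒜

/-- `A ⊸ⁿ B`. -/
def Ty.arrows {n : ℕ} {𝒜 : Fin n → FreeAlg} : ℕ → Ty 𝒜 → Ty 𝒜 → Ty 𝒜
  | 0, _, B => B
  | r + 1, A, B => .arr A (arrows r A B)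

/-- The level of a type. -/
def Ty.level {n : ℕ} {𝒜 : Fin n → FreeAlg} : Ty 𝒜 → ℕ
  | .base _ i => i
  | .arr A B => max A.level B.level

/-- Type contexts: `left L A` is `L ⊸ A` and `right A L` is `A ⊸ L`. -/
inductive TyCtx {n : ℕ} (𝒜 : Fin n → FreeAlg) : Type
  | hole : TyCtx 𝒜
  | left (L : TyCtx 𝒜) (A : Ty 𝒜) : TyCtx 𝒜
  | right (A : Ty 𝒜) (L : TyCtx 𝒜) : TyCtx 𝒜

/-- `L[A]`. -/
def TyCtx.fill {n : ℕ} {𝒜 : Fin n → FreeAlg} : TyCtx 𝒜 → Ty 𝒜 → Ty 𝒜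
  | .hole, X => X
  | .left L A, X => .arr (L.fill X) A
  | .right A L, X => .arr A (L.fill X)

/-- The polarity of a type context: `true` for positive, `false` for negative. -/
def TyCtx.positive {n : ℕ} {𝒜 : Fin n → FreeAlg} : TyCtx 𝒜 → Bool
  | .hole => true
  | .left L _ => !L.positive
  | .right _ L => L.positive

/-- `A ⊸ʳ L` for a type context `L`. -/
def TyCtx.arrows {n : ℕ} {𝒜 : Fin n → FreeAlg} : ℕ → Ty 𝒜 → TyCtx 𝒜 → TyCtx 𝒜
  | 0, _, L => L
  | r + 1, A, L => .right A (arrows r A L)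

/-- `A ⊸ʲ (L ⊸ (A ⊸^(r-j-1) B))`: the `j`-th (from zero) of `r` argument positions. -/
def TyCtx.argAt {n : ℕ} {𝒜 : Fin n → FreeAlg} {r : ℕ} (A : Ty 𝒜) (j : Fin r) (L : TyCtx 𝒜)
    (B : Ty 𝒜) : TyCtx 𝒜 :=
  TyCtx.arrows j A (.left L (Ty.arrows (r - j - 1) A B))

/-- `L` is a focus for `A` if `A = L[𝔸^i]` for some base type `𝔸^i`. -/
def TyCtx.IsFocus {n : ℕ} {𝒜 : Fin n → FreeAlg} (L : TyCtx 𝒜) (A : Ty 𝒜) : Prop :=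
  ∃ a i, A = L.fill (.base a i)

def TyCtx.PosFocus {n : ℕ} {𝒜 : Fin n → FreeAlg} (L : TyCtx 𝒜) (A : Ty 𝒜) : Prop :=
  L.positive = true ∧ L.IsFocus A

def TyCtx.NegFocus {n : ℕ} {𝒜 : Fin n → FreeAlg} (L : TyCtx 𝒜) (A : Ty 𝒜) : Prop :=
  L.positive = false ∧ L.IsFocus A

/-! ### Terms of the lambda calculus -/

/-- Terms up to renaming of bound variables, with de Bruijn indices: below `d` abstractions, the
indices `0, …, d - 1` are bound and `d + x` is the free variable `x`.
`cond L M` is the conditional `L {{M₁, …, M_k}}` and `recur L M` the recursion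
`L ⟪M₁, …, M_k⟫`. -/
inductive Term {n : ℕ} (𝒜 : Fin n → FreeAlg) : Type
  | var (x : ℕ) : Term 𝒜
  | con (a : Fin n) (c : Fin (𝒜 a).k) : Term 𝒜
  | app (M N : Term 𝒜) : Term 𝒜
  | lam (M : Term 𝒜) : Term 𝒜
  | cond {k : ℕ} (L : Term 𝒜) (M : Fin k → Term 𝒜) : Term 𝒜
  | recur {k : ℕ} (L : Term 𝒜) (M : Fin k → Term 𝒜) : Term 𝒜

/-- The size `|M|` of a term. -/
def Term.size {n : ℕ} {𝒜 : Fin n → FreeAlg} : Term 𝒜 → ℕ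
  | .var _ => 1
  | .con _ _ => 1
  | .app M N => M.size + N.size
  | .lam M => M.size + 1
  | .cond (k := k) L M => L.size + ∑ i, (M i).size + k
  | .recur (k := k) L M => L.size + ∑ i, (M i).size + k

/-- Extension of a renaming below an abstraction. -/
def liftRen (σ : ℕ → ℕ) : ℕ → ℕ
  | 0 => 0
  | x + 1 => σ x + 1

/-- Capture-avoiding renaming of the free variables. -/
def Term.rename {n : ℕ} {𝒜 : Fin n → FreeAlg} : (ℕ → ℕ) → Term 𝒜 → Term 𝒜
  | σ, .var x => .var (σ x)
  | _, .con a c => .con a c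
  | σ, .app M N => .app (M.rename σ) (N.rename σ)
  | σ, .lam M => .lam (M.rename (liftRen σ))
  | σ, .cond L M => .cond (L.rename σ) fun i => (M i).rename σ
  | σ, .recur L M => .recur (L.rename σ) fun i => (M i).rename σ

/-- `M{z/x, z/y}`. -/
def Term.contract {n : ℕ} {𝒜 : Fin n → FreeAlg} (M : Term 𝒜) (x y z : ℕ) : Term 𝒜 :=
  M.rename fun w => if w = x ∨ w = y then z else w

/-! ### Typing contexts -/

/-- Typing contexts: partial functions from variables to types (all those that occur in type
derivations are finite). -/
abbrev Ctx {n : ℕ} (𝒜 : Fin n → FreeAlg) : Type := ℕ → Option (Ty 𝒜)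

/-- The variables declared in a context. -/
abbrev Ctx.Dom {n : ℕ} {𝒜 : Fin n → FreeAlg} (Γ : Ctx 𝒜) : Type := {x : ℕ // (Γ x).isSome = true}

def Ctx.empty {n : ℕ} {𝒜 : Fin n → FreeAlg} : Ctx 𝒜 := fun _ => none

/-- `Γ, x : A` (used for `x` not declared in `Γ`). -/
def Ctx.insert {n : ℕ} {𝒜 : Fin n → FreeAlg} (Γ : Ctx 𝒜) (x : ℕ) (A : Ty 𝒜) : Ctx 𝒜 :=
  fun w => if w = x then some A else Γ w

/-- `Γ, x : A` below an abstraction of `x`: index `0` is `x`, the others are shifted. -/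
def Ctx.cons {n : ℕ} {𝒜 : Fin n → FreeAlg} (Γ : Ctx 𝒜) (A : Ty 𝒜) : Ctx 𝒜
  | 0 => some A
  | x + 1 => Γ x

/-- `Γ` is `Γ₁, Γ₂`, the union of contexts with disjoint domains. -/
def Ctx.Union {n : ℕ} {𝒜 : Fin n → FreeAlg} (Γ₁ Γ₂ Γ : Ctx 𝒜) : Prop :=
  (∀ x, Γ₁ x = none ∨ Γ₂ x = none) ∧ ∀ x A, Γ x = some A ↔ Γ₁ x = some A ∨ Γ₂ x = some A

/-- `Γ` is `Γ₁, …, Γ_k, Δ`, the union of contexts with pairwise disjoint domains. -/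
def Ctx.UnionAll {n : ℕ} {𝒜 : Fin n → FreeAlg} {k : ℕ} (Γs : Fin k → Ctx 𝒜) (Δ Γ : Ctx 𝒜) :
    Prop :=
  (∀ i j, i ≠ j → ∀ x, Γs i x = none ∨ Γs j x = none) ∧
  (∀ i x, Γs i x = none ∨ Δ x = none) ∧
  ∀ x A, Γ x = some A ↔ (∃ i, Γs i x = some A) ∨ Δ x = some A

theorem Ctx.Union.left {n : ℕ} {𝒜 : Fin n → FreeAlg} {Γ₁ Γ₂ Γ : Ctx 𝒜} (h : Ctx.Union Γ₁ Γ₂ Γ)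
    (x : ℕ) (hx : (Γ₁ x).isSome = true) : (Γ x).isSome = true := by
  obtain ⟨A, hA⟩ := Option.isSome_iff_exists.mp hx
  exact Option.isSome_iff_exists.mpr ⟨A, (h.2 x A).mpr (Or.inl hA)⟩

theorem Ctx.Union.right {n : ℕ} {𝒜 : Fin n → FreeAlg} {Γ₁ Γ₂ Γ : Ctx 𝒜} (h : Ctx.Union Γ₁ Γ₂ Γ)
    (x : ℕ) (hx : (Γ₂ x).isSome = true) : (Γ x).isSome = true := by
  obtain ⟨A, hA⟩ := Option.isSome_iff_exists.mp hx
  exact Option.isSome_iff_exists.mpr ⟨A, (h.2 x A).mpr (Or.inr hA)⟩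

theorem Ctx.UnionAll.branch {n : ℕ} {𝒜 : Fin n → FreeAlg} {k : ℕ} {Γs : Fin k → Ctx 𝒜}
    {Δ Γ : Ctx 𝒜} (h : Ctx.UnionAll Γs Δ Γ) (i : Fin k) (x : ℕ)
    (hx : (Γs i x).isSome = true) : (Γ x).isSome = true := by
  obtain ⟨A, hA⟩ := Option.isSome_iff_exists.mp hx
  exact Option.isSome_iff_exists.mpr ⟨A, (h.2.2 x A).mpr (Or.inl ⟨i, hA⟩)⟩

theorem Ctx.UnionAll.main {n : ℕ} {𝒜 : Fin n → FreeAlg} {k : ℕ} {Γs : Fin k → Ctx 𝒜}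
    {Δ Γ : Ctx 𝒜} (h : Ctx.UnionAll Γs Δ Γ) (x : ℕ)
    (hx : (Δ x).isSome = true) : (Γ x).isSome = true := by
  obtain ⟨A, hA⟩ := Option.isSome_iff_exists.mp hx
  exact Option.isSome_iff_exists.mpr ⟨A, (h.2.2 x A).mpr (Or.inr hA)⟩

theorem Ctx.isSome_insert_self {n : ℕ} {𝒜 : Fin n → FreeAlg} (Γ : Ctx 𝒜) (x : ℕ) (A : Ty 𝒜) :
    (Γ.insert x A x).isSome = true := by
  simp [Ctx.insert]

theorem Ctx.isSome_insert {n : ℕ} {𝒜 : Fin n → FreeAlg} (Γ : Ctx 𝒜) (x : ℕ) (A : Ty 𝒜) (w : ℕ)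
    (hw : (Γ w).isSome = true) : (Γ.insert x A w).isSome = true := by
  by_cases h : w = x
  · simp [Ctx.insert, h]
  · simpa [Ctx.insert, h] using hw

theorem Ctx.isSome_of_insert {n : ℕ} {𝒜 : Fin n → FreeAlg} (Γ : Ctx 𝒜) (x : ℕ) (A : Ty 𝒜)
    (w : ℕ) (hne : w ≠ x) (hw : (Γ.insert x A w).isSome = true) : (Γ w).isSome = true := by
  simpa [Ctx.insert, hne] using hw

/-! ### Type systems and type derivations -/

/-- The subsystems: contraction (and the contexts of the branches of recursions) are limited to the
types in `dup`, and if `ramified` holds then the ramification condition is imposed. -/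
structure System {n : ℕ} (𝒜 : Fin n → FreeAlg) where
  dup : Set (Ty 𝒜)
  ramified : Prop

/-- The system `H(D)`. -/
def H {n : ℕ} {𝒜 : Fin n → FreeAlg} (D : Set (Ty 𝒜)) : System 𝒜 := ⟨D, False⟩

/-- The ramified system `RH(D)`. -/
def RH {n : ℕ} {𝒜 : Fin n → FreeAlg} (D : Set (Ty 𝒜)) : System 𝒜 := ⟨D, True⟩

/-- `W`, the class of the types `𝔸^i` where `𝔸` is a word algebra. -/
def wordTypes {n : ℕ} (𝒜 : Fin n → FreeAlg) : Set (Ty 𝒜) :=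
  {A | ∃ a i, (𝒜 a).IsWord ∧ A = .base a i}

/-- Type derivations `π : Γ ⊢ M : A`. -/
inductive Deriv {n : ℕ} {𝒜 : Fin n → FreeAlg} (S : System 𝒜) :
    Ctx 𝒜 → Term 𝒜 → Ty 𝒜 → Type
  | ax {Γ' : Ctx 𝒜} (x : ℕ) (A : Ty 𝒜) (hΓ' : Γ' = Ctx.empty.insert x A) :
      Deriv S Γ' (.var x) A
  | weak {Γ Γ' : Ctx 𝒜} {M : Term 𝒜} {B : Ty 𝒜} (x : ℕ) (A : Ty 𝒜) (hx : Γ x = none)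
      (hΓ' : Γ' = Γ.insert x A) (d : Deriv S Γ M B) : Deriv S Γ' M B
  | contr {Γ Γ' Γ'' : Ctx 𝒜} {M M' : Term 𝒜} {B : Ty 𝒜} (x y z : ℕ) (A : Ty 𝒜) (hxy : x ≠ y)
      (hx : Γ x = none) (hy : Γ y = none) (hz : Γ z = none) (hA : A ∈ S.dup)
      (hΓ'' : Γ'' = (Γ.insert x A).insert y A) (hΓ' : Γ' = Γ.insert z A)
      (hM' : M' = M.contract x y z) (d : Deriv S Γ'' M B) : Deriv S Γ' M' B
  | lam {Γ : Ctx 𝒜} {M : Term 𝒜} {A B : Ty 𝒜} (d : Deriv S (Γ.cons A) M B) :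
      Deriv S Γ (.lam M) (.arr A B)
  | app {Γ Γ₁ Γ₂ : Ctx 𝒜} {M N : Term 𝒜} {A B : Ty 𝒜} (hΓ : Ctx.Union Γ₁ Γ₂ Γ)
      (d₁ : Deriv S Γ₁ M (.arr A B)) (d₂ : Deriv S Γ₂ N A) : Deriv S Γ (.app M N) B
  | con {Γ' : Ctx 𝒜} (a : Fin n) (c : Fin (𝒜 a).k) (i : ℕ) (hΓ' : Γ' = Ctx.empty) :
      Deriv S Γ' (.con a c) (Ty.arrows ((𝒜 a).arity c) (.base a i) (.base a i))
  | cond {a : Fin n} {m : ℕ} {Γs : Fin (𝒜 a).k → Ctx 𝒜} {Δ Γ : Ctx 𝒜} {L : Term 𝒜}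
      {M : Fin (𝒜 a).k → Term 𝒜} {C : Ty 𝒜} (hΓ : Ctx.UnionAll Γs Δ Γ)
      (ds : ∀ i, Deriv S (Γs i) (M i) (Ty.arrows ((𝒜 a).arity i) (.base a m) C))
      (d : Deriv S Δ L (.base a m)) : Deriv S Γ (.cond L M) C
  | recur {a : Fin n} {m : ℕ} {Γs : Fin (𝒜 a).k → Ctx 𝒜} {Δ Γ : Ctx 𝒜} {L : Term 𝒜}
      {M : Fin (𝒜 a).k → Term 𝒜} {C : Ty 𝒜} (hΓ : Ctx.UnionAll Γs Δ Γ)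
      (hdup : ∀ i x A, Γs i x = some A → A ∈ S.dup)
      (hram : S.ramified → C.level < m)
      (ds : ∀ i, Deriv S (Γs i) (M i)
        (Ty.arrows ((𝒜 a).arity i) (.base a m) (Ty.arrows ((𝒜 a).arity i) C C)))
      (d : Deriv S Δ L (.base a m)) : Deriv S Γ (.recur L M) C

/-- The recursion depth `R(π)`: the biggest number of instances of the recursion rule on a path
from the root to a leaf. -/
def Deriv.recDepth {n : ℕ} {𝒜 : Fin n → FreeAlg} {S : System 𝒜} {Γ : Ctx 𝒜} {M : Term 𝒜}
    {A : Ty 𝒜} : Deriv S Γ M A → ℕ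
  | .ax _ _ _ => 0
  | .weak _ _ _ _ d => d.recDepth
  | .contr _ _ _ _ _ _ _ _ _ _ _ _ d => d.recDepth
  | .lam d => d.recDepth
  | .app _ d₁ d₂ => max d₁.recDepth d₂.recDepth
  | .con _ _ _ _ => 0
  | .cond _ ds d => max (Finset.univ.sup fun i => (ds i).recDepth) d.recDepth
  | .recur _ _ _ ds d => 1 + max (Finset.univ.sup fun i => (ds i).recDepth) d.recDepth

/-- The highest tier `I(π)`: the maximum tier of the recurrence argument in an instance of the
recursion rule (`0` if there is no such instance). -/
def Deriv.highTier {n : ℕ} {𝒜 : Fin n → FreeAlg} {S : System 𝒜} {Γ : Ctx 𝒜} {M : Term 𝒜}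
    {A : Ty 𝒜} : Deriv S Γ M A → ℕ
  | .ax _ _ _ => 0
  | .weak _ _ _ _ d => d.highTier
  | .contr _ _ _ _ _ _ _ _ _ _ _ _ d => d.highTier
  | .lam d => d.highTier
  | .app _ d₁ d₂ => max d₁.highTier d₂.highTier
  | .con _ _ _ _ => 0
  | .cond _ ds d => max (Finset.univ.sup fun i => (ds i).highTier) d.highTier
  | .recur (m := m) _ _ _ ds d =>
      max m (max (Finset.univ.sup fun i => (ds i).highTier) d.highTier)

/-! ### Interaction graphs

Every edge of an interaction graph leaves either a premise of the graph or an internal vertex. An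
interaction graph with premises `Γ` is given by its internal vertices, the internal edges (those
that leave internal vertices) and, for every internal vertex, its label together with the edges
incident to it; its set of edges is `Γ.Dom ⊕ E`. The vertices labelled `P` (the sources of the
edges in `Γ.Dom`) and the vertex labelled `C` (the target of the edge `out`) induce no closure
condition, so they are left implicit. Plugging the conclusion of a graph into a premise
of another one identifies the two edges. -/

/-- The labels of vertices, with the incident edges. -/
inductive Node {n : ℕ} (𝒜 : Fin n → FreeAlg) (E : Type) : Type
  /-- `W`, with incoming edge `e`. -/
  | weak (e : E) : Node 𝒜 E
  /-- `X`, with incoming edge `h` and outgoing edges `e`, `g`. -/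
  | dup (e g h : E) : Node 𝒜 E
  /-- `I_⊸`: outgoing edge `e` for the variable, incoming edge `g` from the body, outgoing
  conclusion `h`. -/
  | lam (e g h : E) : Node 𝒜 E
  /-- `E_⊸`: incoming edges `e` from the function and `g` from the argument, outgoing
  conclusion `h`. -/
  | app (e g h : E) : Node 𝒜 E
  /-- `I^c_𝔸`, with outgoing edge `e`. -/
  | con (a : Fin n) (c : Fin (𝒜 a).k) (e : E) : Node 𝒜 E
  /-- `C^N_𝔸`: incoming edges `e₀` from the argument and `es i` from the branches, outgoing
  conclusion `g`. -/
  | cond (a : Fin n) (e₀ : E) (es : Fin (𝒜 a).k → E) (g : E) : Node 𝒜 E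
  /-- `C^R_𝔸`: incoming edges `e₀` (the recursive premise) and `es i` from the branches, outgoing
  conclusion `g`. -/
  | recur (a : Fin n) (e₀ : E) (es : Fin (𝒜 a).k → E) (g : E) : Node 𝒜 E
  /-- `P^R_𝔸`: incoming edge `e`, outgoing edge `g` into the box. -/
  | boxPrem (a : Fin n) (e g : E) : Node 𝒜 E

def Node.map {n : ℕ} {𝒜 : Fin n → FreeAlg} {E F : Type} (f : E → F) : Node 𝒜 E → Node 𝒜 F
  | .weak e => .weak (f e)
  | .dup e g h => .dup (f e) (f g) (f h)
  | .lam e g h => .lam (f e) (f g) (f h)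
  | .app e g h => .app (f e) (f g) (f h)
  | .con a c e => .con a c (f e)
  | .cond a e₀ es g => .cond a (f e₀) (fun i => f (es i)) (f g)
  | .recur a e₀ es g => .recur a (f e₀) (fun i => f (es i)) (f g)
  | .boxPrem a e g => .boxPrem a (f e) (f g)

/-- Graphs with premises `Γ`: `ty` gives the types of the internal edges, `box e` is the vertex
`C^R` that delimits the innermost box in which the internal edge `e` is contained, if any. -/
structure IGraph {n : ℕ} {𝒜 : Fin n → FreeAlg} (Γ : Ctx 𝒜) where
  V : Type
  E : Type
  node : V → Node 𝒜 (Γ.Dom ⊕ E)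
  ty : E → Ty 𝒜
  box : E → Option V
  out : Γ.Dom ⊕ E

/-- The set of edges. -/
abbrev IGraph.Edge {n : ℕ} {𝒜 : Fin n → FreeAlg} {Γ : Ctx 𝒜} (G : IGraph Γ) : Type :=
  Γ.Dom ⊕ G.E

/-- The type of an edge. -/
def IGraph.edgeTy {n : ℕ} {𝒜 : Fin n → FreeAlg} {Γ : Ctx 𝒜} (G : IGraph Γ) : G.Edge → Ty 𝒜
  | .inl x => (Γ x.1).get x.2
  | .inr e => G.ty e

/-- The box-premise `θ_G(e)` of an edge. -/
def IGraph.boxPremise {n : ℕ} {𝒜 : Fin n → FreeAlg} {Γ : Ctx 𝒜} (G : IGraph Γ) :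
    G.Edge → Option G.V
  | .inl _ => none
  | .inr e => G.box e

/-- `ρ_G(v) = e`: the vertex `v` has label `C^R_𝔸` for some `𝔸`, and its recursive premise
is `e`. -/
def IGraph.RecPremise {n : ℕ} {𝒜 : Fin n → FreeAlg} {Γ : Ctx 𝒜} (G : IGraph Γ) (v : G.V)
    (e : G.Edge) : Prop :=
  ∃ a es g, G.node v = .recur a e es g

/-- The graph of an axiom: one edge from the premise to the conclusion. -/
def IGraph.ax {n : ℕ} {𝒜 : Fin n → FreeAlg} {Γ' : Ctx 𝒜} (x : ℕ) (A : Ty 𝒜)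
    (hΓ' : Γ' = Ctx.empty.insert x A) : IGraph Γ' where
  V := Empty
  E := Empty
  node := Empty.elim
  ty := Empty.elim
  box := Empty.elim
  out := .inl ⟨x, hΓ' ▸ Ctx.isSome_insert_self _ x A⟩

/-- A new premise `x`, whose edge enters a new vertex `W`. -/
def IGraph.weak {n : ℕ} {𝒜 : Fin n → FreeAlg} {Γ Γ' : Ctx 𝒜} (x : ℕ) (A : Ty 𝒜)
    (hΓ' : Γ' = Γ.insert x A) (G : IGraph Γ) : IGraph Γ' :=
  let f : G.Edge → Γ'.Dom ⊕ G.E :=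
    Sum.map (fun w => ⟨w.1, hΓ' ▸ Ctx.isSome_insert Γ x A w.1 w.2⟩) id
  { V := Option G.V
    E := G.E
    node := fun
      | none => .weak (.inl ⟨x, hΓ' ▸ Ctx.isSome_insert_self Γ x A⟩)
      | some v => (G.node v).map f
    ty := G.ty
    box := fun e => (G.box e).map some
    out := f G.out }

/-- The premises `x` and `y` become the edges (`false` and `true`) that leave a new vertex `X`,
which is entered by the edge of a new premise `z`. -/
def IGraph.contr {n : ℕ} {𝒜 : Fin n → FreeAlg} {Γ Γ' Γ'' : Ctx 𝒜} (x y z : ℕ) (A : Ty 𝒜)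
    (hΓ'' : Γ'' = (Γ.insert x A).insert y A) (hΓ' : Γ' = Γ.insert z A) (G : IGraph Γ'') :
    IGraph Γ' :=
  let f : G.Edge → Γ'.Dom ⊕ (Bool ⊕ G.E) := fun
    | .inl w =>
        if hx : w.1 = x then .inr (.inl false)
        else if hy : w.1 = y then .inr (.inl true)
        else .inl ⟨w.1, hΓ' ▸ Ctx.isSome_insert Γ z A w.1 (Ctx.isSome_of_insert Γ x A w.1 hx
          (Ctx.isSome_of_insert (Γ.insert x A) y A w.1 hy (hΓ'' ▸ w.2)))⟩
    | .inr e => .inr (.inr e)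
  { V := Option G.V
    E := Bool ⊕ G.E
    node := fun
      | none => .dup (.inr (.inl false)) (.inr (.inl true))
          (.inl ⟨z, hΓ' ▸ Ctx.isSome_insert_self Γ z A⟩)
      | some v => (G.node v).map f
    ty := Sum.elim (fun _ => A) G.ty
    box := Sum.elim (fun _ => none) fun e => (G.box e).map some
    out := f G.out }

/-- The bound variable becomes the edge `false` that leaves a new vertex `I_⊸`, whose conclusion is
the edge `true`. -/
def IGraph.lam {n : ℕ} {𝒜 : Fin n → FreeAlg} {Γ : Ctx 𝒜} (A B : Ty 𝒜) (G : IGraph (Γ.cons A)) :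
    IGraph Γ :=
  let f : G.Edge → Γ.Dom ⊕ (Bool ⊕ G.E) := fun
    | .inl ⟨0, _⟩ => .inr (.inl false)
    | .inl ⟨x + 1, hx⟩ => .inl ⟨x, hx⟩
    | .inr e => .inr (.inr e)
  { V := Option G.V
    E := Bool ⊕ G.E
    node := fun
      | none => .lam (.inr (.inl false)) (f G.out) (.inr (.inl true))
      | some v => (G.node v).map f
    ty := Sum.elim (fun b => if b then .arr A B else A) G.ty
    box := Sum.elim (fun _ => none) fun e => (G.box e).map some
    out := .inr (.inl true) }

/-- A new vertex `E_⊸`, with the conclusion `none`. -/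
def IGraph.app {n : ℕ} {𝒜 : Fin n → FreeAlg} {Γ Γ₁ Γ₂ : Ctx 𝒜} (hΓ : Ctx.Union Γ₁ Γ₂ Γ)
    (B : Ty 𝒜) (G₁ : IGraph Γ₁) (G₂ : IGraph Γ₂) : IGraph Γ :=
  let f₁ : G₁.Edge → Γ.Dom ⊕ Option (G₁.E ⊕ G₂.E) :=
    Sum.map (fun w => ⟨w.1, hΓ.left w.1 w.2⟩) fun e => some (.inl e)
  let f₂ : G₂.Edge → Γ.Dom ⊕ Option (G₁.E ⊕ G₂.E) :=
    Sum.map (fun w => ⟨w.1, hΓ.right w.1 w.2⟩) fun e => some (.inr e)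
  { V := Option (G₁.V ⊕ G₂.V)
    E := Option (G₁.E ⊕ G₂.E)
    node := fun
      | none => .app (f₁ G₁.out) (f₂ G₂.out) (.inr none)
      | some (.inl v) => (G₁.node v).map f₁
      | some (.inr v) => (G₂.node v).map f₂
    ty := fun
      | none => B
      | some (.inl e) => G₁.ty e
      | some (.inr e) => G₂.ty e
    box := fun
      | none => none
      | some (.inl e) => (G₁.box e).map fun v => some (.inl v)
      | some (.inr e) => (G₂.box e).map fun v => some (.inr v)
    out := .inr none }

/-- A vertex `I^c_𝔸` with its outgoing edge. -/
def IGraph.con {n : ℕ} {𝒜 : Fin n → FreeAlg} (Γ' : Ctx 𝒜) (a : Fin n) (c : Fin (𝒜 a).k)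
    (i : ℕ) : IGraph Γ' where
  V := Unit
  E := Unit
  node := fun _ => .con a c (.inr ())
  ty := fun _ => Ty.arrows ((𝒜 a).arity c) (.base a i) (.base a i)
  box := fun _ => none
  out := .inr ()

/-- A new vertex `C^N_𝔸`, with the conclusion `none`. -/
def IGraph.cond {n : ℕ} {𝒜 : Fin n → FreeAlg} {a : Fin n} {Γs : Fin (𝒜 a).k → Ctx 𝒜}
    {Δ Γ : Ctx 𝒜} (hΓ : Ctx.UnionAll Γs Δ Γ) (C : Ty 𝒜) (Gs : ∀ i, IGraph (Γs i))
    (G₀ : IGraph Δ) : IGraph Γ :=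
  let f (i : Fin (𝒜 a).k) : (Gs i).Edge → Γ.Dom ⊕ Option ((Σ i, (Gs i).E) ⊕ G₀.E) :=
    Sum.map (fun w => ⟨w.1, hΓ.branch i w.1 w.2⟩) fun e => some (.inl ⟨i, e⟩)
  let f₀ : G₀.Edge → Γ.Dom ⊕ Option ((Σ i, (Gs i).E) ⊕ G₀.E) :=
    Sum.map (fun w => ⟨w.1, hΓ.main w.1 w.2⟩) fun e => some (.inr e)
  { V := Option ((Σ i, (Gs i).V) ⊕ G₀.V)
    E := Option ((Σ i, (Gs i).E) ⊕ G₀.E)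
    node := fun
      | none => .cond a (f₀ G₀.out) (fun i => f i (Gs i).out) (.inr none)
      | some (.inl ⟨i, v⟩) => ((Gs i).node v).map (f i)
      | some (.inr v) => (G₀.node v).map f₀
    ty := fun
      | none => C
      | some (.inl ⟨i, e⟩) => (Gs i).ty e
      | some (.inr e) => G₀.ty e
    box := fun
      | none => none
      | some (.inl ⟨i, e⟩) => ((Gs i).box e).map fun v => some (.inl ⟨i, v⟩)
      | some (.inr e) => (G₀.box e).map fun v => some (.inr v)
    out := .inr none }

/-- A new vertex `C^R_𝔸` (`none`), with the conclusion `none`. It delimits a box that contains all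
the edges of the graphs of the branches; every premise `x` of the `i`-th branch becomes an edge
that leaves a new vertex `P^R_𝔸` (both are called `⟨i, .inl x⟩`). -/
def IGraph.recur {n : ℕ} {𝒜 : Fin n → FreeAlg} {a : Fin n} {Γs : Fin (𝒜 a).k → Ctx 𝒜}
    {Δ Γ : Ctx 𝒜} (hΓ : Ctx.UnionAll Γs Δ Γ) (C : Ty 𝒜) (Gs : ∀ i, IGraph (Γs i))
    (G₀ : IGraph Δ) : IGraph Γ :=
  let f (i : Fin (𝒜 a).k) (e : (Gs i).Edge) : Γ.Dom ⊕ Option ((Σ i, (Gs i).Edge) ⊕ G₀.E) :=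
    .inr (some (.inl ⟨i, e⟩))
  let f₀ : G₀.Edge → Γ.Dom ⊕ Option ((Σ i, (Gs i).Edge) ⊕ G₀.E) :=
    Sum.map (fun w => ⟨w.1, hΓ.main w.1 w.2⟩) fun e => some (.inr e)
  { V := Option ((Σ i, (Γs i).Dom ⊕ (Gs i).V) ⊕ G₀.V)
    E := Option ((Σ i, (Gs i).Edge) ⊕ G₀.E)
    node := fun
      | none => .recur a (f₀ G₀.out) (fun i => f i (Gs i).out) (.inr none)
      | some (.inl ⟨i, .inl x⟩) =>
          .boxPrem a (.inl ⟨x.1, hΓ.branch i x.1 x.2⟩) (f i (.inl x))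
      | some (.inl ⟨i, .inr v⟩) => ((Gs i).node v).map (f i)
      | some (.inr v) => (G₀.node v).map f₀
    ty := fun
      | none => C
      | some (.inl ⟨i, e⟩) => (Gs i).edgeTy e
      | some (.inr e) => G₀.ty e
    box := fun
      | none => none
      | some (.inl ⟨i, e⟩) =>
          match (Gs i).boxPremise e with
          | none => some none
          | some v => some (some (.inl ⟨i, .inr v⟩))
      | some (.inr e) => (G₀.box e).map fun v => some (.inr v)
    out := .inr none }

/-- The interaction graph `G_π` of a type derivation `π`. -/
def Deriv.graph {n : ℕ} {𝒜 : Fin n → FreeAlg} {S : System 𝒜} {Γ : Ctx 𝒜} {M : Term 𝒜}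
    {A : Ty 𝒜} : Deriv S Γ M A → IGraph Γ
  | .ax x A hΓ' => .ax x A hΓ'
  | .weak x A _ hΓ' d => d.graph.weak x A hΓ'
  | .contr x y z A _ _ _ _ _ hΓ'' hΓ' _ d => d.graph.contr x y z A hΓ'' hΓ'
  | .lam (A := A) (B := B) d => d.graph.lam A B
  | .app (B := B) hΓ d₁ d₂ => .app hΓ B d₁.graph d₂.graph
  | .con a c i _ => .con Γ a c i
  | .cond (C := C) hΓ ds d => .cond hΓ C (fun i => (ds i).graph) d.graph
  | .recur (C := C) hΓ _ _ ds d => .recur hΓ C (fun i => (ds i).graph) d.graph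

/-! ### Algebraic context semantics -/

/-- The triples `(u, t, v)` in stacks; `u` is a term context and `t` a term for the same algebra
`𝒜 alg`, and `v` is a vertex. -/
structure Entry {n : ℕ} {𝒜 : Fin n → FreeAlg} {Γ : Ctx 𝒜} (G : IGraph Γ) where
  alg : Fin n
  ctx : AlgCtx (𝒜 alg)
  tm : AlgTerm (𝒜 alg)
  vtx : G.V

/-- The elements `(t, e, U, L)` of `S(G)`; `t` is a term for some algebra of the family. -/
structure Lab {n : ℕ} {𝒜 : Fin n → FreeAlg} {Γ : Ctx 𝒜} (G : IGraph Γ) where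
  term : Σ a, AlgTerm (𝒜 a)
  edge : G.Edge
  stack : List (Entry G)
  ctx : TyCtx 𝒜

/-- Finite ordered trees with vertices labelled in `S(G)`. -/
inductive Tree {n : ℕ} {𝒜 : Fin n → FreeAlg} {Γ : Ctx 𝒜} (G : IGraph Γ) : Type
  | node (l : Lab G) (k : ℕ) (f : Fin k → Tree G) : Tree G

/-- The label of the root. -/
def Tree.label {n : ℕ} {𝒜 : Fin n → FreeAlg} {Γ : Ctx 𝒜} {G : IGraph Γ} : Tree G → Lab G
  | .node l _ _ => l

/-- `L(T)`, the term in the label of the root. -/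
def Tree.value {n : ℕ} {𝒜 : Fin n → FreeAlg} {Γ : Ctx 𝒜} {G : IGraph Γ} (T : Tree G) :
    Σ a, AlgTerm (𝒜 a) :=
  T.label.term

/-- The tree with root label `l` and one immediate subtree `T`. -/
def Tree.unary {n : ℕ} {𝒜 : Fin n → FreeAlg} {Γ : Ctx 𝒜} {G : IGraph Γ} (l : Lab G) (T : Tree G) :
    Tree G :=
  .node l 1 fun _ => T

/-- `IsB T u S` says that `S = B(T, u, s)`, where `L(T) = u[s]`: travelling from the root of `T`
towards the leaves, guided by `u`, the last vertex found that corresponds to `u` is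
the root of `S`. -/
inductive IsB {n : ℕ} {𝒜 : Fin n → FreeAlg} {Γ : Ctx 𝒜} {G : IGraph Γ} {a : Fin n} :
    Tree G → AlgCtx (𝒜 a) → Tree G → Prop
  /-- The child carries the same term: go on. -/
  | pass {l : Lab G} {T S : Tree G} {u : AlgCtx (𝒜 a)} (ht : T.value = l.term) (h : IsB T u S) :
      IsB (.unary l T) u S
  /-- The children carry the arguments of the constructor at the root: choose the one at
  the position of the hole. -/
  | arg {l : Lab G} {c : Fin (𝒜 a).k} {f : Fin ((𝒜 a).arity c) → Tree G}
      {ts : Fin ((𝒜 a).arity c) → AlgTerm (𝒜 a)} {j : Fin ((𝒜 a).arity c)} {u : AlgCtx (𝒜 a)}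
      {S : Tree G} (hl : l.term = ⟨a, .mk c ts⟩) (hf : ∀ i, (f i).value = ⟨a, ts i⟩)
      (h : IsB (f j) u S) :
      IsB (.node l _ f) (.node c j (fun i => ts i) u) S
  /-- The hole of `u` is reached, and the children (if any) carry proper subterms: this is the vertex. -/
  | found {l : Lab G} {c : Fin (𝒜 a).k} {f : Fin ((𝒜 a).arity c) → Tree G}
      {ts : Fin ((𝒜 a).arity c) → AlgTerm (𝒜 a)}
      (hl : l.term = ⟨a, .mk c ts⟩) (hf : ∀ i, (f i).value = ⟨a, ts i⟩) :
      IsB (.node l _ f) .hole (.node l _ f)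

/-- The closure conditions `l ← l'` without side conditions, induced by the vertices labelled
`I_⊸`, `E_⊸` and `X`. -/
inductive Step {n : ℕ} {𝒜 : Fin n → FreeAlg} {Γ : Ctx 𝒜} (G : IGraph Γ) :
    Lab G → Lab G → Prop
  | lam_var {v : G.V} {e g h : G.Edge} {t U P} (hv : G.node v = .lam e g h)
      (hP : P.PosFocus (G.edgeTy e)) :
      Step G ⟨t, e, U, P⟩ ⟨t, h, U, .left P (G.edgeTy g)⟩
  | lam_arg {v : G.V} {e g h : G.Edge} {t U N} (hv : G.node v = .lam e g h)
      (hN : N.NegFocus (G.edgeTy e)) :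
      Step G ⟨t, h, U, .left N (G.edgeTy g)⟩ ⟨t, e, U, N⟩
  | lam_out {v : G.V} {e g h : G.Edge} {t U P} (hv : G.node v = .lam e g h)
      (hP : P.PosFocus (G.edgeTy g)) :
      Step G ⟨t, h, U, .right (G.edgeTy e) P⟩ ⟨t, g, U, P⟩
  | lam_body {v : G.V} {e g h : G.Edge} {t U N} (hv : G.node v = .lam e g h)
      (hN : N.NegFocus (G.edgeTy g)) :
      Step G ⟨t, g, U, N⟩ ⟨t, h, U, .right (G.edgeTy e) N⟩
  | app_arg {v : G.V} {e g h : G.Edge} {t U P} (hv : G.node v = .app e g h)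
      (hP : P.PosFocus (G.edgeTy g)) :
      Step G ⟨t, e, U, .left P (G.edgeTy h)⟩ ⟨t, g, U, P⟩
  | app_back {v : G.V} {e g h : G.Edge} {t U N} (hv : G.node v = .app e g h)
      (hN : N.NegFocus (G.edgeTy g)) :
      Step G ⟨t, g, U, N⟩ ⟨t, e, U, .left N (G.edgeTy h)⟩
  | app_fun {v : G.V} {e g h : G.Edge} {t U N} (hv : G.node v = .app e g h)
      (hN : N.NegFocus (G.edgeTy h)) :
      Step G ⟨t, e, U, .right (G.edgeTy g) N⟩ ⟨t, h, U, N⟩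
  | app_out {v : G.V} {e g h : G.Edge} {t U P} (hv : G.node v = .app e g h)
      (hP : P.PosFocus (G.edgeTy h)) :
      Step G ⟨t, h, U, P⟩ ⟨t, e, U, .right (G.edgeTy g) P⟩
  | dup_left {v : G.V} {e g h : G.Edge} {t U} (hv : G.node v = .dup e g h) :
      Step G ⟨t, e, U, .hole⟩ ⟨t, h, U, .hole⟩
  | dup_right {v : G.V} {e g h : G.Edge} {t U} (hv : G.node v = .dup e g h) :
      Step G ⟨t, g, U, .hole⟩ ⟨t, h, U, .hole⟩

/-- `InT G T` says that `T ∈ T(G)`: the smallest set of trees satisfying the closure conditions. -/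
inductive InT {n : ℕ} {𝒜 : Fin n → FreeAlg} {Γ : Ctx 𝒜} (G : IGraph Γ) : Tree G → Prop
  | step {T : Tree G} {l : Lab G} (hT : InT G T) (h : Step G l T.label) : InT G (.unary l T)
  /- Vertices `I^c_𝔸`, `c` of arity zero, outside every box. -/
  | con_zero {w : G.V} {a : Fin n} {c : Fin (𝒜 a).k} {e : G.Edge}
      {ts : Fin ((𝒜 a).arity c) → AlgTerm (𝒜 a)} {f : Fin ((𝒜 a).arity c) → Tree G}
      (hw : G.node w = .con a c e) (hc : (𝒜 a).arity c = 0) (hbox : G.boxPremise e = none) :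
      InT G (.node ⟨⟨a, .mk c ts⟩, e, [], .hole⟩ _ f)
  /- Vertices `I^c_𝔸`, `c` of arity zero, inside a box. -/
  | con_zero_box {w : G.V} {a : Fin n} {c : Fin (𝒜 a).k} {e : G.Edge}
      {ts : Fin ((𝒜 a).arity c) → AlgTerm (𝒜 a)} {f : Fin ((𝒜 a).arity c) → Tree G}
      {v : G.V} {e₀ : G.Edge} {b : Fin n} {u : AlgCtx (𝒜 b)} {t : AlgTerm (𝒜 b)}
      {U : List (Entry G)} {T₀ : Tree G}
      (hw : G.node w = .con a c e) (hc : (𝒜 a).arity c = 0) (hbox : G.boxPremise e = some v)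
      (hv : G.RecPremise v e₀) (hT₀ : InT G T₀) (hl₀ : T₀.label = ⟨⟨b, u.plug t⟩, e₀, U, .hole⟩) :
      InT G (.node ⟨⟨a, .mk c ts⟩, e, ⟨b, u, t, v⟩ :: U, .hole⟩ _ f)
  /- Vertices `I^c_𝔸`, `c` of positive arity. -/
  | con_succ {w : G.V} {a : Fin n} {c : Fin (𝒜 a).k} {e : G.Edge} {i : ℕ} {U : List (Entry G)}
      {ts : Fin ((𝒜 a).arity c) → AlgTerm (𝒜 a)} {f : Fin ((𝒜 a).arity c) → Tree G}
      (hw : G.node w = .con a c e) (hc : 0 < (𝒜 a).arity c)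
      (he : G.edgeTy e = Ty.arrows ((𝒜 a).arity c) (.base a i) (.base a i))
      (hf : ∀ j, InT G (f j))
      (hl : ∀ j, (f j).label =
        ⟨⟨a, ts j⟩, e, U, TyCtx.argAt (.base a i) j .hole (.base a i)⟩) :
      InT G (.node ⟨⟨a, .mk c ts⟩, e, U, TyCtx.arrows ((𝒜 a).arity c) (.base a i) .hole⟩ _ f)
  /- Vertices `C^N_𝔸`. -/
  | cond_out {v : G.V} {a : Fin n} {e₀ : G.Edge} {es : Fin (𝒜 a).k → G.Edge} {g : G.Edge}
      {c : Fin (𝒜 a).k} {ts : Fin ((𝒜 a).arity c) → AlgTerm (𝒜 a)} {U : List (Entry G)}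
      {T₀ T : Tree G} {t} {P : TyCtx 𝒜}
      (hv : G.node v = .cond a e₀ es g) (hT₀ : InT G T₀)
      (hl₀ : T₀.label = ⟨⟨a, .mk c ts⟩, e₀, U, .hole⟩)
      (hT : InT G T)
      (hl : T.label = ⟨t, es c, U, TyCtx.arrows ((𝒜 a).arity c) (G.edgeTy e₀) P⟩)
      (hP : P.PosFocus (G.edgeTy g)) :
      InT G (.unary ⟨t, g, U, P⟩ T)
  | cond_in {v : G.V} {a : Fin n} {e₀ : G.Edge} {es : Fin (𝒜 a).k → G.Edge} {g : G.Edge}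
      {c : Fin (𝒜 a).k} {ts : Fin ((𝒜 a).arity c) → AlgTerm (𝒜 a)} {U : List (Entry G)}
      {T₀ T : Tree G} {t} {N : TyCtx 𝒜}
      (hv : G.node v = .cond a e₀ es g) (hT₀ : InT G T₀)
      (hl₀ : T₀.label = ⟨⟨a, .mk c ts⟩, e₀, U, .hole⟩)
      (hT : InT G T) (hl : T.label = ⟨t, g, U, N⟩) (hN : N.NegFocus (G.edgeTy g)) :
      InT G (.unary ⟨t, es c, U, TyCtx.arrows ((𝒜 a).arity c) (G.edgeTy e₀) N⟩ T)
  | cond_arg {v : G.V} {a : Fin n} {e₀ : G.Edge} {es : Fin (𝒜 a).k → G.Edge} {g : G.Edge}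
      {c : Fin (𝒜 a).k} {ts : Fin ((𝒜 a).arity c) → AlgTerm (𝒜 a)} {U : List (Entry G)}
      {T₀ S : Tree G} {j : Fin ((𝒜 a).arity c)}
      (hv : G.node v = .cond a e₀ es g) (hT₀ : InT G T₀)
      (hl₀ : T₀.label = ⟨⟨a, .mk c ts⟩, e₀, U, .hole⟩)
      (hS : IsB T₀ (AlgCtx.arg c ts j) S) :
      InT G (.unary ⟨⟨a, ts j⟩, es c, U, TyCtx.argAt (G.edgeTy e₀) j .hole (G.edgeTy g)⟩ S)
  /- Vertices `C^R_𝔸`: from one copy of the box to another one. -/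
  | rec_up {v : G.V} {a : Fin n} {e₀ : G.Edge} {es : Fin (𝒜 a).k → G.Edge} {g : G.Edge}
      {c d : Fin (𝒜 a).k} {ts : Fin ((𝒜 a).arity c) → AlgTerm (𝒜 a)}
      {ss : Fin ((𝒜 a).arity d) → AlgTerm (𝒜 a)} {k : Fin ((𝒜 a).arity c)}
      {u : AlgCtx (𝒜 a)} {U : List (Entry G)} {T₀ T : Tree G} {r} {P : TyCtx 𝒜}
      (hv : G.node v = .recur a e₀ es g) (hT₀ : InT G T₀)
      (hl₀ : T₀.label = ⟨⟨a, u.plug (.mk c ts)⟩, e₀, U, .hole⟩) (hk : ts k = .mk d ss)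
      (hT : InT G T)
      (hl : T.label = ⟨r, es d, ⟨a, u.comp (AlgCtx.arg c ts k), ts k, v⟩ :: U,
        TyCtx.arrows ((𝒜 a).arity d) (G.edgeTy e₀)
          (TyCtx.arrows ((𝒜 a).arity d) (G.edgeTy g) P)⟩)
      (hP : P.PosFocus (G.edgeTy g)) :
      InT G (.unary ⟨r, es c, ⟨a, u, .mk c ts, v⟩ :: U,
        TyCtx.arrows ((𝒜 a).arity c) (G.edgeTy e₀)
          (TyCtx.argAt (G.edgeTy g) k P (G.edgeTy g))⟩ T)
  | rec_down {v : G.V} {a : Fin n} {e₀ : G.Edge} {es : Fin (𝒜 a).k → G.Edge} {g : G.Edge}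
      {c d : Fin (𝒜 a).k} {ts : Fin ((𝒜 a).arity c) → AlgTerm (𝒜 a)}
      {ss : Fin ((𝒜 a).arity d) → AlgTerm (𝒜 a)} {k : Fin ((𝒜 a).arity c)}
      {u : AlgCtx (𝒜 a)} {U : List (Entry G)} {T₀ T : Tree G} {r} {N : TyCtx 𝒜}
      (hv : G.node v = .recur a e₀ es g) (hT₀ : InT G T₀)
      (hl₀ : T₀.label = ⟨⟨a, u.plug (.mk c ts)⟩, e₀, U, .hole⟩) (hk : ts k = .mk d ss)
      (hT : InT G T)
      (hl : T.label = ⟨r, es c, ⟨a, u, .mk c ts, v⟩ :: U,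
        TyCtx.arrows ((𝒜 a).arity c) (G.edgeTy e₀)
          (TyCtx.argAt (G.edgeTy g) k N (G.edgeTy g))⟩)
      (hN : N.NegFocus (G.edgeTy g)) :
      InT G (.unary ⟨r, es d, ⟨a, u.comp (AlgCtx.arg c ts k), ts k, v⟩ :: U,
        TyCtx.arrows ((𝒜 a).arity d) (G.edgeTy e₀)
          (TyCtx.arrows ((𝒜 a).arity d) (G.edgeTy g) N)⟩ T)
  /- Vertices `C^R_𝔸`: leaving and entering the box through its conclusion. -/
  | rec_out {v : G.V} {a : Fin n} {e₀ : G.Edge} {es : Fin (𝒜 a).k → G.Edge} {g : G.Edge}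
      {c : Fin (𝒜 a).k} {ts : Fin ((𝒜 a).arity c) → AlgTerm (𝒜 a)}
      {U : List (Entry G)} {T₀ T : Tree G} {r} {P : TyCtx 𝒜}
      (hv : G.node v = .recur a e₀ es g) (hT₀ : InT G T₀)
      (hl₀ : T₀.label = ⟨⟨a, .mk c ts⟩, e₀, U, .hole⟩)
      (hT : InT G T)
      (hl : T.label = ⟨r, es c, ⟨a, .hole, .mk c ts, v⟩ :: U,
        TyCtx.arrows ((𝒜 a).arity c) (G.edgeTy e₀)
          (TyCtx.arrows ((𝒜 a).arity c) (G.edgeTy g) P)⟩)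
      (hP : P.PosFocus (G.edgeTy g)) :
      InT G (.unary ⟨r, g, U, P⟩ T)
  | rec_in {v : G.V} {a : Fin n} {e₀ : G.Edge} {es : Fin (𝒜 a).k → G.Edge} {g : G.Edge}
      {c : Fin (𝒜 a).k} {ts : Fin ((𝒜 a).arity c) → AlgTerm (𝒜 a)}
      {U : List (Entry G)} {T₀ T : Tree G} {r} {N : TyCtx 𝒜}
      (hv : G.node v = .recur a e₀ es g) (hT₀ : InT G T₀)
      (hl₀ : T₀.label = ⟨⟨a, .mk c ts⟩, e₀, U, .hole⟩)
      (hT : InT G T) (hl : T.label = ⟨r, g, U, N⟩) (hN : N.NegFocus (G.edgeTy g)) :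
      InT G (.unary ⟨r, es c, ⟨a, .hole, .mk c ts, v⟩ :: U,
        TyCtx.arrows ((𝒜 a).arity c) (G.edgeTy e₀)
          (TyCtx.arrows ((𝒜 a).arity c) (G.edgeTy g) N)⟩ T)
  /- Vertices `C^R_𝔸`: passing the subterms of the recurrence argument to the branches. -/
  | rec_arg {v : G.V} {a : Fin n} {e₀ : G.Edge} {es : Fin (𝒜 a).k → G.Edge} {g : G.Edge}
      {c : Fin (𝒜 a).k} {ts : Fin ((𝒜 a).arity c) → AlgTerm (𝒜 a)}
      {u : AlgCtx (𝒜 a)} {U : List (Entry G)} {T₀ S : Tree G} {j : Fin ((𝒜 a).arity c)}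
      (hv : G.node v = .recur a e₀ es g) (hT₀ : InT G T₀)
      (hl₀ : T₀.label = ⟨⟨a, u.plug (.mk c ts)⟩, e₀, U, .hole⟩)
      (hS : IsB T₀ (u.comp (AlgCtx.arg c ts j)) S) :
      InT G (.unary ⟨⟨a, ts j⟩, es c, ⟨a, u, .mk c ts, v⟩ :: U,
        TyCtx.argAt (G.edgeTy e₀) j .hole
          (Ty.arrows ((𝒜 a).arity c) (G.edgeTy g) (G.edgeTy g))⟩ S)
  /- Vertices `P^R_𝔸`. -/
  | box {w v : G.V} {a b : Fin n} {e g e₀ : G.Edge} {u : AlgCtx (𝒜 b)} {s : AlgTerm (𝒜 b)}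
      {U : List (Entry G)} {T₀ T : Tree G} {t}
      (hw : G.node w = .boxPrem a e g) (hbox : G.boxPremise g = some v) (hv : G.RecPremise v e₀)
      (hT₀ : InT G T₀) (hl₀ : T₀.label = ⟨⟨b, u.plug s⟩, e₀, U, .hole⟩)
      (hT : InT G T) (hl : T.label = ⟨t, e, U, .hole⟩) :
      InT G (.unary ⟨t, g, ⟨b, u, s, v⟩ :: U, .hole⟩ T)

/-- The context semantics `T(G)`. -/
def trees {n : ℕ} {𝒜 : Fin n → FreeAlg} {Γ : Ctx 𝒜} (G : IGraph Γ) : Set (Tree G) :=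
  {T | InT G T}

end LinRec

/-!
A tree of `T(G)` is a derivation of its root label, and the rules are functional: a derivable label
is determined by its configuration, that is, by its edge, stack and type context. The term of a
label is no larger than the number of constructor labels among its ancestors, because every ancestor
passes on each constructor of its term at most once: only labels of word types can be duplicated, by
contraction or by a box, and the ancestors of such a label form a chain.

By ramification, the part of the stack that starts at the innermost box of tier at most `i` is,
for an ancestor of a label of tier `i`, a suffix of the same part for the label itself, so it is
known up to its length. The entries above that part belong to boxes of tier greater than `i`;
there are at most `d` of them, `d` being the recursion depth, and each can take at most `N`
values, `N` being a bound on the recurrence arguments of tier greater than `i`. Hence each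
constructor vertex contributes at most `N ^ d` ancestors, and there are at most `|M|` such
vertices. So a bound `N` for tiers greater than `i` gives `|M| * N ^ d` for tier `i`, and
induction downwards from the highest tier `I` bounds the term of every label
by `|M| ^ ((1 + d) ^ I)`.
-/

namespace LinRec

section WellFormed

variable {n : ℕ} {𝒜 : Fin n → FreeAlg} {Γ : Ctx 𝒜}

/-- The roles an edge can play at an incident vertex. -/
inductive Port
  | weak | dupL | dupR | dupIn | lamVar | lamBody | lamOut | appFun | appArg | appOut | con
  | condArg | condBr (i : ℕ) | condOut | recArg | recBr (i : ℕ) | recOut | boxIn | boxOut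

/-- Whether the edge at a port leaves the vertex. -/
def Port.isOut : Port → Bool
  | .dupL | .dupR | .lamVar | .lamOut | .appOut | .con | .condOut | .recOut | .boxOut => true
  | _ => false

/-- The incidence relation of a vertex: the edge `x` is attached to the port `p`. -/
def Node.At {E : Type} (N : Node 𝒜 E) (p : Port) (x : E) : Prop :=
  match N with
  | .weak e => p = .weak ∧ x = e
  | .dup e g h => (p = .dupL ∧ x = e) ∨ (p = .dupR ∧ x = g) ∨ (p = .dupIn ∧ x = h)
  | .lam e g h => (p = .lamVar ∧ x = e) ∨ (p = .lamBody ∧ x = g) ∨ (p = .lamOut ∧ x = h)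
  | .app e g h => (p = .appFun ∧ x = e) ∨ (p = .appArg ∧ x = g) ∨ (p = .appOut ∧ x = h)
  | .con _ _ e => p = .con ∧ x = e
  | .cond a e₀ es g =>
      (p = .condArg ∧ x = e₀) ∨ (p = .condOut ∧ x = g) ∨ ∃ c : Fin (𝒜 a).k, p = .condBr c ∧ x = es c
  | .recur a e₀ es g =>
      (p = .recArg ∧ x = e₀) ∨ (p = .recOut ∧ x = g) ∨ ∃ c : Fin (𝒜 a).k, p = .recBr c ∧ x = es c
  | .boxPrem _ e g => (p = .boxIn ∧ x = e) ∨ (p = .boxOut ∧ x = g)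

theorem Node.At.exists_of_map {E F : Type} {f : E → F} {N : Node 𝒜 E} {p : Port} {x : F}
    (h : (N.map f).At p x) : ∃ e, x = f e ∧ N.At p e := by
  cases N <;> simp only [Node.map, Node.At] at h ⊢ <;> aesop

/-- The places where an edge can start or end: the vertices labelled `P` and `C`, which are implicit
in `IGraph`, and the ports of the internal vertices. -/
inductive IGraph.End (G : IGraph Γ) : Type
  | premise (x : Γ.Dom)
  | conclusion
  | port (v : G.V) (p : Port)

/-- Whether the edge at an end starts (rather than ends) there. -/
def IGraph.End.isOut {G : IGraph Γ} : G.End → Bool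
  | .premise _ => true
  | .conclusion => false
  | .port _ p => p.isOut

/-- The edge `e` starts or ends at the given end. -/
def IGraph.Incident (G : IGraph Γ) : G.End → G.Edge → Prop
  | .premise x, e => e = .inl x
  | .conclusion, e => e = G.out
  | .port v p, e => (G.node v).At p e

/-- Either there is no box, or the given vertex delimits a box that is contained in at most `k`
boxes, itself included. -/
inductive BoxDepth (G : IGraph Γ) : ℕ → Option G.V → Prop
  | none {k : ℕ} : BoxDepth G k none
  | some {k : ℕ} {v : G.V} {a : Fin n} {e₀ : G.Edge} {es : Fin (𝒜 a).k → G.Edge} {g : G.Edge}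
      (hv : G.node v = .recur a e₀ es g) (h : BoxDepth G k (G.boxPremise e₀)) :
      BoxDepth G (k + 1) (some v)

theorem BoxDepth.mono {G : IGraph Γ} {k : ℕ} {o : Option G.V} (h : BoxDepth G k o) {l : ℕ}
    (hl : k ≤ l) : BoxDepth G l o := by
  induction h generalizing l with
  | none => exact .none
  | some hv _ ih =>
    obtain ⟨l, rfl⟩ := Nat.exists_eq_add_of_le' (Nat.one_le_of_lt hl)
    exact .some hv (ih (by omega))

/-- The local typing and box conditions at a vertex `v` with label `N`; `D` is the set of the types
that may be duplicated and `I` bounds the tiers of recursions. -/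
def IGraph.NodeOK (G : IGraph Γ) (D : Set (Ty 𝒜)) (I : ℕ) (v : G.V) : Node 𝒜 G.Edge → Prop
  | .weak _ => True
  | .dup e g h => G.edgeTy e = G.edgeTy h ∧ G.edgeTy g = G.edgeTy h ∧ G.edgeTy h ∈ D ∧
      G.boxPremise e = G.boxPremise h ∧ G.boxPremise g = G.boxPremise h
  | .lam e g h => G.edgeTy h = .arr (G.edgeTy e) (G.edgeTy g) ∧
      G.boxPremise e = G.boxPremise h ∧ G.boxPremise g = G.boxPremise h
  | .app e g h => G.edgeTy e = .arr (G.edgeTy g) (G.edgeTy h) ∧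
      G.boxPremise e = G.boxPremise h ∧ G.boxPremise g = G.boxPremise h
  | .con a c e => ∃ i, G.edgeTy e = Ty.arrows ((𝒜 a).arity c) (.base a i) (.base a i)
  | .cond a e₀ es g => (∃ m, G.edgeTy e₀ = .base a m) ∧
      (∀ c, G.edgeTy (es c) = Ty.arrows ((𝒜 a).arity c) (G.edgeTy e₀) (G.edgeTy g)) ∧
      G.boxPremise e₀ = G.boxPremise g ∧ ∀ c, G.boxPremise (es c) = G.boxPremise g
  | .recur a e₀ es g =>
      (∃ m, G.edgeTy e₀ = .base a m ∧ (G.edgeTy g).level < m ∧ m ≤ I) ∧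
      (∀ c, G.edgeTy (es c) = Ty.arrows ((𝒜 a).arity c) (G.edgeTy e₀)
        (Ty.arrows ((𝒜 a).arity c) (G.edgeTy g) (G.edgeTy g))) ∧
      G.boxPremise e₀ = G.boxPremise g ∧ ∀ c, G.boxPremise (es c) = some v
  | .boxPrem _ e g => G.edgeTy e = G.edgeTy g ∧ G.edgeTy g ∈ D ∧
      ∃ v' b e₀ es g', G.boxPremise g = some v' ∧ G.node v' = .recur b e₀ es g' ∧
        G.boxPremise e = G.boxPremise e₀

/-- The invariant of the graphs of derivations: every edge has one source and one target, the
conclusion has type `A` and lies outside every box, vertices satisfy `IGraph.NodeOK`, and at most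
`R` boxes are nested around an edge. -/
structure IGraph.WF (G : IGraph Γ) (A : Ty 𝒜) (D : Set (Ty 𝒜)) (R I : ℕ) : Prop where
  uniq : ∀ {z z' : G.End} {e}, G.Incident z e → G.Incident z' e → z.isOut = z'.isOut → z = z'
  outBox : G.boxPremise G.out = none
  outTy : G.edgeTy G.out = A
  ok : ∀ v, G.NodeOK D I v (G.node v)
  depth : ∀ e, BoxDepth G R (G.boxPremise e)

theorem IGraph.NodeOK.mono {G : IGraph Γ} {D : Set (Ty 𝒜)} {I J : ℕ} {v : G.V}
    {N : Node 𝒜 G.Edge} (h : G.NodeOK D I v N) (hIJ : I ≤ J) : G.NodeOK D J v N := by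
  cases N with
  | recur a e₀ es g =>
    obtain ⟨⟨m, hty, hlvl, hm⟩, hbr⟩ := h
    exact ⟨⟨m, hty, hlvl, hm.trans hIJ⟩, hbr⟩
  | _ => exact h

theorem IGraph.WF.mono {G : IGraph Γ} {A : Ty 𝒜} {D : Set (Ty 𝒜)} {R S I J : ℕ}
    (h : G.WF A D R I) (hR : R ≤ S) (hI : I ≤ J) : G.WF A D S J where
  uniq := h.uniq
  outBox := h.outBox
  outTy := h.outTy
  ok v := (h.ok v).mono hI
  depth e := (h.depth e).mono hR

end WellFormed

/-! ### Gluing graphs -/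

section Gluing

variable {n : ℕ} {𝒜 : Fin n → FreeAlg} {Γ : Ctx 𝒜}

/-- An end that belongs to `G` itself and not to the graphs glued into it, where `fresh` is the set
of the vertices that do not come from those graphs. -/
def IGraph.End.IsFresh {G : IGraph Γ} (fresh : Set G.V) : G.End → Prop
  | .port v _ => v ∈ fresh
  | _ => True

/-- A copy of a graph `part` inside `G`, lying in the box of `host` (if any). At the fresh ends of
`G`, the conclusion of the copy ends at `atOut` and its premises start at `atPrem`. -/
structure IGraph.Copy (G : IGraph Γ) (fresh : Set G.V) where
  {Δ : Ctx 𝒜}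
  part : IGraph Δ
  onV : part.V → G.V
  onE : part.Edge → G.Edge
  host : Option G.V
  atOut : G.End
  atPrem : Δ.Dom → G.End
  node_onV : ∀ v, G.node (onV v) = (part.node v).map onE
  edgeTy_onE : ∀ e, G.edgeTy (onE e) = part.edgeTy e
  boxPremise_onE : ∀ e, G.boxPremise (onE e) = ((part.boxPremise e).map onV).or host
  onE_injective : Function.Injective onE
  isOut_atOut : atOut.isOut = false
  isOut_atPrem : ∀ x, (atPrem x).isOut = true
  incident_fresh : ∀ {z e}, z.IsFresh fresh → G.Incident z (onE e) →
    (e = part.out ∧ z = atOut) ∨ ∃ x, e = .inl x ∧ z = atPrem x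

namespace IGraph.Copy

variable {G : IGraph Γ} {fresh : Set G.V} (C : G.Copy fresh)

/-- The end of `G` at which an end of the copied graph is found. -/
def onEnd : C.part.End → G.End
  | .premise x => C.atPrem x
  | .conclusion => C.atOut
  | .port v p => .port (C.onV v) p

theorem isOut_onEnd (z : C.part.End) : (C.onEnd z).isOut = z.isOut :=
  match z with
  | .premise x => C.isOut_atPrem x
  | .conclusion => C.isOut_atOut
  | .port _ _ => rfl

theorem boxPremise_onE_of_eq_none {e : C.part.Edge} (he : C.part.boxPremise e = none) :
    G.boxPremise (C.onE e) = C.host := by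
  rw [C.boxPremise_onE, he]
  rfl

theorem nodeOK_onV {D : Set (Ty 𝒜)} {I : ℕ} {v : C.part.V}
    (h : C.part.NodeOK D I v (C.part.node v)) : G.NodeOK D I (C.onV v) (G.node (C.onV v)) := by
  rw [C.node_onV]
  generalize C.part.node v = N at h ⊢
  cases N with
  | boxPrem a e g =>
    obtain ⟨hty, hD, v', b, e₀, es, g', hbox, hv', he⟩ := h
    exact ⟨by simp only [C.edgeTy_onE, hty], by rwa [C.edgeTy_onE], C.onV v', b, C.onE e₀,
      fun i => C.onE (es i), C.onE g', by simp [C.boxPremise_onE, hbox],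
      by rw [C.node_onV, hv']; rfl, by simp only [C.boxPremise_onE, he]⟩
  | _ => simp_all [IGraph.NodeOK, Node.map, C.edgeTy_onE, C.boxPremise_onE]

theorem boxDepth {r s : ℕ} {o : Option C.part.V} (h : BoxDepth C.part r o)
    (hs : BoxDepth G s C.host) : BoxDepth G (r + s) ((o.map C.onV).or C.host) := by
  induction h with
  | none => exact hs.mono (Nat.le_add_left _ _)
  | @some r v a e₀ es g hv _ ih =>
    rw [Nat.add_right_comm]
    exact .some (a := a) (e₀ := C.onE e₀) (es := C.onE ∘ es) (g := C.onE g)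
      (by rw [C.node_onV, hv]; rfl) (by rwa [C.boxPremise_onE])

end IGraph.Copy

/-- A decomposition of `G` into copies of graphs and fresh vertices. -/
structure IGraph.Gluing (G : IGraph Γ) (K : Type) where
  fresh : Set G.V
  copy : K → G.Copy fresh
  eq_of_onE_eq : ∀ {k l e e'}, (copy k).onE e = (copy l).onE e' → k = l
  mem_fresh_or : ∀ v, v ∈ fresh ∨ ∃ k w, v = (copy k).onV w
  boxPremise_eq_none_or : ∀ e, G.boxPremise e = none ∨ ∃ k x, e = (copy k).onE x
  exists_ends : ∀ {e}, (∀ k x, e ≠ (copy k).onE x) → ∃ src tgt : G.End, src.isOut = true ∧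
    tgt.isOut = false ∧ ∀ z, z.IsFresh fresh → G.Incident z e → z = src ∨ z = tgt

namespace IGraph.Gluing

variable {G : IGraph Γ} {K : Type} (L : G.Gluing K)

theorem isFresh_or (z : G.End) :
    z.IsFresh L.fresh ∨ ∃ k w p, z = (L.copy k).onEnd (.port w p) := by
  rcases z with x | _ | ⟨v, p⟩
  · exact .inl trivial
  · exact .inl trivial
  · exact (L.mem_fresh_or v).imp_right fun ⟨k, w, hw⟩ => ⟨k, w, p, hw ▸ rfl⟩

theorem exists_incident_onE {k : K} {w : (L.copy k).part.V} {p : Port} {e : G.Edge}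
    (h : G.Incident ((L.copy k).onEnd (.port w p)) e) :
    ∃ x, e = (L.copy k).onE x ∧ (L.copy k).part.Incident (.port w p) x := by
  simp only [IGraph.Copy.onEnd, IGraph.Incident, IGraph.Copy.node_onV] at h
  exact h.exists_of_map

theorem exists_onEnd_eq {z : G.End} {k : K} {x : (L.copy k).part.Edge}
    (h : G.Incident z ((L.copy k).onE x)) :
    ∃ y, (L.copy k).part.Incident y x ∧ z = (L.copy k).onEnd y := by
  rcases L.isFresh_or z with hz | ⟨l, w, p, rfl⟩
  · rcases (L.copy k).incident_fresh hz h with ⟨rfl, rfl⟩ | ⟨y, rfl, rfl⟩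
    · exact ⟨.conclusion, rfl, rfl⟩
    · exact ⟨.premise y, rfl, rfl⟩
  · obtain ⟨x', hx, hw⟩ := L.exists_incident_onE h
    obtain rfl := L.eq_of_onE_eq hx
    obtain rfl := (L.copy k).onE_injective hx
    exact ⟨.port w p, hw, rfl⟩

theorem wf {A : Ty 𝒜} {D : Set (Ty 𝒜)} {R I : ℕ}
    (hcopy : ∀ k, ∃ B r s, (L.copy k).part.WF B D r I ∧ BoxDepth G s (L.copy k).host ∧ r + s ≤ R)
    (hfresh : ∀ v ∈ L.fresh, G.NodeOK D I v (G.node v)) (houtBox : G.boxPremise G.out = none)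
    (houtTy : G.edgeTy G.out = A) : G.WF A D R I where
  uniq {z z' e} h h' hz := by
    by_cases he : ∃ k x, e = (L.copy k).onE x
    · obtain ⟨k, x, rfl⟩ := he
      obtain ⟨B, r, s, hwf, -⟩ := hcopy k
      obtain ⟨y, hy, rfl⟩ := L.exists_onEnd_eq h
      obtain ⟨y', hy', rfl⟩ := L.exists_onEnd_eq h'
      rw [(L.copy k).isOut_onEnd, (L.copy k).isOut_onEnd] at hz
      rw [hwf.uniq hy hy' hz]
    · have isFresh {z : G.End} (h : G.Incident z e) : z.IsFresh L.fresh :=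
        (L.isFresh_or z).resolve_right <| by
          rintro ⟨k, w, p, rfl⟩
          obtain ⟨x, hx, -⟩ := L.exists_incident_onE h
          exact he ⟨k, x, hx⟩
      push Not at he
      obtain ⟨src, tgt, hsrc, htgt, hends⟩ := L.exists_ends he
      rcases hends z (isFresh h) h with rfl | rfl <;> rcases hends z' (isFresh h') h' with rfl | rfl
      all_goals first | rfl | simp [hsrc, htgt] at hz
  outBox := houtBox
  outTy := houtTy
  ok v := by
    rcases L.mem_fresh_or v with hv | ⟨k, w, rfl⟩
    · exact hfresh v hv
    · obtain ⟨B, r, s, hwf, -⟩ := hcopy k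
      exact (L.copy k).nodeOK_onV (hwf.ok w)
  depth e := by
    rcases L.boxPremise_eq_none_or e with he | ⟨k, x, rfl⟩
    · exact he ▸ .none
    · obtain ⟨B, r, s, hwf, hs, hle⟩ := hcopy k
      rw [(L.copy k).boxPremise_onE]
      exact ((L.copy k).boxDepth (hwf.depth x) hs).mono hle

end IGraph.Gluing

end Gluing

section Constructors

variable {n : ℕ} {𝒜 : Fin n → FreeAlg} {Γ Γ' Γ₁ Γ₂ Δ : Ctx 𝒜}

theorem IGraph.edgeTy_inl_congr {G : IGraph Γ} {G' : IGraph Γ'} {x : Γ.Dom} {y : Γ'.Dom}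
    (h : Γ' y.1 = Γ x.1) : G'.edgeTy (.inl y) = G.edgeTy (.inl x) := by
  simp only [IGraph.edgeTy, h]

theorem IGraph.edgeTy_inl {G : IGraph Γ} {x : Γ.Dom} {A : Ty 𝒜} :
    G.edgeTy (.inl x) = A ↔ Γ x.1 = some A := by
  simp only [IGraph.edgeTy, Option.eq_some_iff_get_eq, x.2, exists_true_left]

theorem Ctx.eq_of_forall_eq_some {x y : ℕ} (hx : (Γ₁ x).isSome)
    (h : ∀ A, Γ₁ x = some A → Γ y = some A) : Γ y = Γ₁ x := by
  obtain ⟨A, hA⟩ := Option.isSome_iff_exists.mp hx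
  rw [hA, h A hA]

theorem Ctx.Union.eq_left (h : Ctx.Union Γ₁ Γ₂ Γ) (w : Γ₁.Dom) : Γ w.1 = Γ₁ w.1 :=
  Ctx.eq_of_forall_eq_some w.2 fun A hA => (h.2 w.1 A).mpr (.inl hA)

theorem Ctx.Union.eq_right (h : Ctx.Union Γ₁ Γ₂ Γ) (w : Γ₂.Dom) : Γ w.1 = Γ₂ w.1 :=
  Ctx.eq_of_forall_eq_some w.2 fun A hA => (h.2 w.1 A).mpr (.inr hA)

theorem Ctx.ne_of_eq_none {x : ℕ} (hx : Γ x = none) (w : Γ.Dom) : w.1 ≠ x := by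
  rintro rfl
  simpa [hx] using w.2

theorem Ctx.Union.exists_dom (h : Ctx.Union Γ₁ Γ₂ Γ) (x : Γ.Dom) :
    (∃ w : Γ₁.Dom, w.1 = x.1) ∨ ∃ w : Γ₂.Dom, w.1 = x.1 := by
  obtain ⟨A, hA⟩ := Option.isSome_iff_exists.mp x.2
  exact ((h.2 x.1 A).mp hA).imp (fun h => ⟨⟨x.1, by rw [h]; rfl⟩, rfl⟩)
    fun h => ⟨⟨x.1, by rw [h]; rfl⟩, rfl⟩

section UnionAll

variable {k : ℕ} {Γs : Fin k → Ctx 𝒜}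

theorem Ctx.UnionAll.eq_branch (h : Ctx.UnionAll Γs Δ Γ) {i : Fin k} (w : (Γs i).Dom) :
    Γ w.1 = Γs i w.1 :=
  Ctx.eq_of_forall_eq_some w.2 fun A hA => (h.2.2 w.1 A).mpr (.inl ⟨i, hA⟩)

theorem Ctx.UnionAll.eq_main (h : Ctx.UnionAll Γs Δ Γ) (w : Δ.Dom) : Γ w.1 = Δ w.1 :=
  Ctx.eq_of_forall_eq_some w.2 fun A hA => (h.2.2 w.1 A).mpr (.inr hA)

theorem Ctx.UnionAll.exists_dom (h : Ctx.UnionAll Γs Δ Γ) (x : Γ.Dom) :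
    (∃ i, ∃ w : (Γs i).Dom, w.1 = x.1) ∨ ∃ w : Δ.Dom, w.1 = x.1 := by
  obtain ⟨A, hA⟩ := Option.isSome_iff_exists.mp x.2
  exact ((h.2.2 x.1 A).mp hA).imp (fun ⟨i, h⟩ => ⟨i, ⟨x.1, by rw [h]; rfl⟩, rfl⟩)
    fun h => ⟨⟨x.1, by rw [h]; rfl⟩, rfl⟩

theorem Ctx.UnionAll.branch_unique (h : Ctx.UnionAll Γs Δ Γ) {i j : Fin k} (w : (Γs i).Dom)
    (w' : (Γs j).Dom) (hw : w.1 = w'.1) : i = j := by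
  by_contra hij
  rcases h.1 i j hij w.1 with hnone | hnone
  · exact Ctx.ne_of_eq_none hnone w rfl
  · exact Ctx.ne_of_eq_none hnone w' hw.symm

end UnionAll

theorem Ctx.insert_of_ne {x y : ℕ} (A : Ty 𝒜) (h : y ≠ x) : Γ.insert x A y = Γ y := by
  simp [Ctx.insert, h]

theorem Ctx.insert_self {x : ℕ} (A : Ty 𝒜) : Γ.insert x A x = some A := by
  simp [Ctx.insert]

theorem IGraph.ax_wf (x : ℕ) (A : Ty 𝒜) (hΓ' : Γ' = Ctx.empty.insert x A) (D : Set (Ty 𝒜))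
    (R I : ℕ) : (IGraph.ax x A hΓ').WF A D R I where
  uniq {z z' e} h h' hz := by
    rcases z with y | _ | ⟨⟨⟩, _⟩ <;> rcases z' with y' | _ | ⟨⟨⟩, _⟩
    · cases h; cases h'; rfl
    · cases hz
    · cases hz
    · rfl
  outBox := rfl
  outTy := IGraph.edgeTy_inl.mpr (hΓ' ▸ Ctx.insert_self A)
  ok v := v.elim
  depth
    | .inl _ => .none

theorem IGraph.con_wf (a : Fin n) (c : Fin (𝒜 a).k) (i : ℕ) (D : Set (Ty 𝒜)) (R I : ℕ) :
    (IGraph.con Γ a c i).WF (Ty.arrows ((𝒜 a).arity c) (.base a i) (.base a i)) D R I where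
  uniq {z z' e} h h' hz := by
    rcases z with y | _ | ⟨⟨⟩, p⟩ <;> rcases z' with y' | _ | ⟨⟨⟩, p'⟩ <;>
      simp_all [IGraph.Incident, IGraph.con, Node.At, IGraph.End.isOut, Port.isOut]
  outBox := rfl
  outTy := rfl
  ok _ := ⟨i, rfl⟩
  depth
    | .inl _ => .none
    | .inr _ => .none

/-- The inclusion of the variables of a context into those of a context that extends it. -/
def Ctx.incl (hΔ : ∀ w : Δ.Dom, Γ w.1 = Δ w.1) (w : Δ.Dom) : Γ.Dom :=
  ⟨w.1, (hΔ w).symm ▸ w.2⟩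

theorem Ctx.sumMap_incl_injective {E F : Type} (hΔ : ∀ w : Δ.Dom, Γ w.1 = Δ w.1) {f : E → F}
    (hf : Function.Injective f) : Function.Injective (Sum.map (Ctx.incl hΔ) f) :=
  Sum.map_injective.mpr ⟨fun _ _ h => Subtype.ext (congrArg Subtype.val h :), hf⟩

theorem Ctx.sumMap_incl_ne {E₁ E₂ F : Type} (hdisj : ∀ x, Γ₁ x = none ∨ Γ₂ x = none)
    (h₁ : ∀ w : Γ₁.Dom, Γ w.1 = Γ₁ w.1) (h₂ : ∀ w : Γ₂.Dom, Γ w.1 = Γ₂ w.1) {f₁ : E₁ → F}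
    {f₂ : E₂ → F} (hf : ∀ e e', f₁ e ≠ f₂ e') (x : Γ₁.Dom ⊕ E₁) (y : Γ₂.Dom ⊕ E₂) :
    Sum.map (Ctx.incl h₁) f₁ x ≠ Sum.map (Ctx.incl h₂) f₂ y := by
  rcases x with ⟨x, hx⟩ | e <;> rcases y with ⟨y, hy⟩ | e' <;>
    simp only [Sum.map_inl, Sum.map_inr, ne_eq, Sum.inl.injEq, Sum.inr.injEq, reduceCtorEq,
      not_false_eq_true, hf, Ctx.incl, Subtype.mk.injEq]
  rintro rfl
  rcases hdisj x with h | h <;> simp [h] at hx hy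

/-- A copy of `part` outside all boxes of `G`, with premises among those of `G`. -/
def IGraph.Copy.ofIncl {G : IGraph Γ} {fresh : Set G.V} (part : IGraph Δ)
    (hΔ : ∀ w : Δ.Dom, Γ w.1 = Δ w.1) (onV : part.V → G.V) (onE : part.E → G.E) (atOut : G.End)
    (node_onV : ∀ v, G.node (onV v) = (part.node v).map (Sum.map (Ctx.incl hΔ) onE))
    (ty_onE : ∀ e, G.ty (onE e) = part.ty e)
    (box_onE : ∀ e, G.box (onE e) = (part.box e).map onV)
    (onE_injective : Function.Injective onE) (isOut_atOut : atOut.isOut = false)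
    (out_eq : ∀ {e}, Sum.map (Ctx.incl hΔ) onE e = G.out → e = part.out ∧ .conclusion = atOut)
    (at_fresh : ∀ {v p e}, v ∈ fresh → (G.node v).At p (Sum.map (Ctx.incl hΔ) onE e) →
      e = part.out ∧ .port v p = atOut) : G.Copy fresh where
  part := part
  onV := onV
  onE := Sum.map (Ctx.incl hΔ) onE
  host := none
  atOut := atOut
  atPrem w := .premise (Ctx.incl hΔ w)
  node_onV := node_onV
  edgeTy_onE
    | .inl w => IGraph.edgeTy_inl_congr (hΔ w)
    | .inr e => ty_onE e
  boxPremise_onE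
    | .inl _ => rfl
    | .inr e => (box_onE e).trans (Option.or_none ..).symm
  onE_injective := Ctx.sumMap_incl_injective hΔ onE_injective
  isOut_atOut := isOut_atOut
  isOut_atPrem _ := rfl
  incident_fresh {z e} hz h := by
    rcases z with y | _ | ⟨v, p⟩
    · rcases e with w | e <;> cases h
      exact .inr ⟨w, rfl, rfl⟩
    · exact .inl (out_eq h)
    · exact .inl (at_fresh hz h)

/-- The graph of a weakening consists of the graph of the premise and a vertex `W`. -/
def IGraph.weakGluing {x : ℕ} (A : Ty 𝒜) (hx : Γ x = none) (G : IGraph Γ) :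
    (G.weak x A rfl).Gluing Unit where
  fresh := {none}
  copy _ := .ofIncl G (fun w => Ctx.insert_of_ne A (Ctx.ne_of_eq_none hx w)) some id .conclusion
    (fun _ => rfl) (fun _ => rfl) (fun _ => rfl) Function.injective_id rfl
    (fun h => ⟨Ctx.sumMap_incl_injective _ Function.injective_id h, rfl⟩) (by
      rintro _ p (w | e) rfl ⟨-, h⟩ <;> cases h
      exact absurd rfl (Ctx.ne_of_eq_none hx w))
  eq_of_onE_eq _ := rfl
  mem_fresh_or
    | none => .inl rfl
    | some v => .inr ⟨(), v, rfl⟩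
  boxPremise_eq_none_or
    | .inl _ => .inl rfl
    | .inr e => .inr ⟨(), .inr e, rfl⟩
  exists_ends {e} he := by
    rcases e with y | e
    · refine ⟨.premise y, .port none .weak, rfl, rfl, ?_⟩
      rintro (y' | _ | ⟨v, p⟩) hz h
      · cases h
        exact .inl rfl
      · exact absurd h (he () _)
      · obtain rfl := hz
        exact .inr (congrArg _ h.1)
    · exact absurd rfl (he () (.inr e))

theorem Ctx.insert_insert_ne {x y z w : ℕ} {A : Ty 𝒜} (hz : Γ z = none)
    (hw : ((Γ.insert x A).insert y A w).isSome) (hx : w ≠ x) (hy : w ≠ y) : w ≠ z := by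
  rintro rfl
  simp [Ctx.insert, hx, hy, hz] at hw

section Contraction

variable {x y z : ℕ} {A : Ty 𝒜} (G : IGraph ((Γ.insert x A).insert y A))

/-- The position, in the graph of a contraction, of the edges of the graph of its premise. -/
def IGraph.contrEdge : G.Edge → (Γ.insert z A).Dom ⊕ (Bool ⊕ G.E)
  | .inl w =>
    if hx : w.1 = x then .inr (.inl false)
    else if hy : w.1 = y then .inr (.inl true)
    else .inl ⟨w.1, Ctx.isSome_insert Γ z A w.1 (Ctx.isSome_of_insert Γ x A w.1 hx
      (Ctx.isSome_of_insert (Γ.insert x A) y A w.1 hy w.2))⟩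
  | .inr e => .inr (.inr e)

theorem IGraph.contr_out_eq : (G.contr x y z A rfl rfl).out = G.contrEdge G.out := by
  rcases hG : G.out with w | e <;> simp only [IGraph.contr, hG, IGraph.contrEdge]

theorem IGraph.contrEdge_injective : Function.Injective (G.contrEdge (z := z)) := by
  rintro (⟨w, hw⟩ | e) (⟨w', hw'⟩ | e') he <;> simp only [IGraph.contrEdge] at he <;>
    (try split_ifs at he) <;> simp_all

theorem IGraph.edgeTy_contrEdge (hz : Γ z = none) (e : G.Edge) :
    (G.contr x y z A rfl rfl).edgeTy (G.contrEdge e) = G.edgeTy e := by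
  rcases e with ⟨w, hw⟩ | e
  · simp only [IGraph.contrEdge]
    split_ifs with hx hy
    · exact (IGraph.edgeTy_inl.mpr (by simp [Ctx.insert, hx, IGraph.edgeTy, IGraph.contr])).symm
    · exact (IGraph.edgeTy_inl.mpr (by simp [Ctx.insert, hy, IGraph.edgeTy, IGraph.contr])).symm
    · exact IGraph.edgeTy_inl_congr
        (by simp [Ctx.insert, hx, hy, Ctx.insert_insert_ne hz hw hx hy])
  · rfl

/-- The source, in the graph of a contraction, of the edge of a variable of the premise. -/
def IGraph.contrSource (w : ((Γ.insert x A).insert y A).Dom) : (G.contr x y z A rfl rfl).End :=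
  if hx : w.1 = x then .port none .dupL
  else if hy : w.1 = y then .port none .dupR
  else .premise ⟨w.1, Ctx.isSome_insert Γ z A w.1 (Ctx.isSome_of_insert Γ x A w.1 hx
    (Ctx.isSome_of_insert (Γ.insert x A) y A w.1 hy w.2))⟩

theorem IGraph.eq_of_incident_contrEdge (hz : Γ z = none) {s : (G.contr x y z A rfl rfl).End}
    (hs : s.IsFresh ({none} : Set (Option G.V))) {e : G.Edge}
    (h : (G.contr x y z A rfl rfl).Incident s (G.contrEdge e)) :
    (e = G.out ∧ s = .conclusion) ∨ ∃ w, e = .inl w ∧ s = G.contrSource w := by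
  rcases s with s | _ | ⟨v, p⟩
  · rcases e with w | e
    · refine .inr ⟨w, rfl, ?_⟩
      simp only [IGraph.Incident, IGraph.contrEdge] at h
      simp only [IGraph.contrSource]
      split_ifs at h ⊢
      cases h
      rfl
    · cases h
  · exact .inl ⟨G.contrEdge_injective (h.trans G.contr_out_eq), rfl⟩
  · obtain rfl := hs
    rcases e with w | e
    · refine .inr ⟨w, rfl, ?_⟩
      simp only [IGraph.Incident, IGraph.contrEdge, IGraph.contr, Node.At] at h
      simp only [IGraph.contrSource]
      split_ifs at h ⊢ with hx hy
      · simp_all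
      · simp_all
      · have := Ctx.insert_insert_ne hz w.2 hx hy
        simp_all
    · rcases h with ⟨-, h⟩ | ⟨-, h⟩ | ⟨-, h⟩ <;> cases h

/-- The graph of the premise inside the graph of a contraction. -/
def IGraph.contrCopy (hz : Γ z = none) : (G.contr x y z A rfl rfl).Copy {none} where
  part := G
  onV := some
  onE := G.contrEdge
  host := none
  atOut := .conclusion
  atPrem := G.contrSource
  node_onV v := congrArg (Node.map · (G.node v)) (funext fun | .inl _ | .inr _ => rfl)
  edgeTy_onE := G.edgeTy_contrEdge hz
  boxPremise_onE
    | .inr _ => (Option.or_none ..).symm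
    | .inl w => by simp only [IGraph.contrEdge]; split_ifs <;> rfl
  onE_injective := G.contrEdge_injective
  isOut_atOut := rfl
  isOut_atPrem w := by simp only [IGraph.contrSource]; split_ifs <;> rfl
  incident_fresh hs h := G.eq_of_incident_contrEdge hz hs h

/-- The graph of a contraction consists of the graph of the premise and a vertex `X`. -/
def IGraph.contrGluing (hz : Γ z = none) : (G.contr x y z A rfl rfl).Gluing Unit where
  fresh := {none}
  copy _ := G.contrCopy hz
  eq_of_onE_eq _ := rfl
  mem_fresh_or
    | none => .inl rfl
    | some v => .inr ⟨(), v, rfl⟩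
  boxPremise_eq_none_or
    | .inl _ => .inl rfl
    | .inr (.inl _) => .inl rfl
    | .inr (.inr e) => .inr ⟨(), .inr e, rfl⟩
  exists_ends {e} he := by
    have he_out : e ≠ (G.contr x y z A rfl rfl).out := G.contr_out_eq ▸ he () G.out
    rcases e with s | b | e
    · refine ⟨.premise s, .port none .dupIn, rfl, rfl, ?_⟩
      rintro (s' | _ | ⟨v, p⟩) hs h
      · cases h
        exact .inl rfl
      · exact absurd h he_out
      · obtain rfl := hs
        rcases h with ⟨rfl, h⟩ | ⟨rfl, h⟩ | ⟨rfl, -⟩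
        · cases h
        · cases h
        · exact .inr rfl
    · refine ⟨.port none (if b then .dupR else .dupL), .conclusion, by cases b <;> rfl, rfl, ?_⟩
      rintro (s' | _ | ⟨v, p⟩) hs h
      · cases h
      · exact .inr rfl
      · obtain rfl := hs
        rcases h with ⟨rfl, h⟩ | ⟨rfl, h⟩ | ⟨rfl, h⟩ <;> cases h <;> exact .inl rfl
    · exact absurd rfl (he () (.inr e))

end Contraction

section Abstraction

variable {A B : Ty 𝒜} (G : IGraph (Γ.cons A))

/-- The position, in the graph of an abstraction, of the edges of the graph of its body. -/
def IGraph.lamEdge : G.Edge → Γ.Dom ⊕ (Bool ⊕ G.E)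
  | .inl ⟨0, _⟩ => .inr (.inl false)
  | .inl ⟨x + 1, hx⟩ => .inl ⟨x, hx⟩
  | .inr e => .inr (.inr e)

theorem IGraph.lamEdge_injective : Function.Injective G.lamEdge := by
  rintro (⟨_ | w, hw⟩ | e) (⟨_ | w', hw'⟩ | e') he <;> cases he <;> rfl

theorem IGraph.lam_node_none : (G.lam A B).node none =
    .lam (.inr (.inl false)) (G.lamEdge G.out) (.inr (.inl true)) := by
  rcases hG : G.out with ⟨_ | w, hw⟩ | e <;> simp only [IGraph.lam, hG, IGraph.lamEdge]

/-- The source, in the graph of an abstraction, of the edge of a variable of the body. -/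
def IGraph.lamSource : (Γ.cons A).Dom → (G.lam A B).End
  | ⟨0, _⟩ => .port none .lamVar
  | ⟨x + 1, hx⟩ => .premise ⟨x, hx⟩

/-- The graph of the body inside the graph of an abstraction. -/
def IGraph.lamCopy (B : Ty 𝒜) : (G.lam A B).Copy {none} where
  part := G
  onV := some
  onE := G.lamEdge
  host := none
  atOut := .port none .lamBody
  atPrem := G.lamSource
  node_onV v := congrArg (Node.map · (G.node v))
    (funext fun | .inl ⟨0, _⟩ | .inl ⟨_ + 1, _⟩ | .inr _ => rfl)
  edgeTy_onE
    | .inl ⟨0, _⟩ | .inl ⟨_ + 1, _⟩ | .inr _ => rfl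
  boxPremise_onE
    | .inl ⟨0, _⟩ | .inl ⟨_ + 1, _⟩ => rfl
    | .inr _ => (Option.or_none ..).symm
  onE_injective := G.lamEdge_injective
  isOut_atOut := rfl
  isOut_atPrem
    | ⟨0, _⟩ | ⟨_ + 1, _⟩ => rfl
  incident_fresh {s e} hs h := by
    rcases s with s | _ | ⟨v, p⟩
    · rcases e with ⟨_ | w, hw⟩ | e <;> cases h
      exact .inr ⟨_, rfl, rfl⟩
    · rcases e with ⟨_ | w, hw⟩ | e <;> cases h
    · obtain rfl := hs
      simp only [IGraph.Incident, G.lam_node_none] at h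
      rcases h with ⟨rfl, h⟩ | ⟨rfl, h⟩ | ⟨rfl, h⟩
      · rcases e with ⟨_ | w, hw⟩ | e <;> cases h
        exact .inr ⟨_, rfl, rfl⟩
      · exact .inl ⟨G.lamEdge_injective h, rfl⟩
      · rcases e with ⟨_ | w, hw⟩ | e <;> cases h

/-- The graph of an abstraction consists of the graph of the body and a vertex `I_⊸`. -/
def IGraph.lamGluing (B : Ty 𝒜) : (G.lam A B).Gluing Unit where
  fresh := {none}
  copy _ := G.lamCopy B
  eq_of_onE_eq _ := rfl
  mem_fresh_or
    | none => .inl rfl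
    | some v => .inr ⟨(), v, rfl⟩
  boxPremise_eq_none_or
    | .inl _ => .inl rfl
    | .inr (.inl _) => .inl rfl
    | .inr (.inr e) => .inr ⟨(), .inr e, rfl⟩
  exists_ends {e} he := by
    rcases e with s | b | e
    · exact absurd rfl (he () (.inl ⟨s.1 + 1, s.2⟩))
    · refine ⟨.port none (if b then .lamOut else .lamVar), .conclusion, by cases b <;> rfl, rfl, ?_⟩
      rintro (s' | _ | ⟨v, p⟩) hs h
      · cases h
      · exact .inr rfl
      · obtain rfl := hs
        simp only [IGraph.Incident, G.lam_node_none] at h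
        rcases h with ⟨rfl, h⟩ | ⟨rfl, h⟩ | ⟨rfl, h⟩
        · cases h
          exact .inl rfl
        · exact absurd h (he () _)
        · cases h
          exact .inl rfl
    · exact absurd rfl (he () (.inr e))

end Abstraction

section Application

variable (hΓ : Ctx.Union Γ₁ Γ₂ Γ) (B : Ty 𝒜) (G₁ : IGraph Γ₁) (G₂ : IGraph Γ₂)

/-- The graph of the function inside the graph of an application. -/
def IGraph.appFunCopy : (IGraph.app hΓ B G₁ G₂).Copy {none} :=
  .ofIncl G₁ hΓ.eq_left (fun v => some (.inl v)) (fun e => some (.inl e)) (.port none .appFun)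
    (fun _ => rfl) (fun _ => rfl) (fun _ => rfl)
    ((Option.some_injective _).comp Sum.inl_injective) rfl
    (fun {e} h => by rcases e with w | e <;> cases h) (by
      rintro _ p e rfl (⟨rfl, h⟩ | ⟨rfl, h⟩ | ⟨rfl, h⟩)
      · exact ⟨Ctx.sumMap_incl_injective _ ((Option.some_injective _).comp Sum.inl_injective) h,
          rfl⟩
      · exact absurd h (Ctx.sumMap_incl_ne hΓ.1 _ hΓ.eq_right nofun _ _)
      · rcases e with w | e <;> cases h)

/-- The graph of the argument inside the graph of an application. -/
def IGraph.appArgCopy : (IGraph.app hΓ B G₁ G₂).Copy {none} :=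
  .ofIncl G₂ hΓ.eq_right (fun v => some (.inr v)) (fun e => some (.inr e)) (.port none .appArg)
    (fun _ => rfl) (fun _ => rfl) (fun _ => rfl)
    ((Option.some_injective _).comp Sum.inr_injective) rfl
    (fun {e} h => by rcases e with w | e <;> cases h) (by
      rintro _ p e rfl (⟨rfl, h⟩ | ⟨rfl, h⟩ | ⟨rfl, h⟩)
      · exact absurd h.symm (Ctx.sumMap_incl_ne hΓ.1 hΓ.eq_left _ nofun _ _)
      · exact ⟨Ctx.sumMap_incl_injective _ ((Option.some_injective _).comp Sum.inr_injective) h,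
          rfl⟩
      · rcases e with w | e <;> cases h)

/-- The graph of an application consists of the graphs of the function and of the argument and a
vertex `E_⊸`. -/
def IGraph.appGluing : (IGraph.app hΓ B G₁ G₂).Gluing Bool where
  fresh := {none}
  copy
    | false => IGraph.appFunCopy hΓ B G₁ G₂
    | true => IGraph.appArgCopy hΓ B G₁ G₂
  eq_of_onE_eq {k l e e'} h := by
    match k, l with
    | false, false | true, true => rfl
    | false, true => exact absurd h (Ctx.sumMap_incl_ne hΓ.1 _ _ nofun _ _)
    | true, false => exact absurd h.symm (Ctx.sumMap_incl_ne hΓ.1 _ _ nofun _ _)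
  mem_fresh_or
    | none => .inl rfl
    | some (.inl v) => .inr ⟨false, v, rfl⟩
    | some (.inr v) => .inr ⟨true, v, rfl⟩
  boxPremise_eq_none_or
    | .inl _ => .inl rfl
    | .inr none => .inl rfl
    | .inr (some (.inl e)) => .inr ⟨false, .inr e, rfl⟩
    | .inr (some (.inr e)) => .inr ⟨true, .inr e, rfl⟩
  exists_ends {e} he := by
    rcases e with x | _ | e | e
    · rcases hΓ.exists_dom x with ⟨w, hw⟩ | ⟨w, hw⟩
      · exact absurd (congrArg Sum.inl (Subtype.ext hw.symm)) (he false (.inl w))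
      · exact absurd (congrArg Sum.inl (Subtype.ext hw.symm)) (he true (.inl w))
    · refine ⟨.port none .appOut, .conclusion, rfl, rfl, ?_⟩
      rintro (x | _ | ⟨v, p⟩) hs h
      · cases h
      · exact .inr rfl
      · obtain rfl := hs
        rcases h with ⟨rfl, h⟩ | ⟨rfl, h⟩ | ⟨rfl, -⟩
        · exact absurd h (he false _)
        · exact absurd h (he true _)
        · exact .inl rfl
    · exact absurd rfl (he false (.inr e))
    · exact absurd rfl (he true (.inr e))

end Application

section Conditional

variable {a : Fin n} {Γs : Fin (𝒜 a).k → Ctx 𝒜} (hΓ : Ctx.UnionAll Γs Δ Γ) (C : Ty 𝒜)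
  (Gs : ∀ i, IGraph (Γs i)) (G₀ : IGraph Δ)

/-- The graph of the argument inside the graph of a conditional. -/
def IGraph.condArgCopy : (IGraph.cond hΓ C Gs G₀).Copy {none} :=
  .ofIncl G₀ hΓ.eq_main (fun v => some (.inr v)) (fun e => some (.inr e)) (.port none .condArg)
    (fun _ => rfl) (fun _ => rfl) (fun _ => rfl)
    ((Option.some_injective _).comp Sum.inr_injective) rfl
    (fun {e} h => by rcases e with w | e <;> cases h) (by
      rintro _ p e rfl (⟨rfl, h⟩ | ⟨rfl, h⟩ | ⟨i, rfl, h⟩)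
      · exact ⟨Ctx.sumMap_incl_injective _ ((Option.some_injective _).comp Sum.inr_injective) h,
          rfl⟩
      · rcases e with w | e <;> cases h
      · exact absurd h.symm (Ctx.sumMap_incl_ne (hΓ.2.1 i) (fun _ => hΓ.eq_branch _) _ nofun
          _ _))

/-- The graph of a branch inside the graph of a conditional. -/
def IGraph.condBranchCopy (i : Fin (𝒜 a).k) : (IGraph.cond hΓ C Gs G₀).Copy {none} :=
  have onE_injective : Function.Injective
      (fun e => some (.inl ⟨i, e⟩) : (Gs i).E → Option ((Σ i, (Gs i).E) ⊕ G₀.E)) :=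
    (Option.some_injective _).comp (Sum.inl_injective.comp sigma_mk_injective)
  .ofIncl (Gs i) (fun _ => hΓ.eq_branch _) (fun v => some (.inl ⟨i, v⟩))
    (fun e => some (.inl ⟨i, e⟩)) (.port none (.condBr i))
    (fun _ => rfl) (fun _ => rfl) (fun _ => rfl) onE_injective rfl
    (fun {e} h => by rcases e with w | e <;> cases h) (by
      rintro _ p e rfl (⟨rfl, h⟩ | ⟨rfl, h⟩ | ⟨j, rfl, h⟩)
      · exact absurd h (Ctx.sumMap_incl_ne (hΓ.2.1 i) _ hΓ.eq_main nofun _ _)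
      · rcases e with w | e <;> cases h
      · obtain rfl | hij := eq_or_ne i j
        · exact ⟨Ctx.sumMap_incl_injective _ onE_injective h, rfl⟩
        · exact absurd h (Ctx.sumMap_incl_ne (hΓ.1 i j hij) _ (fun _ => hΓ.eq_branch _)
            (fun _ _ h => hij (by cases h; rfl)) _ _))

/-- The graph of a conditional consists of the graphs of the argument and of the branches and a
vertex `C^N`. -/
def IGraph.condGluing : (IGraph.cond hΓ C Gs G₀).Gluing (Option (Fin (𝒜 a).k)) where
  fresh := {none}
  copy
    | none => IGraph.condArgCopy hΓ C Gs G₀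
    | some i => IGraph.condBranchCopy hΓ C Gs G₀ i
  eq_of_onE_eq {k l e e'} h := by
    match k, l with
    | none, none => rfl
    | none, some i => exact absurd h.symm (Ctx.sumMap_incl_ne (hΓ.2.1 i) _ _ nofun _ _)
    | some i, none => exact absurd h (Ctx.sumMap_incl_ne (hΓ.2.1 i) _ _ nofun _ _)
    | some i, some j =>
      by_contra! hij
      replace hij : i ≠ j := fun hij' => hij (congrArg some hij')
      exact Ctx.sumMap_incl_ne (hΓ.1 i j hij) _ _ (fun _ _ h => hij (by cases h; rfl)) _ _ h
  mem_fresh_or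
    | none => .inl rfl
    | some (.inl ⟨i, v⟩) => .inr ⟨some i, v, rfl⟩
    | some (.inr v) => .inr ⟨none, v, rfl⟩
  boxPremise_eq_none_or
    | .inl _ => .inl rfl
    | .inr none => .inl rfl
    | .inr (some (.inl ⟨i, e⟩)) => .inr ⟨some i, .inr e, rfl⟩
    | .inr (some (.inr e)) => .inr ⟨none, .inr e, rfl⟩
  exists_ends {e} he := by
    rcases e with x | _ | ⟨i, e⟩ | e
    · rcases hΓ.exists_dom x with ⟨i, w, hw⟩ | ⟨w, hw⟩
      · exact absurd (congrArg Sum.inl (Subtype.ext hw.symm)) (he (some i) (.inl w))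
      · exact absurd (congrArg Sum.inl (Subtype.ext hw.symm)) (he none (.inl w))
    · refine ⟨.port none .condOut, .conclusion, rfl, rfl, ?_⟩
      rintro (x | _ | ⟨v, p⟩) hs h
      · cases h
      · exact .inr rfl
      · obtain rfl := hs
        rcases h with ⟨rfl, h⟩ | ⟨rfl, -⟩ | ⟨i, rfl, h⟩
        · exact absurd h (he none _)
        · exact .inl rfl
        · exact absurd h (he (some i) _)
    · exact absurd rfl (he (some i) (.inr e))
    · exact absurd rfl (he none (.inr e))

end Conditional

section Recursion

variable {a : Fin n} {Γs : Fin (𝒜 a).k → Ctx 𝒜} (hΓ : Ctx.UnionAll Γs Δ Γ) (C : Ty 𝒜)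
  (Gs : ∀ i, IGraph (Γs i)) (G₀ : IGraph Δ)

/-- The vertices of the graph of a recursion that are labelled `C^R` or `P^R` and do not come from
the graphs of its premises. -/
def IGraph.recurFresh : Set (IGraph.recur hΓ C Gs G₀).V :=
  {v | v = none ∨ ∃ i x, v = some (.inl ⟨i, .inl x⟩)}

/-- The graph of the recurrence argument inside the graph of a recursion. -/
def IGraph.recurArgCopy : (IGraph.recur hΓ C Gs G₀).Copy (IGraph.recurFresh hΓ C Gs G₀) :=
  .ofIncl G₀ hΓ.eq_main (fun v => some (.inr v)) (fun e => some (.inr e)) (.port none .recArg)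
    (fun _ => rfl) (fun _ => rfl) (fun _ => rfl)
    ((Option.some_injective _).comp Sum.inr_injective) rfl
    (fun {e} h => by rcases e with w | e <;> cases h) (by
      rintro _ p e (rfl | ⟨i, x, rfl⟩) h
      · rcases h with ⟨rfl, h⟩ | ⟨rfl, h⟩ | ⟨i, rfl, h⟩
        · exact ⟨Ctx.sumMap_incl_injective _ ((Option.some_injective _).comp Sum.inr_injective) h,
            rfl⟩
        · rcases e with w | e <;> cases h
        · rcases e with w | e <;> cases h
      · rcases h with ⟨rfl, h⟩ | ⟨rfl, h⟩
        · exact absurd h.symm (Ctx.sumMap_incl_ne (f₁ := fun e => some (Sum.inl ⟨i, .inr e⟩))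
            (hΓ.2.1 i) (fun _ => hΓ.eq_branch _) _ nofun (.inl x) _)
        · rcases e with w | e <;> cases h)

/-- The graph of a branch inside the graph of a recursion. -/
def IGraph.recurBranchCopy (i : Fin (𝒜 a).k) :
    (IGraph.recur hΓ C Gs G₀).Copy (IGraph.recurFresh hΓ C Gs G₀) where
  part := Gs i
  onV v := some (.inl ⟨i, .inr v⟩)
  onE e := .inr (some (.inl ⟨i, e⟩))
  host := some none
  atOut := .port none (.recBr i)
  atPrem x := .port (some (.inl ⟨i, .inl x⟩)) .boxOut
  node_onV _ := rfl
  edgeTy_onE _ := rfl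
  boxPremise_onE e := by
    simp only [IGraph.boxPremise, IGraph.recur]
    split <;> simp_all
  onE_injective := Sum.inr_injective.comp
    ((Option.some_injective _).comp (Sum.inl_injective.comp sigma_mk_injective))
  isOut_atOut := rfl
  isOut_atPrem _ := rfl
  incident_fresh {s e} hs h := by
    rcases s with x | _ | ⟨v, p⟩
    · cases h
    · cases h
    · rcases hs with rfl | ⟨j, x, rfl⟩
      · rcases h with ⟨rfl, h⟩ | ⟨rfl, h⟩ | ⟨j, rfl, h⟩
        · rcases hG : G₀.out with w | e' <;> rw [hG] at h <;> cases h
        · cases h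
        · cases h
          exact .inl ⟨rfl, rfl⟩
      · rcases h with ⟨rfl, h⟩ | ⟨rfl, h⟩
        · cases h
        · cases h
          exact .inr ⟨x, rfl, rfl⟩

theorem IGraph.recur_incident_inl {x : Γ.Dom} {i : Fin (𝒜 a).k} {w : (Γs i).Dom} (hw : w.1 = x.1)
    {z : (IGraph.recur hΓ C Gs G₀).End} (hz : z.IsFresh (IGraph.recurFresh hΓ C Gs G₀))
    (h : (IGraph.recur hΓ C Gs G₀).Incident z (.inl x)) :
    z = .premise x ∨ z = .port (some (.inl ⟨i, .inl w⟩)) .boxIn := by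
  rcases z with x' | _ | ⟨v, p⟩
  · cases h
    exact .inl rfl
  · cases h
  · rcases hz with rfl | ⟨j, w', rfl⟩
    · rcases h with ⟨rfl, h⟩ | ⟨rfl, h⟩ | ⟨_, rfl, h⟩
      · obtain rfl : Ctx.incl (fun _ => hΓ.eq_branch _) w = x := Subtype.ext hw
        exact absurd h (Ctx.sumMap_incl_ne (f₁ := fun e => some (.inl ⟨i, e⟩)) (hΓ.2.1 i)
          (fun _ => hΓ.eq_branch _) hΓ.eq_main nofun (.inl w) _)
      · cases h
      · cases h
    · rcases h with ⟨rfl, h⟩ | ⟨-, h⟩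
      · cases h
        obtain rfl : i = j := hΓ.branch_unique w w' hw
        obtain rfl := Subtype.ext hw
        exact .inr rfl
      · cases h

/-- The graph of a recursion consists of the graphs of the recurrence argument and of the branches
and of vertices `C^R` and `P^R`. -/
def IGraph.recurGluing : (IGraph.recur hΓ C Gs G₀).Gluing (Option (Fin (𝒜 a).k)) where
  fresh := IGraph.recurFresh hΓ C Gs G₀
  copy
    | none => IGraph.recurArgCopy hΓ C Gs G₀
    | some i => IGraph.recurBranchCopy hΓ C Gs G₀ i
  eq_of_onE_eq {k l e e'} h := by
    match k, l with
    | none, none => rfl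
    | none, some i => rcases e with w | e <;> cases h
    | some i, none => rcases e' with w | e' <;> cases h
    | some i, some j => cases h; rfl
  mem_fresh_or
    | none => .inl (.inl rfl)
    | some (.inl ⟨i, .inl x⟩) => .inl (.inr ⟨i, x, rfl⟩)
    | some (.inl ⟨i, .inr v⟩) => .inr ⟨some i, v, rfl⟩
    | some (.inr v) => .inr ⟨none, v, rfl⟩
  boxPremise_eq_none_or
    | .inl _ => .inl rfl
    | .inr none => .inl rfl
    | .inr (some (.inl ⟨i, e⟩)) => .inr ⟨some i, e, rfl⟩
    | .inr (some (.inr e)) => .inr ⟨none, .inr e, rfl⟩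
  exists_ends {e} he := by
    rcases e with x | _ | ⟨i, e⟩ | e
    · rcases hΓ.exists_dom x with ⟨i, w, hw⟩ | ⟨w, hw⟩
      · exact ⟨.premise x, .port (some (.inl ⟨i, .inl w⟩)) .boxIn, rfl, rfl,
          fun z => IGraph.recur_incident_inl hΓ C Gs G₀ hw⟩
      · exact absurd (congrArg Sum.inl (Subtype.ext hw.symm)) (he none (.inl w))
    · refine ⟨.port none .recOut, .conclusion, rfl, rfl, ?_⟩
      rintro (x | _ | ⟨v, p⟩) hs h
      · cases h
      · exact .inr rfl
      · rcases hs with rfl | ⟨j, w', rfl⟩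
        · rcases h with ⟨rfl, h⟩ | ⟨rfl, -⟩ | ⟨i, rfl, h⟩
          · exact absurd h (he none _)
          · exact .inl rfl
          · cases h
        · rcases h with ⟨rfl, h⟩ | ⟨rfl, h⟩ <;> cases h
    · exact absurd rfl (he (some i) e)
    · exact absurd rfl (he none (.inr e))

end Recursion

end Constructors

section Derivations

variable {n : ℕ} {𝒜 : Fin n → FreeAlg} {Γ Γ₁ Γ₂ Δ : Ctx 𝒜} {A B C : Ty 𝒜} {D : Set (Ty 𝒜)}
  {R I : ℕ}

theorem IGraph.WF.weak {G : IGraph Γ} (h : G.WF B D R I) {x : ℕ} (hx : Γ x = none) :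
    (G.weak x A rfl).WF B D R I :=
  let Cp := (G.weakGluing A hx).copy ()
  (G.weakGluing A hx).wf (fun _ => ⟨B, R, 0, h, .none, le_rfl⟩) (by rintro _ rfl; trivial)
    (Cp.boxPremise_onE_of_eq_none h.outBox) ((Cp.edgeTy_onE _).trans h.outTy)

theorem IGraph.WF.contr {x y z : ℕ} {G : IGraph ((Γ.insert x A).insert y A)} (h : G.WF B D R I)
    (hz : Γ z = none) (hA : A ∈ D) : (G.contr x y z A rfl rfl).WF B D R I := by
  have edgeTy_z : (G.contr x y z A rfl rfl).edgeTy
      (.inl ⟨z, Ctx.isSome_insert_self Γ z A⟩) = A := IGraph.edgeTy_inl.mpr (Ctx.insert_self A)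
  refine (G.contrGluing hz).wf (fun _ => ⟨B, R, 0, h, .none, le_rfl⟩) ?_ ?_ ?_
  · rintro _ rfl
    exact ⟨edgeTy_z.symm, edgeTy_z.symm, edgeTy_z.symm ▸ hA, rfl, rfl⟩
  · rw [G.contr_out_eq]
    exact (G.contrCopy hz).boxPremise_onE_of_eq_none h.outBox
  · rw [G.contr_out_eq, G.edgeTy_contrEdge hz, h.outTy]

theorem IGraph.WF.lam {G : IGraph (Γ.cons A)} (h : G.WF B D R I) :
    (G.lam A B).WF (.arr A B) D R I := by
  refine (G.lamGluing B).wf (fun _ => ⟨B, R, 0, h, .none, le_rfl⟩) ?_ rfl rfl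
  rintro _ rfl
  rw [G.lam_node_none]
  refine ⟨?_, rfl, (G.lamCopy B).boxPremise_onE_of_eq_none h.outBox⟩
  exact congrArg (Ty.arr A) (((G.lamCopy B).edgeTy_onE G.out).trans h.outTy).symm

theorem IGraph.WF.app (hΓ : Ctx.Union Γ₁ Γ₂ Γ) {G₁ : IGraph Γ₁} {G₂ : IGraph Γ₂}
    (h₁ : G₁.WF (.arr A B) D R I) (h₂ : G₂.WF A D R I) :
    (IGraph.app hΓ B G₁ G₂).WF B D R I := by
  let F := IGraph.appFunCopy hΓ B G₁ G₂
  let N := IGraph.appArgCopy hΓ B G₁ G₂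
  refine (IGraph.appGluing hΓ B G₁ G₂).wf ?_ ?_ rfl rfl
  · rintro (_ | _)
    · exact ⟨_, R, 0, h₁, .none, le_rfl⟩
    · exact ⟨_, R, 0, h₂, .none, le_rfl⟩
  · rintro _ rfl
    refine ⟨?_, F.boxPremise_onE_of_eq_none h₁.outBox, N.boxPremise_onE_of_eq_none h₂.outBox⟩
    exact ((F.edgeTy_onE _).trans h₁.outTy).trans
      (congrArg (Ty.arr · B) ((N.edgeTy_onE _).trans h₂.outTy).symm)

section Branches

variable {a : Fin n} {m : ℕ} {Γs : Fin (𝒜 a).k → Ctx 𝒜} (hΓ : Ctx.UnionAll Γs Δ Γ)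
  {Gs : ∀ i, IGraph (Γs i)} {G₀ : IGraph Δ}

include hΓ

theorem IGraph.WF.cond
    (hs : ∀ i, (Gs i).WF (Ty.arrows ((𝒜 a).arity i) (.base a m) C) D R I)
    (h₀ : G₀.WF (.base a m) D R I) : (IGraph.cond hΓ C Gs G₀).WF C D R I := by
  let L := IGraph.condArgCopy hΓ C Gs G₀
  let Ms := IGraph.condBranchCopy hΓ C Gs G₀
  refine (IGraph.condGluing hΓ C Gs G₀).wf ?_ ?_ rfl rfl
  · rintro (_ | i)
    · exact ⟨_, R, 0, h₀, .none, le_rfl⟩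
    · exact ⟨_, R, 0, hs i, .none, le_rfl⟩
  · rintro _ rfl
    have edgeTy_arg := (L.edgeTy_onE _).trans h₀.outTy
    refine ⟨⟨m, edgeTy_arg⟩, fun i => ?_, L.boxPremise_onE_of_eq_none h₀.outBox,
      fun i => (Ms i).boxPremise_onE_of_eq_none (hs i).outBox⟩
    exact (((Ms i).edgeTy_onE _).trans (hs i).outTy).trans
      (congrArg (Ty.arrows _ · C) edgeTy_arg.symm)

theorem IGraph.WF.recur (hdup : ∀ i x A, Γs i x = some A → A ∈ D) (hm : C.level < m) (hmI : m ≤ I)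
    (hs : ∀ i, (Gs i).WF (Ty.arrows ((𝒜 a).arity i) (.base a m)
      (Ty.arrows ((𝒜 a).arity i) C C)) D R I)
    (h₀ : G₀.WF (.base a m) D R I) : (IGraph.recur hΓ C Gs G₀).WF C D (R + 1) I := by
  let L := IGraph.recurArgCopy hΓ C Gs G₀
  let Ms := IGraph.recurBranchCopy hΓ C Gs G₀
  have outBox_arg := L.boxPremise_onE_of_eq_none h₀.outBox
  refine (IGraph.recurGluing hΓ C Gs G₀).wf ?_ ?_ rfl rfl
  · rintro (_ | i)
    · exact ⟨_, R, 0, h₀, .none, Nat.le_succ R⟩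
    · refine ⟨_, R, 1, hs i, .some rfl ?_, le_rfl⟩
      exact Eq.mpr (congrArg (BoxDepth _ 0) outBox_arg) .none
  · rintro _ (rfl | ⟨i, x, rfl⟩)
    · have edgeTy_arg := (L.edgeTy_onE _).trans h₀.outTy
      refine ⟨⟨m, edgeTy_arg, hm, hmI⟩, fun i => ?_, outBox_arg,
        fun i => (Ms i).boxPremise_onE_of_eq_none (hs i).outBox⟩
      exact (((Ms i).edgeTy_onE _).trans (hs i).outTy).trans
        (congrArg (Ty.arrows _ · _) edgeTy_arg.symm)
    · have edgeTy_prem := (Ms i).edgeTy_onE (.inl x)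
      refine ⟨IGraph.edgeTy_inl.mpr ((hΓ.eq_branch x).trans ?_), edgeTy_prem ▸ ?_,
        none, a, _, _, _, rfl, rfl, outBox_arg.symm⟩
      · exact (IGraph.edgeTy_inl.mp rfl).trans (congrArg some edgeTy_prem.symm)
      · exact hdup i x.1 _ (IGraph.edgeTy_inl (G := Gs i).mp rfl)

end Branches

theorem Deriv.graph_wf {S : System 𝒜} {M : Term 𝒜} (hram : S.ramified) (π : Deriv S Γ M A) :
    π.graph.WF A S.dup π.recDepth π.highTier := by
  have le_sup_max {k : ℕ} (f : Fin k → ℕ) (b : ℕ) (i : Fin k) : f i ≤ max (Finset.univ.sup f) b :=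
    le_max_of_le_left (Finset.le_sup (Finset.mem_univ i))
  induction π with
  | ax x A hΓ' => exact IGraph.ax_wf x A hΓ' S.dup 0 0
  | weak x A hx hΓ' d ih =>
    subst hΓ'
    exact ih.weak hx
  | contr x y z A _ _ _ hz hA hΓ'' hΓ' _ d ih =>
    subst hΓ'' hΓ'
    exact ih.contr hz hA
  | lam d ih => exact ih.lam
  | app hΓ d₁ d₂ ih₁ ih₂ =>
    exact .app hΓ (ih₁.mono (le_max_left _ _) (le_max_left _ _))
      (ih₂.mono (le_max_right _ _) (le_max_right _ _))
  | con a c i _ => exact IGraph.con_wf a c i S.dup 0 0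
  | cond hΓ ds d ihs ih =>
    exact .cond hΓ (fun i => (ihs i).mono (le_sup_max (fun i => (ds i).recDepth) _ i)
      (le_sup_max (fun i => (ds i).highTier) _ i)) (ih.mono (le_max_right _ _) (le_max_right _ _))
  | recur hΓ hdup hm ds d ihs ih =>
    rw [Deriv.recDepth, Nat.add_comm]
    exact .recur hΓ hdup (hm hram) (le_max_left _ _)
      (fun i => (ihs i).mono (le_sup_max (fun i => (ds i).recDepth) _ i)
        (le_max_of_le_right (le_sup_max (fun i => (ds i).highTier) _ i)))
      (ih.mono (le_max_right _ _) (le_max_of_le_right (le_max_right _ _)))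

end Derivations

/-! ### Counting the constructor vertices -/

section ConVertices

variable {n : ℕ} {𝒜 : Fin n → FreeAlg} {Γ : Ctx 𝒜} {M : Term 𝒜} {A : Ty 𝒜}

/-- The vertices labelled by constructors. -/
def IGraph.conVertices (G : IGraph Γ) : Set G.V :=
  {v | ∃ a c e, G.node v = .con a c e}

theorem Node.exists_of_map_eq_con {E F : Type} {f : E → F} {N : Node 𝒜 E} {a : Fin n}
    {c : Fin (𝒜 a).k} {x : F} (h : N.map f = .con a c x) : ∃ e, N = .con a c e := by
  cases N <;> cases h
  exact ⟨_, rfl⟩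

theorem IGraph.Gluing.encard_conVertices_le {G : IGraph Γ} {K : Type} [Fintype K] (L : G.Gluing K)
    (hfresh : ∀ v ∈ L.fresh, v ∉ G.conVertices) :
    G.conVertices.encard ≤ ∑ k, (L.copy k).part.conVertices.encard := by
  have subset_iUnion :
      G.conVertices ⊆ ⋃ k, (L.copy k).onV '' (L.copy k).part.conVertices := by
    intro v hv
    obtain ⟨k, w, rfl⟩ := (L.mem_fresh_or v).resolve_left fun h => hfresh v h hv
    obtain ⟨a, c, x, hx⟩ := hv
    rw [IGraph.Copy.node_onV] at hx
    obtain ⟨e, he⟩ := Node.exists_of_map_eq_con hx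
    exact Set.mem_iUnion.mpr ⟨k, w, ⟨a, c, e, he⟩, rfl⟩
  calc G.conVertices.encard
      ≤ (⋃ k, (L.copy k).onV '' (L.copy k).part.conVertices).encard :=
        Set.encard_le_encard subset_iUnion
    _ ≤ ∑ k, ((L.copy k).onV '' (L.copy k).part.conVertices).encard :=
        Set.encard_iUnion_le_of_fintype _
    _ ≤ ∑ k, (L.copy k).part.conVertices.encard :=
        Finset.sum_le_sum fun k _ => Set.encard_image_le _ _

theorem IGraph.Gluing.encard_conVertices_le_of_unique {G : IGraph Γ} {K : Type} [Unique K]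
    (L : G.Gluing K) (hfresh : ∀ v ∈ L.fresh, v ∉ G.conVertices) :
    G.conVertices.encard ≤ (L.copy default).part.conVertices.encard :=
  (L.encard_conVertices_le hfresh).trans_eq (Fintype.sum_unique _)

theorem Term.size_rename (M : Term 𝒜) (σ : ℕ → ℕ) : (M.rename σ).size = M.size := by
  induction M generalizing σ with
  | var | con => rfl
  | app M N ihM ihN => simp only [Term.rename, Term.size, ihM, ihN]
  | lam M ih => simp only [Term.rename, Term.size, ih]
  | cond L M ihL ih | recur L M ihL ih => simp only [Term.rename, Term.size, ihL, ih]

theorem Term.one_le_size : 1 ≤ M.size := by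
  induction M with
  | var | con => exact le_rfl
  | app | lam | cond | recur => rw [Term.size]; omega

theorem Deriv.encard_conVertices_le {S : System 𝒜} (π : Deriv S Γ M A) :
    π.graph.conVertices.encard ≤ M.size := by
  have sum_option_le {k l : ℕ} {f : Option (Fin k) → ℕ∞} {g : Fin k → ℕ} (h : f none ≤ l)
      (hs : ∀ i, f (some i) ≤ g i) : ∑ o, f o ≤ ((l + ∑ i, g i + k : ℕ) : ℕ∞) := by
    rw [Fintype.sum_option]
    push_cast
    exact (add_le_add h (Finset.sum_le_sum fun i _ => hs i)).trans le_self_add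
  induction π with
  | ax x A _ =>
    have : IsEmpty (Deriv.ax (S := S) x A ‹_›).graph.V := inferInstanceAs (IsEmpty Empty)
    rw [Set.eq_empty_of_isEmpty (Deriv.graph _).conVertices, Set.encard_empty]
    exact zero_le
  | weak x A hx hΓ' d ih =>
    subst hΓ'
    refine ((d.graph.weakGluing A hx).encard_conVertices_le_of_unique ?_).trans ih
    rintro _ rfl ⟨_, _, _, ⟨⟩⟩
  | @contr _ _ _ M M' _ x y z A _ _ _ hz _ hΓ'' hΓ' hM' d ih =>
    subst hΓ'' hΓ'
    have size_eq : M'.size = M.size := (congrArg Term.size hM').trans (Term.size_rename M _)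
    rw [← size_eq] at ih
    refine ((d.graph.contrGluing hz).encard_conVertices_le_of_unique ?_).trans ih
    rintro _ rfl ⟨_, _, _, ⟨⟩⟩
  | @lam _ _ _ B d ih =>
    refine ((d.graph.lamGluing B).encard_conVertices_le_of_unique ?_).trans
      (ih.trans (Nat.cast_le.mpr (Nat.le_succ _)))
    rintro _ rfl ⟨_, _, _, ⟨⟩⟩
  | app hΓ d₁ d₂ ih₁ ih₂ =>
    refine ((IGraph.appGluing hΓ _ d₁.graph d₂.graph).encard_conVertices_le ?_).trans ?_
    · rintro _ rfl ⟨_, _, _, ⟨⟩⟩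
    · rw [Fintype.sum_bool, add_comm, Term.size, Nat.cast_add]
      exact add_le_add ih₁ ih₂
  | con a c i _ => exact (Set.encard_le_one_iff.mpr fun _ _ _ _ => rfl).trans (by simp [Term.size])
  | cond hΓ ds d ihs ih =>
    refine ((IGraph.condGluing hΓ _ (ds · |>.graph) d.graph).encard_conVertices_le ?_).trans
      (sum_option_le ih ihs)
    rintro _ rfl ⟨_, _, _, ⟨⟩⟩
  | recur hΓ _ _ ds d ihs ih =>
    refine ((IGraph.recurGluing hΓ _ (ds · |>.graph) d.graph).encard_conVertices_le ?_).trans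
      (sum_option_le ih ihs)
    rintro _ (rfl | ⟨i, x, rfl⟩) ⟨_, _, _, ⟨⟩⟩

end ConVertices

/-! ### Terms, types and their contexts -/

theorem AlgCtx.comp_arg_ne_hole {B : FreeAlg} (u : AlgCtx B) (c : Fin B.k)
    (ts : Fin (B.arity c) → AlgTerm B) (k : Fin (B.arity c)) : u.comp (.arg c ts k) ≠ .hole := by
  cases u <;> simp [AlgCtx.comp, AlgCtx.arg]

theorem AlgCtx.arg_inj {B : FreeAlg} {c c' : Fin B.k}
    {ts : Fin (B.arity c) → AlgTerm B} {ts' : Fin (B.arity c') → AlgTerm B}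
    {k : Fin (B.arity c)} {k' : Fin (B.arity c')} (h : AlgCtx.arg c ts k = .arg c' ts' k')
    (hk : ts k = ts' k') :
    (⟨c, ts, k⟩ : Σ c : Fin B.k, (Fin (B.arity c) → AlgTerm B) × Fin (B.arity c)) =
      ⟨c', ts', k'⟩ := by
  simp only [AlgCtx.arg, AlgCtx.node.injEq] at h
  obtain ⟨rfl, hk', hts, -⟩ := h
  obtain rfl := eq_of_heq hk'
  have : ts = ts' := by
    funext l
    by_cases hl : l = k
    · rw [hl, hk]
    · exact congrFun (eq_of_heq hts) ⟨l, hl⟩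
  rw [this]

theorem AlgCtx.comp_arg_inj {B : FreeAlg} {c c' : Fin B.k}
    {ts : Fin (B.arity c) → AlgTerm B} {ts' : Fin (B.arity c') → AlgTerm B}
    {k : Fin (B.arity c)} {k' : Fin (B.arity c')} :
    ∀ {u u' : AlgCtx B}, u.comp (.arg c ts k) = u'.comp (.arg c' ts' k') →
      u = u' ∧ AlgCtx.arg c ts k = .arg c' ts' k'
  | .hole, .hole, h => ⟨rfl, h⟩
  | .hole, .node d j ss u', h => by
    simp only [AlgCtx.comp, AlgCtx.arg, AlgCtx.node.injEq] at h
    exact absurd h.2.2.2.symm (AlgCtx.comp_arg_ne_hole _ _ _ _)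
  | .node d j ss u, .hole, h => by
    simp only [AlgCtx.comp, AlgCtx.arg, AlgCtx.node.injEq] at h
    exact absurd h.2.2.2 (AlgCtx.comp_arg_ne_hole _ _ _ _)
  | .node d j ss u, .node d' j' ss' u', h => by
    simp only [AlgCtx.comp, AlgCtx.node.injEq] at h
    obtain ⟨rfl, hj, hs, hu⟩ := h
    obtain rfl := eq_of_heq hj
    obtain rfl := eq_of_heq hs
    obtain ⟨rfl, h'⟩ := AlgCtx.comp_arg_inj hu
    exact ⟨rfl, h'⟩

theorem AlgCtx.plug_comp {B : FreeAlg} (u w : AlgCtx B) (t : AlgTerm B) :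
    (u.comp w).plug t = u.plug (w.plug t) := by
  induction u with
  | hole => rfl
  | node c j ts u ih => simp only [AlgCtx.comp, AlgCtx.plug, ih]

theorem AlgCtx.plug_arg {B : FreeAlg} (c : Fin B.k) (ts : Fin (B.arity c) → AlgTerm B)
    (k : Fin (B.arity c)) : (AlgCtx.arg c ts k).plug (ts k) = .mk c ts := by
  simp only [AlgCtx.arg, AlgCtx.plug]
  congr 1
  funext l
  split_ifs with h
  · rw [h]
  · rfl

theorem AlgTerm.sum_size_lt {B : FreeAlg} {c : Fin B.k} {ts : Fin (B.arity c) → AlgTerm B} :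
    ∑ j, (ts j).size < (AlgTerm.mk c ts).size := by
  rw [AlgTerm.size]
  omega

theorem AlgTerm.arg_size_lt {B : FreeAlg} {c : Fin B.k} {ts : Fin (B.arity c) → AlgTerm B}
    {j : Fin (B.arity c)} : (ts j).size < (AlgTerm.mk c ts).size :=
  (Finset.single_le_sum (f := fun j => (ts j).size) (fun _ _ => Nat.zero_le _)
    (Finset.mem_univ j)).trans_lt AlgTerm.sum_size_lt

theorem AlgCtx.size_le_plug {B : FreeAlg} (u : AlgCtx B) (t : AlgTerm B) :
    t.size ≤ (u.plug t).size := by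
  induction u with
  | hole => exact le_rfl
  | node c j ts u ih =>
    refine ih.trans (le_of_eq_of_le ?_ (AlgTerm.arg_size_lt (j := j)).le)
    rw [dif_pos rfl]

/-- The decompositions of a term as `u[s]`, one for each of its constructors. -/
def AlgTerm.decompositions {B : FreeAlg} (t : AlgTerm B) : Set (AlgCtx B × AlgTerm B) :=
  {q | q.1.plug q.2 = t}

theorem AlgTerm.decompositions_mk_subset {B : FreeAlg} (c : Fin B.k)
    (ts : Fin (B.arity c) → AlgTerm B) :
    (AlgTerm.mk c ts).decompositions ⊆ insert (.hole, .mk c ts)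
      (⋃ j, (fun q => (.node c j (fun l => ts l) q.1, q.2)) '' (ts j).decompositions) := by
  rintro ⟨_ | ⟨d, j, ss, u⟩, s⟩ h
  · exact .inl (congrArg _ h)
  · obtain ⟨rfl, h⟩ := AlgTerm.mk.inj h
    obtain rfl := eq_of_heq h
    have hs : (u, s) ∈ (u.plug s).decompositions := rfl
    refine .inr (Set.mem_iUnion.mpr ⟨j, (u, s), by simpa only [dif_pos] using hs, ?_⟩)
    have hss : (fun l : {l // l ≠ j} => if h : l.1 = j then u.plug s else ss ⟨l, h⟩) = ss :=
      funext fun l => dif_neg l.2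
    rw [hss]

theorem AlgTerm.encard_decompositions_le {B : FreeAlg} (t : AlgTerm B) :
    t.decompositions.encard ≤ t.size := by
  induction t with
  | mk c ts ih =>
    refine (Set.encard_le_encard (AlgTerm.decompositions_mk_subset c ts)).trans
      ((Set.encard_insert_le _ _).trans ?_)
    rw [AlgTerm.size, Nat.cast_add, add_comm, Nat.cast_one, Nat.cast_sum]
    gcongr
    exact (Set.encard_iUnion_le_of_fintype _).trans <|
      Finset.sum_le_sum fun j _ => (Set.encard_image_le _ _).trans (ih j)

theorem FreeAlg.IsWord.arity_le {B : FreeAlg} (h : B.IsWord) (c : Fin B.k) : B.arity c ≤ 1 := by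
  obtain ⟨i, hi, hone⟩ := h
  by_cases hc : c = i
  · rw [hc, hi]
    exact Nat.zero_le 1
  · exact (hone c hc).le

section Types

variable {n : ℕ} {𝒜 : Fin n → FreeAlg}

theorem Ty.arrows_inj {A : Ty 𝒜} : ∀ {r : ℕ} {X Y : Ty 𝒜},
    Ty.arrows r A X = Ty.arrows r A Y ↔ X = Y
  | 0, _, _ => Iff.rfl
  | r + 1, X, Y => by simp [Ty.arrows, Ty.arrows_inj (r := r)]

theorem Ty.arrows_base_inj {a : Fin n} {i j : ℕ} : ∀ {r : ℕ},
    Ty.arrows r (.base a i) (.base a i) = Ty.arrows (𝒜 := 𝒜) r (.base a j) (.base a j) → i = j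
  | 0, h => by simpa [Ty.arrows] using h
  | r + 1, h => by
    simp only [Ty.arrows, Ty.arr.injEq, Ty.base.injEq, true_and] at h
    exact h.1

theorem Ty.arrows_split (A B : Ty 𝒜) : ∀ {r j : ℕ}, j < r →
    Ty.arrows r A B = Ty.arrows j A (.arr A (Ty.arrows (r - j - 1) A B))
  | 0, j, h => absurd h (Nat.not_lt_zero j)
  | r + 1, 0, _ => rfl
  | r + 1, j + 1, h => by
    rw [Ty.arrows, Ty.arrows, Ty.arrows_split A B (r := r) (j := j) (by omega),
      show r + 1 - (j + 1) - 1 = r - j - 1 by omega]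

theorem TyCtx.arrows_inj {A : Ty 𝒜} : ∀ {r : ℕ} {X Y : TyCtx 𝒜},
    TyCtx.arrows r A X = TyCtx.arrows r A Y ↔ X = Y
  | 0, _, _ => Iff.rfl
  | r + 1, X, Y => by simp [TyCtx.arrows, TyCtx.arrows_inj (r := r)]

theorem TyCtx.arrows_left_inj {A B B' : Ty 𝒜} {X Y : TyCtx 𝒜} : ∀ {r s : ℕ},
    TyCtx.arrows r A (.left X B) = TyCtx.arrows s A (.left Y B') → r = s ∧ X = Y
  | 0, 0, h => by
    simp only [TyCtx.arrows, TyCtx.left.injEq] at h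
    exact ⟨rfl, h.1⟩
  | 0, s + 1, h => by simp [TyCtx.arrows] at h
  | r + 1, 0, h => by simp [TyCtx.arrows] at h
  | r + 1, s + 1, h => by
    simp only [TyCtx.arrows, TyCtx.right.injEq, true_and] at h
    obtain ⟨rfl, h'⟩ := TyCtx.arrows_left_inj h
    exact ⟨rfl, h'⟩

theorem TyCtx.argAt_inj {A B : Ty 𝒜} {r : ℕ} {j k : Fin r} {X Y : TyCtx 𝒜}
    (h : TyCtx.argAt A j X B = TyCtx.argAt A k Y B) : j = k ∧ X = Y := by
  obtain ⟨h, h'⟩ := TyCtx.arrows_left_inj h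
  exact ⟨Fin.ext h, h'⟩

theorem TyCtx.arrows_left_ne {A B : Ty 𝒜} {X Y : TyCtx 𝒜} : ∀ {j r : ℕ}, j < r →
    TyCtx.arrows j A (.left X B) ≠ TyCtx.arrows r A Y
  | 0, r + 1, _, h => by simp [TyCtx.arrows] at h
  | j + 1, r + 1, hj, h => by
    simp only [TyCtx.arrows, TyCtx.right.injEq, true_and] at h
    exact TyCtx.arrows_left_ne (by omega) h

theorem TyCtx.argAt_ne_arrows {A B : Ty 𝒜} {r : ℕ} {j : Fin r} {X Y : TyCtx 𝒜} :
    TyCtx.argAt A j X B ≠ TyCtx.arrows r A Y :=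
  TyCtx.arrows_left_ne j.2

theorem TyCtx.positive_arrows {A : Ty 𝒜} {L : TyCtx 𝒜} : ∀ {r : ℕ},
    (TyCtx.arrows r A L).positive = L.positive
  | 0 => rfl
  | r + 1 => by rw [TyCtx.arrows, TyCtx.positive, TyCtx.positive_arrows]

theorem TyCtx.positive_argAt {A B : Ty 𝒜} {L : TyCtx 𝒜} {r : ℕ} {j : Fin r} :
    (TyCtx.argAt A j L B).positive = !L.positive := by
  rw [TyCtx.argAt, TyCtx.positive_arrows, TyCtx.positive]

theorem TyCtx.fill_arrows {A X : Ty 𝒜} {L : TyCtx 𝒜} : ∀ {r : ℕ},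
    (TyCtx.arrows r A L).fill X = Ty.arrows r A (L.fill X)
  | 0 => rfl
  | r + 1 => by rw [TyCtx.arrows, TyCtx.fill, TyCtx.fill_arrows, Ty.arrows]

theorem TyCtx.eq_fill_argAt {A B X : Ty 𝒜} {L : TyCtx 𝒜} {r : ℕ} {j : Fin r} :
    Ty.arrows r A B = (TyCtx.argAt A j L B).fill X ↔ A = L.fill X := by
  rw [TyCtx.argAt, TyCtx.fill_arrows, TyCtx.fill, Ty.arrows_split A B j.2, Ty.arrows_inj,
    Ty.arr.injEq, and_iff_left rfl]

theorem TyCtx.le_level_fill {a : Fin n} {i : ℕ} : ∀ {L : TyCtx 𝒜},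
    i ≤ (L.fill (.base a i)).level
  | .hole => le_rfl
  | .left _ _ => TyCtx.le_level_fill.trans (le_max_left _ _)
  | .right _ _ => TyCtx.le_level_fill.trans (le_max_right _ _)

end Types

section Labels

variable {n : ℕ} {𝒜 : Fin n → FreeAlg} {Γ : Ctx 𝒜} {G : IGraph Γ}

/-- A label without its term. -/
structure Cfg (G : IGraph Γ) where
  edge : G.Edge
  stack : List (Entry G)
  ctx : TyCtx 𝒜

/-- The configuration of a label. Since every configuration carries at most one derivable label,
it determines the term. -/
def Lab.cfg (l : Lab G) : Cfg G := ⟨l.edge, l.stack, l.ctx⟩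

/-- The two ends of the moves at a vertex that leave the term unchanged and can be used in both
directions; `R` decides the side conditions. -/
inductive Wire (R : Set (Lab G)) : G.V → Port → Cfg G → Port → Cfg G → Prop
  | lamVar {v e g h U P} (hv : G.node v = .lam e g h) :
      Wire R v .lamVar ⟨e, U, P⟩ .lamOut ⟨h, U, .left P (G.edgeTy g)⟩
  | lamBody {v e g h U P} (hv : G.node v = .lam e g h) :
      Wire R v .lamBody ⟨g, U, P⟩ .lamOut ⟨h, U, .right (G.edgeTy e) P⟩
  | appArg {v e g h U P} (hv : G.node v = .app e g h) :
      Wire R v .appArg ⟨g, U, P⟩ .appFun ⟨e, U, .left P (G.edgeTy h)⟩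
  | appOut {v e g h U P} (hv : G.node v = .app e g h) :
      Wire R v .appOut ⟨h, U, P⟩ .appFun ⟨e, U, .right (G.edgeTy g) P⟩
  | cond {v a e₀ es g U P} {c : Fin (𝒜 a).k} {ts} (hv : G.node v = .cond a e₀ es g)
      (hR : ⟨⟨a, .mk c ts⟩, e₀, U, .hole⟩ ∈ R) :
      Wire R v .condOut ⟨g, U, P⟩ (.condBr c)
        ⟨es c, U, TyCtx.arrows ((𝒜 a).arity c) (G.edgeTy e₀) P⟩
  | recOut {v a e₀ es g U P} {c : Fin (𝒜 a).k} {ts} (hv : G.node v = .recur a e₀ es g)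
      (hR : ⟨⟨a, .mk c ts⟩, e₀, U, .hole⟩ ∈ R) :
      Wire R v .recOut ⟨g, U, P⟩ (.recBr c)
        ⟨es c, ⟨a, .hole, .mk c ts, v⟩ :: U, TyCtx.arrows ((𝒜 a).arity c) (G.edgeTy e₀)
          (TyCtx.arrows ((𝒜 a).arity c) (G.edgeTy g) P)⟩
  | recCall {v a e₀ es g U P} {c d : Fin (𝒜 a).k} {ts ss} {k : Fin ((𝒜 a).arity c)}
      {u : AlgCtx (𝒜 a)} (hv : G.node v = .recur a e₀ es g)
      (hR : ⟨⟨a, u.plug (.mk c ts)⟩, e₀, U, .hole⟩ ∈ R) (hk : ts k = .mk d ss) :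
      Wire R v (.recBr c)
        ⟨es c, ⟨a, u, .mk c ts, v⟩ :: U, TyCtx.arrows ((𝒜 a).arity c) (G.edgeTy e₀)
          (TyCtx.argAt (G.edgeTy g) k P (G.edgeTy g))⟩ (.recBr d)
        ⟨es d, ⟨a, u.comp (AlgCtx.arg c ts k), ts k, v⟩ :: U,
          TyCtx.arrows ((𝒜 a).arity d) (G.edgeTy e₀)
            (TyCtx.arrows ((𝒜 a).arity d) (G.edgeTy g) P)⟩

theorem Lab.eq_of_injOn_cfg {R : Set (Lab G)} (hR : R.InjOn Lab.cfg) {a : Fin n}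
    {t t' : AlgTerm (𝒜 a)} {e : G.Edge} {U : List (Entry G)} {L : TyCtx 𝒜}
    (h : ⟨⟨a, t⟩, e, U, L⟩ ∈ R) (h' : ⟨⟨a, t'⟩, e, U, L⟩ ∈ R) : t = t' := by
  have := congrArg Lab.term (hR h h' rfl)
  exact eq_of_heq (Sigma.mk.inj this).2

variable {R : Set (Lab G)} {v : G.V} {p p' q q' : Port} {x x' y y' : Cfg G}

theorem Wire.right_eq (hR : R.InjOn Lab.cfg) (h : Wire R v p x q y) (h' : Wire R v p x q' y') :
    q = q' ∧ y = y' := by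
  generalize hp : p = p', hx : x = x' at h'
  cases h with
  | cond hn hT =>
    cases h' with
    | cond hn' hT' =>
      cases hn.symm.trans hn'
      cases hx
      cases Lab.eq_of_injOn_cfg hR hT hT'
      exact ⟨rfl, rfl⟩
    | _ => simp only [reduceCtorEq] at hp
  | recOut hn hT =>
    cases h' with
    | recOut hn' hT' =>
      cases hn.symm.trans hn'
      cases hx
      cases Lab.eq_of_injOn_cfg hR hT hT'
      exact ⟨rfl, rfl⟩
    | _ => simp only [reduceCtorEq] at hp
  | recCall hn _ hk =>
    cases h' with
    | recCall hn' _ hk' =>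
      cases hn.symm.trans hn'
      obtain rfl := Fin.ext (Port.recBr.inj hp)
      simp only [Cfg.mk.injEq, true_and, List.cons.injEq, Entry.mk.injEq, heq_eq_eq, and_true,
        AlgTerm.mk.injEq, TyCtx.arrows_inj] at hx
      obtain ⟨⟨⟨rfl, rfl⟩, rfl⟩, hctx⟩ := hx
      obtain ⟨rfl, rfl⟩ := TyCtx.argAt_inj hctx
      cases hk.symm.trans hk'
      exact ⟨rfl, rfl⟩
    | _ => simp only [reduceCtorEq] at hp
  | _ => cases h' <;> grind

theorem Wire.left_eq (h : Wire R v p x q y) (h' : Wire R v p' x' q y) : p = p' ∧ x = x' := by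
  generalize hq : q = q', hy : y = y' at h'
  cases h with
  | recCall hn _ _ =>
    cases h' with
    | recCall hn' _ _ =>
      cases hn.symm.trans hn'
      obtain rfl := Fin.ext (Port.recBr.inj hq)
      simp only [Cfg.mk.injEq, true_and, List.cons.injEq, Entry.mk.injEq, heq_eq_eq, and_true,
        TyCtx.arrows_inj] at hy
      obtain ⟨⟨⟨hu, ht⟩, rfl⟩, rfl⟩ := hy
      obtain ⟨rfl, harg⟩ := AlgCtx.comp_arg_inj hu
      cases AlgCtx.arg_inj harg ht
      exact ⟨rfl, rfl⟩
    | _ => grind [AlgCtx.comp_arg_ne_hole]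
  | _ => cases h' <;> grind [Fin.ext_iff, TyCtx.arrows_inj, AlgCtx.comp_arg_ne_hole]

theorem Wire.right_ne_left (h : Wire R v p x q y) (h' : Wire R v q y q' y') : False := by
  generalize hq : q = p', hy : y = x' at h'
  cases h <;> cases h' <;> grind [Fin.ext_iff, TyCtx.argAt_ne_arrows, TyCtx.arrows_inj]

/-- A wire, read in either direction. -/
def Link (R : Set (Lab G)) (v : G.V) (p : Port) (x : Cfg G) (q : Port) (y : Cfg G) : Prop :=
  Wire R v p x q y ∨ Wire R v q y p x

theorem Link.symm (h : Link R v p x q y) : Link R v q y p x :=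
  Or.symm h

theorem Link.unique (hR : R.InjOn Lab.cfg) (h : Link R v p x q y) (h' : Link R v p x q' y') :
    q = q' ∧ y = y' := by
  rcases h with h | h <;> rcases h' with h' | h'
  · exact h.right_eq hR h'
  · exact (h'.right_ne_left h).elim
  · exact (h.right_ne_left h').elim
  · exact h.left_eq h'

theorem Wire.mono {R' : Set (Lab G)} (hR : R ⊆ R') (h : Wire R v p x q y) : Wire R' v p x q y := by
  cases h with
  | lamVar hv => exact .lamVar hv
  | lamBody hv => exact .lamBody hv
  | appArg hv => exact .appArg hv
  | appOut hv => exact .appOut hv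
  | cond hv h => exact .cond hv (hR h)
  | recOut hv h => exact .recOut hv (hR h)
  | recCall hv h hk => exact .recCall hv (hR h) hk

theorem Link.mono {R' : Set (Lab G)} (hR : R ⊆ R') (h : Link R v p x q y) : Link R' v p x q y :=
  h.imp (Wire.mono hR) (Wire.mono hR)

theorem Wire.at_left (h : Wire R v p x q y) : (G.node v).At p x.edge := by
  cases h with
  | recCall hv _ _ => exact hv ▸ Or.inr (Or.inr ⟨_, rfl, rfl⟩)
  | _ => simp [Node.At, *]

theorem Wire.at_right (h : Wire R v p x q y) : (G.node v).At q y.edge := by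
  cases h with
  | cond hv _ | recOut hv _ | recCall hv _ _ => exact hv ▸ Or.inr (Or.inr ⟨_, rfl, rfl⟩)
  | _ => simp [Node.At, *]

theorem Link.at_left (h : Link R v p x q y) : (G.node v).At p x.edge :=
  h.elim Wire.at_left Wire.at_right

theorem Wire.positive_iff (h : Wire R v p x q y) :
    x.ctx.positive = p.isOut ↔ y.ctx.positive = !q.isOut := by
  cases h <;> simp [TyCtx.positive, TyCtx.positive_arrows, TyCtx.positive_argAt, Port.isOut]

theorem Link.positive_eq_not_isOut (h : Link R v p x q y) (hp : x.ctx.positive = p.isOut) :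
    y.ctx.positive = !q.isOut := by
  rcases h with h | h
  · exact h.positive_iff.mp hp
  · simpa [hp, ← Bool.not_eq] using h.positive_iff.not

/-- Side condition on the stack of a new label on an edge whose innermost box belongs to `o`: it is
empty outside all boxes, and otherwise its top is an entry for that box, the rest being the stack of
the label of the recursion premise that this entry splits. -/
inductive StackOK (R : Set (Lab G)) : Option G.V → List (Entry G) → Prop
  | nil : StackOK R none []
  | cons {v e₀ b u t U} (hv : G.RecPremise v e₀)
      (hR : ⟨⟨b, AlgCtx.plug u t⟩, e₀, U, .hole⟩ ∈ R) : StackOK R (some v) (⟨b, u, t, v⟩ :: U)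

/-- `Rule R v p ps l`: the label `l` is derived from the labels in `ps` at the port `p` of the
vertex `v`; `R` decides the other side conditions. -/
inductive Rule (R : Set (Lab G)) : G.V → Port → Set (Lab G) → Lab G → Prop
  | link {v p q l l'} (h : Link R v p l.cfg q l'.cfg) (hp : l.ctx.positive = p.isOut)
      (ht : l.term = l'.term) : Rule R v p {l'} l
  | dupL {v e g h t U} (hv : G.node v = .dup e g h) :
      Rule R v .dupL {⟨t, h, U, .hole⟩} ⟨t, e, U, .hole⟩
  | dupR {v e g h t U} (hv : G.node v = .dup e g h) :
      Rule R v .dupR {⟨t, h, U, .hole⟩} ⟨t, g, U, .hole⟩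
  | box {v a e g x U t} (hv : G.node v = .boxPrem a e g)
      (hU : StackOK R (G.boxPremise g) (x :: U)) :
      Rule R v .boxOut {⟨t, e, U, .hole⟩} ⟨t, g, x :: U, .hole⟩
  | con {v a c e i U ts} (hv : G.node v = .con a c e)
      (he : G.edgeTy e = Ty.arrows ((𝒜 a).arity c) (.base a i) (.base a i))
      (hU : (𝒜 a).arity c = 0 → StackOK R (G.boxPremise e) U) :
      Rule R v .con
        (Set.range fun j => ⟨⟨a, ts j⟩, e, U, TyCtx.argAt (.base a i) j .hole (.base a i)⟩)
        ⟨⟨a, .mk c ts⟩, e, U, TyCtx.arrows ((𝒜 a).arity c) (.base a i) .hole⟩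
  | condArg {v a e₀ es g} {c : Fin (𝒜 a).k} {ts U} {j : Fin ((𝒜 a).arity c)}
      (hv : G.node v = .cond a e₀ es g) :
      Rule R v (.condBr c) {⟨⟨a, .mk c ts⟩, e₀, U, .hole⟩}
        ⟨⟨a, ts j⟩, es c, U, TyCtx.argAt (G.edgeTy e₀) j .hole (G.edgeTy g)⟩
  | recArg {v a e₀ es g} {c : Fin (𝒜 a).k} {ts U} {u : AlgCtx (𝒜 a)}
      {j : Fin ((𝒜 a).arity c)} (hv : G.node v = .recur a e₀ es g) :
      Rule R v (.recBr c) {⟨⟨a, u.plug (.mk c ts)⟩, e₀, U, .hole⟩}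
        ⟨⟨a, ts j⟩, es c, ⟨a, u, .mk c ts, v⟩ :: U, TyCtx.argAt (G.edgeTy e₀) j .hole
          (Ty.arrows ((𝒜 a).arity c) (G.edgeTy g) (G.edgeTy g))⟩

theorem StackOK.mono {R' : Set (Lab G)} (hR : R ⊆ R') {o : Option G.V} {U : List (Entry G)}
    (h : StackOK R o U) : StackOK R' o U := by
  cases h with
  | nil => exact .nil
  | cons hv h => exact .cons hv (hR h)

variable {ps ps' : Set (Lab G)} {l l' : Lab G}

theorem Rule.mono {R' : Set (Lab G)} (hR : R ⊆ R') (h : Rule R v p ps l) : Rule R' v p ps l := by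
  cases h with
  | link h hp ht => exact .link (h.mono hR) hp ht
  | dupL hv => exact .dupL hv
  | dupR hv => exact .dupR hv
  | box hv hU => exact .box hv (hU.mono hR)
  | con hv he hU => exact .con hv he fun h => (hU h).mono hR
  | condArg hv => exact .condArg hv
  | recArg hv => exact .recArg hv

theorem Rule.at (h : Rule R v p ps l) : (G.node v).At p l.edge := by
  cases h with
  | link h _ _ => exact h.at_left
  | condArg hv => exact hv ▸ Or.inr (Or.inr ⟨_, rfl, rfl⟩)
  | recArg hv => exact hv ▸ Or.inr (Or.inr ⟨_, rfl, rfl⟩)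
  | _ => simp [Node.At, *]

theorem Rule.positive (h : Rule R v p ps l) : l.ctx.positive = p.isOut := by
  cases h with
  | link _ hp _ => exact hp
  | _ => simp [TyCtx.positive_arrows, TyCtx.positive_argAt, TyCtx.positive, Port.isOut]

theorem Rule.exists_link_of_link (h : Rule R v p ps l) (hl : Link R v p l.cfg q y) :
    ∃ q' l', Link R v p l.cfg q' l'.cfg ∧ l.term = l'.term ∧ ps = {l'} := by
  generalize hp : p = p', hx : l.cfg = x at hl
  cases h with
  | link h _ ht => exact ⟨_, _, hp ▸ hx ▸ h, ht, rfl⟩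
  | _ =>
    rcases hl with hl | hl <;> cases hl <;>
      grind [Lab.cfg, TyCtx.argAt_ne_arrows, Fin.ext_iff]

theorem Rule.unique_of_link (hR : R.InjOn Lab.cfg) (hl : Link R v p l.cfg q y)
    (h : Rule R v p ps l) (hps : ps ⊆ R) (h' : Rule R v p ps' l') (hps' : ps' ⊆ R)
    (hll' : l.cfg = l'.cfg) : l.term = l'.term ∧ ps = ps' := by
  obtain ⟨_, m, hm, ht, rfl⟩ := h.exists_link_of_link hl
  obtain ⟨_, m', hm', ht', rfl⟩ := h'.exists_link_of_link (hll' ▸ hl)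
  have hmm' : m = m' :=
    hR (hps rfl) (hps' rfl) (hm.unique hR (hll' ▸ hm')).2
  exact ⟨ht.trans (hmm' ▸ ht'.symm), hmm' ▸ rfl⟩

theorem Lab.eq_of_term_of_cfg (ht : l.term = l'.term) (hc : l.cfg = l'.cfg) : l = l' := by
  cases l
  cases l'
  cases hc
  cases ht
  rfl

theorem Rule.unique_of_not_link (hR : R.InjOn Lab.cfg) (hlink : ∀ q y, ¬Link R v p l.cfg q y)
    (h : Rule R v p ps l) (hps : ps ⊆ R) (h' : Rule R v p ps' l') (hps' : ps' ⊆ R)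
    (hl : l.cfg = l'.cfg) : l.term = l'.term ∧ ps = ps' := by
  have hlink' {q y} (hk : Link R v p l'.cfg q y) : False := hlink q y (hl ▸ hk)
  generalize hp : p = p' at h'
  cases h with
  | link hk _ _ => exact (hlink _ _ hk).elim
  | con hv he _ =>
    cases h' with
    | link hk _ _ => exact (hlink' (hp ▸ hk)).elim
    | con hv' he' _ =>
      cases hv.symm.trans hv'
      obtain rfl := Ty.arrows_base_inj (he.symm.trans he')
      cases hl
      obtain rfl := funext fun j => Lab.eq_of_injOn_cfg hR (hps ⟨j, rfl⟩) (hps' ⟨j, rfl⟩)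
      exact ⟨rfl, rfl⟩
    | _ => cases hp
  | condArg hv =>
    cases h' with
    | link hk _ _ => exact (hlink' (hp ▸ hk)).elim
    | condArg hv' =>
      cases hv.symm.trans hv'
      obtain rfl := Fin.ext (Port.condBr.inj hp)
      simp only [Lab.cfg, Cfg.mk.injEq, true_and] at hl
      obtain ⟨rfl, ⟨rfl, -⟩⟩ := hl.imp_right TyCtx.argAt_inj
      cases Lab.eq_of_injOn_cfg hR (hps rfl) (hps' rfl)
      exact ⟨rfl, rfl⟩
    | _ => cases hp
  | recArg hv =>
    cases h' with
    | link hk _ _ => exact (hlink' (hp ▸ hk)).elim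
    | recArg hv' =>
      cases hv.symm.trans hv'
      obtain rfl := Fin.ext (Port.recBr.inj hp)
      simp only [Lab.cfg, Cfg.mk.injEq, List.cons.injEq, Entry.mk.injEq, heq_eq_eq, true_and,
        and_true, AlgTerm.mk.injEq] at hl
      obtain ⟨⟨⟨rfl, rfl⟩, rfl⟩, ⟨rfl, -⟩⟩ := hl.imp_right TyCtx.argAt_inj
      exact ⟨rfl, rfl⟩
    | _ => cases hp
  | _ =>
    rw [Set.singleton_subset_iff] at hps
    cases h' with
    | link hk _ _ => exact (hlink' (hp ▸ hk)).elim
    | _ => first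
      | cases hp; done
      | rw [Set.singleton_subset_iff] at hps'
        grind [Lab.cfg, hR hps hps']

theorem Rule.unique (hR : R.InjOn Lab.cfg) (h : Rule R v p ps l) (hps : ps ⊆ R)
    (h' : Rule R v p ps' l') (hps' : ps' ⊆ R) (hl : l.cfg = l'.cfg) : l = l' ∧ ps = ps' := by
  suffices key : l.term = l'.term ∧ ps = ps' from ⟨Lab.eq_of_term_of_cfg key.1 hl, key.2⟩
  by_cases hlink : ∃ q y, Link R v p l.cfg q y
  · obtain ⟨q, y, hlink⟩ := hlink
    exact h.unique_of_link hR hlink hps h' hps' hl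
  · exact h.unique_of_not_link hR (fun q y hk => hlink ⟨q, y, hk⟩) hps h' hps' hl

end Labels

/-! ### Derivable labels -/

section Derivable

variable {n : ℕ} {𝒜 : Fin n → FreeAlg} {Γ : Ctx 𝒜} {G : IGraph Γ}

/-- The labels derivable in at most `k` rounds of the rules. -/
def derivableIn (G : IGraph Γ) : ℕ → Set (Lab G)
  | 0 => ∅
  | k + 1 => {l | ∃ v p ps, Rule (derivableIn G k) v p ps l ∧ ps ⊆ derivableIn G k}

/-- The derivable labels. A tree of `T(G)` is a derivation of its root label, but it does not
contain the derivations of the side conditions. -/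
def derivable (G : IGraph Γ) : Set (Lab G) := ⋃ k, derivableIn G k

/-- `Pred G x l`: the label `x` is a premise of a rule deriving `l`. -/
def Pred (G : IGraph Γ) (x l : Lab G) : Prop :=
  ∃ v p ps, Rule (derivable G) v p ps l ∧ ps ⊆ derivable G ∧ x ∈ ps

/-- The least number of rounds in which a label is derivable (and `0` if there is none). -/
noncomputable def rank (l : Lab G) : ℕ := sInf {k | l ∈ derivableIn G k}

theorem derivableIn_subset_succ (k : ℕ) : derivableIn G k ⊆ derivableIn G (k + 1) := by
  induction k with
  | zero => exact Set.empty_subset _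
  | succ k ih =>
    rintro l ⟨v, p, ps, h, hps⟩
    exact ⟨v, p, ps, h.mono ih, hps.trans ih⟩

theorem derivableIn_mono : Monotone (derivableIn G) :=
  monotone_nat_of_le_succ derivableIn_subset_succ

theorem derivableIn_subset_derivable (k : ℕ) : derivableIn G k ⊆ derivable G :=
  Set.subset_iUnion _ k

variable {v v' : G.V} {p p' q : Port} {x l : Lab G} {ps ps' : Set (Lab G)}

theorem mem_derivableIn_rank (h : l ∈ derivable G) : l ∈ derivableIn G (rank l) :=
  Nat.sInf_mem (Set.mem_iUnion.mp h)

theorem exists_rule_of_mem_derivable (h : l ∈ derivable G) :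
    ∃ v p ps, Rule (derivable G) v p ps l ∧ ps ⊆ derivable G ∧ ∀ x ∈ ps, rank x < rank l := by
  have hl := mem_derivableIn_rank h
  cases hr : rank l with
  | zero => exact (hr ▸ hl).elim
  | succ k =>
    rw [hr] at hl
    obtain ⟨v, p, ps, h, hps⟩ := hl
    have hk := derivableIn_subset_derivable (G := G) k
    exact ⟨v, p, ps, h.mono hk, hps.trans hk, fun x hx => Nat.lt_succ_of_le (Nat.sInf_le (hps hx))⟩

theorem Wire.exists_of_iUnion {R : ℕ → Set (Lab G)} {x y : Cfg G}
    (h : Wire (⋃ k, R k) v p x q y) : ∃ k, Wire (R k) v p x q y := by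
  cases h with
  | lamVar hv => exact ⟨0, .lamVar hv⟩
  | lamBody hv => exact ⟨0, .lamBody hv⟩
  | appArg hv => exact ⟨0, .appArg hv⟩
  | appOut hv => exact ⟨0, .appOut hv⟩
  | cond hv h => exact (Set.mem_iUnion.mp h).imp fun _ h => .cond hv h
  | recOut hv h => exact (Set.mem_iUnion.mp h).imp fun _ h => .recOut hv h
  | recCall hv h hk => exact (Set.mem_iUnion.mp h).imp fun _ h => .recCall hv h hk

theorem StackOK.exists_of_iUnion {R : ℕ → Set (Lab G)} {o : Option G.V} {U : List (Entry G)}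
    (h : StackOK (⋃ k, R k) o U) : ∃ k, StackOK (R k) o U := by
  cases h with
  | nil => exact ⟨0, .nil⟩
  | cons hv h => exact (Set.mem_iUnion.mp h).imp fun _ h => .cons hv h

theorem Rule.exists_of_iUnion {R : ℕ → Set (Lab G)} (h : Rule (⋃ k, R k) v p ps l) :
    ∃ k, Rule (R k) v p ps l := by
  cases h with
  | link h hp ht =>
    rcases h with h | h
    · exact h.exists_of_iUnion.imp fun _ h => .link (Or.inl h) hp ht
    · exact h.exists_of_iUnion.imp fun _ h => .link (Or.inr h) hp ht
  | dupL hv => exact ⟨0, .dupL hv⟩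
  | dupR hv => exact ⟨0, .dupR hv⟩
  | box hv hU => exact hU.exists_of_iUnion.imp fun _ hU => .box hv hU
  | @con a c _ _ _ _ hv he hU =>
    by_cases hc : (𝒜 a).arity c = 0
    · exact (hU hc).exists_of_iUnion.imp fun _ hU => .con hv he fun _ => hU
    · exact ⟨0, .con hv he fun h => absurd h hc⟩
  | condArg hv => exact ⟨0, .condArg hv⟩
  | recArg hv => exact ⟨0, .recArg hv⟩

theorem Rule.finite {R : Set (Lab G)} (h : Rule R v p ps l) : ps.Finite := by
  cases h with
  | con => exact Set.finite_range _
  | _ => exact Set.finite_singleton _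

theorem Rule.mem_derivable (h : Rule (derivable G) v p ps l) (hps : ps ⊆ derivable G) :
    l ∈ derivable G := by
  obtain ⟨k, hk⟩ := h.exists_of_iUnion
  obtain ⟨m, hm⟩ := (h.finite.image rank).bddAbove
  refine derivableIn_subset_derivable (max k m + 1)
    ⟨v, p, ps, hk.mono (derivableIn_mono (le_max_left _ _)), fun x hx => ?_⟩
  have hxm : rank x ≤ m := hm (Set.mem_image_of_mem _ hx)
  exact derivableIn_mono (hxm.trans (le_max_right k m)) (mem_derivableIn_rank (hps hx))

theorem Rule.mem_derivable_of_singleton (h : Rule (derivable G) v p {x} l)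
    (hx : x ∈ derivable G) : l ∈ derivable G :=
  h.mem_derivable (Set.singleton_subset_iff.mpr hx)

theorem Pred.left_mem_derivable (h : Pred G x l) : x ∈ derivable G := by
  obtain ⟨v, p, ps, -, hps, hx⟩ := h
  exact hps hx

theorem Pred.right_mem_derivable (h : Pred G x l) : l ∈ derivable G := by
  obtain ⟨v, p, ps, h, hps, -⟩ := h
  exact h.mem_derivable hps

section Uniqueness

variable {A : Ty 𝒜} {D : Set (Ty 𝒜)} {d I : ℕ}

theorem IGraph.WF.injOn_cfg_derivableIn (hG : G.WF A D d I) (k : ℕ) :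
    (derivableIn G k).InjOn Lab.cfg := by
  induction k with
  | zero => exact Set.injOn_empty _
  | succ k ih =>
    rintro l ⟨v, p, ps, h, hps⟩ l' ⟨v', p', ps', h', hps'⟩ hl
    have hpos : p.isOut = p'.isOut := by
      rw [← h.positive, ← h'.positive]
      exact congrArg (fun c => c.ctx.positive) hl
    have hedge : l.edge = l'.edge := congrArg Cfg.edge hl
    have hat : (G.node v').At p' l.edge := hedge ▸ h'.at
    cases hG.uniq (z := .port v p) (z' := .port v' p') h.at hat hpos
    exact (h.unique ih hps h' hps' hl).1

theorem IGraph.WF.injOn_cfg_derivable (hG : G.WF A D d I) : (derivable G).InjOn Lab.cfg := by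
  intro l hl l' hl' h
  obtain ⟨k, hk⟩ := Set.mem_iUnion.mp hl
  obtain ⟨k', hk'⟩ := Set.mem_iUnion.mp hl'
  exact hG.injOn_cfg_derivableIn (max k k') (derivableIn_mono (le_max_left _ _) hk)
    (derivableIn_mono (le_max_right _ _) hk') h

theorem IGraph.WF.rule_unique (hG : G.WF A D d I) (h : Rule (derivable G) v p ps l)
    (hps : ps ⊆ derivable G) (h' : Rule (derivable G) v' p' ps' l) (hps' : ps' ⊆ derivable G) :
    v = v' ∧ p = p' ∧ ps = ps' := by
  cases hG.uniq (z := .port v p) (z' := .port v' p') h.at h'.at (h.positive.symm.trans h'.positive)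
  exact ⟨rfl, rfl, (h.unique hG.injOn_cfg_derivable hps h' hps' rfl).2⟩

theorem IGraph.WF.pred_iff (hG : G.WF A D d I) (h : Rule (derivable G) v p ps l)
    (hps : ps ⊆ derivable G) : Pred G x l ↔ x ∈ ps := by
  refine ⟨?_, fun hx => ⟨v, p, ps, h, hps, hx⟩⟩
  rintro ⟨v', p', ps', h', hps', hx⟩
  obtain ⟨-, -, rfl⟩ := hG.rule_unique h hps h' hps'
  exact hx

theorem IGraph.WF.rank_lt (hG : G.WF A D d I) (h : Pred G x l) : rank x < rank l := by
  obtain ⟨v, p, ps, hr, hps, hrank⟩ := exists_rule_of_mem_derivable h.right_mem_derivable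
  exact hrank x ((hG.pred_iff hr hps).mp h)

end Uniqueness

section Trees

variable {c c' : Cfg G} {t : Σ a, AlgTerm (𝒜 a)}

theorem Wire.left_mem_derivable (h : Wire (derivable G) v p c q c')
    (hp : c.ctx.positive = p.isOut) (hc' : ⟨t, c'.edge, c'.stack, c'.ctx⟩ ∈ derivable G) :
    ⟨t, c.edge, c.stack, c.ctx⟩ ∈ derivable G :=
  Rule.mem_derivable_of_singleton (x := ⟨t, c'.edge, c'.stack, c'.ctx⟩)
    (.link (Or.inl h) hp rfl) hc'

theorem Wire.right_mem_derivable (h : Wire (derivable G) v p c q c')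
    (hq : c'.ctx.positive = q.isOut) (hc : ⟨t, c.edge, c.stack, c.ctx⟩ ∈ derivable G) :
    ⟨t, c'.edge, c'.stack, c'.ctx⟩ ∈ derivable G :=
  Rule.mem_derivable_of_singleton (x := ⟨t, c.edge, c.stack, c.ctx⟩)
    (.link (Or.inr h) hq rfl) hc

theorem Step.mem_derivable {l l' : Lab G} (h : Step G l l') (hl' : l' ∈ derivable G) :
    l ∈ derivable G := by
  cases h with
  | lam_var hv hP => exact (Wire.lamVar hv).left_mem_derivable hP.1 hl'
  | lam_arg hv hN =>
    exact (Wire.lamVar hv).right_mem_derivable (by simp [TyCtx.positive, hN.1, Port.isOut]) hl'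
  | lam_out hv hP => exact (Wire.lamBody hv).right_mem_derivable hP.1 hl'
  | lam_body hv hN => exact (Wire.lamBody hv).left_mem_derivable hN.1 hl'
  | app_arg hv hP =>
    exact (Wire.appArg hv).right_mem_derivable (by simp [TyCtx.positive, hP.1, Port.isOut]) hl'
  | app_back hv hN => exact (Wire.appArg hv).left_mem_derivable hN.1 hl'
  | app_fun hv hN => exact (Wire.appOut hv).right_mem_derivable hN.1 hl'
  | app_out hv hP => exact (Wire.appOut hv).left_mem_derivable hP.1 hl'
  | dup_left hv => exact Rule.mem_derivable_of_singleton (.dupL hv) hl'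
  | dup_right hv => exact Rule.mem_derivable_of_singleton (.dupR hv) hl'

variable {A : Ty 𝒜} {D : Set (Ty 𝒜)} {d I : ℕ}

theorem IGraph.WF.nullary_mem_derivable (hG : G.WF A D d I) {a : Fin n} {c : Fin (𝒜 a).k}
    {e : G.Edge} {ts : Fin ((𝒜 a).arity c) → AlgTerm (𝒜 a)} {U : List (Entry G)}
    (hv : G.node v = .con a c e) (hc : (𝒜 a).arity c = 0)
    (hU : StackOK (derivable G) (G.boxPremise e) U) :
    ⟨⟨a, .mk c ts⟩, e, U, .hole⟩ ∈ derivable G := by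
  obtain ⟨i, hi⟩ : ∃ i, G.edgeTy e = Ty.arrows ((𝒜 a).arity c) (.base a i) (.base a i) := by
    simpa only [hv, IGraph.NodeOK] using hG.ok v
  have hl := (Rule.con (ts := ts) hv hi fun _ => hU).mem_derivable
    (Set.range_subset_iff.mpr fun j => absurd j.pos (by omega))
  rwa [show TyCtx.arrows ((𝒜 a).arity c) (.base a i) .hole = TyCtx.hole (𝒜 := 𝒜) by
    rw [hc]; rfl] at hl

theorem IGraph.WF.label_mem_derivable (hG : G.WF A D d I) {T : Tree G} (h : InT G T) :
    T.label ∈ derivable G := by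
  induction h with
  | step _ h ih => exact h.mem_derivable ih
  | con_zero hv hc hbox => exact hG.nullary_mem_derivable hv hc (hbox ▸ .nil)
  | con_zero_box hv hc hbox hr _ hl₀ ih =>
    exact hG.nullary_mem_derivable hv hc (hbox ▸ .cons hr (hl₀ ▸ ih))
  | con_succ hv hc he _ hl ih =>
    exact (Rule.con hv he fun h => absurd h hc.ne').mem_derivable
      (Set.range_subset_iff.mpr fun j => hl j ▸ ih j)
  | cond_out hv _ hl₀ _ hl hP ih₀ ih =>
    exact (Wire.cond hv (hl₀ ▸ ih₀)).left_mem_derivable hP.1 (hl ▸ ih)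
  | cond_in hv _ hl₀ _ hl hN ih₀ ih =>
    exact (Wire.cond hv (hl₀ ▸ ih₀)).right_mem_derivable
      (by simp [TyCtx.positive_arrows, hN.1, Port.isOut]) (hl ▸ ih)
  | cond_arg hv _ hl₀ _ ih₀ => exact Rule.mem_derivable_of_singleton (.condArg hv) (hl₀ ▸ ih₀)
  | rec_up hv _ hl₀ hk _ hl hP ih₀ ih =>
    exact (Wire.recCall hv (hl₀ ▸ ih₀) hk).left_mem_derivable
      (by simp [TyCtx.positive_arrows, TyCtx.positive_argAt, hP.1, Port.isOut]) (hl ▸ ih)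
  | rec_down hv _ hl₀ hk _ hl hN ih₀ ih =>
    exact (Wire.recCall hv (hl₀ ▸ ih₀) hk).right_mem_derivable
      (by simp [TyCtx.positive_arrows, hN.1, Port.isOut]) (hl ▸ ih)
  | rec_out hv _ hl₀ _ hl hP ih₀ ih =>
    exact (Wire.recOut hv (hl₀ ▸ ih₀)).left_mem_derivable hP.1 (hl ▸ ih)
  | rec_in hv _ hl₀ _ hl hN ih₀ ih =>
    exact (Wire.recOut hv (hl₀ ▸ ih₀)).right_mem_derivable
      (by simp [TyCtx.positive_arrows, hN.1, Port.isOut]) (hl ▸ ih)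
  | rec_arg hv _ hl₀ _ ih₀ => exact Rule.mem_derivable_of_singleton (.recArg hv) (hl₀ ▸ ih₀)
  | box hv hbox hr _ hl₀ _ hl ih₀ ih =>
    exact Rule.mem_derivable_of_singleton (.box hv (hbox ▸ .cons hr (hl₀ ▸ ih₀))) (hl ▸ ih)

end Trees

end Derivable

/-! ### Tiers and stacks -/

section Tiers

variable {n : ℕ} {𝒜 : Fin n → FreeAlg} {Γ : Ctx 𝒜} {G : IGraph Γ} {A : Ty 𝒜} {D : Set (Ty 𝒜)}
  {d I : ℕ} {R : Set (Lab G)} {v : G.V} {p q : Port} {x l : Lab G} {y z : Cfg G} {ps : Set (Lab G)}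

/-- The base type in the focus of the label has tier `i`. -/
def HasTier (l : Lab G) (i : ℕ) : Prop :=
  G.edgeTy l.edge = l.ctx.fill (.base l.term.1 i)

theorem IGraph.WF.edgeTy_eq_fill_iff_of_wire (hG : G.WF A D d I) (h : Wire R v p y q z)
    {X : Ty 𝒜} : G.edgeTy y.edge = y.ctx.fill X ↔ G.edgeTy z.edge = z.ctx.fill X := by
  have hok := hG.ok v
  cases h with
  | lamVar hv | lamBody hv | appArg hv | appOut hv =>
    rw [hv] at hok
    simp [hok.1, TyCtx.fill]
  | cond hv _ | recOut hv _ =>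
    rw [hv] at hok
    simp [hok.2.1, TyCtx.fill_arrows, Ty.arrows_inj]
  | recCall hv _ _ =>
    rw [hv] at hok
    simp only [hok.2.1, TyCtx.fill_arrows, Ty.arrows_inj, TyCtx.eq_fill_argAt]

theorem IGraph.WF.edgeTy_eq_fill_iff_of_link (hG : G.WF A D d I) (h : Link R v p y q z)
    {X : Ty 𝒜} : G.edgeTy y.edge = y.ctx.fill X ↔ G.edgeTy z.edge = z.ctx.fill X :=
  h.elim (fun h => hG.edgeTy_eq_fill_iff_of_wire h) fun h => (hG.edgeTy_eq_fill_iff_of_wire h).symm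

theorem Rule.term_fst_eq (h : Rule R v p ps l) (hx : x ∈ ps) : x.term.1 = l.term.1 := by
  cases h with
  | link _ _ ht => cases hx; rw [ht]
  | con => obtain ⟨j, rfl⟩ := hx; rfl
  | _ => cases hx; rfl

theorem IGraph.WF.hasTier_iff_of_rule (hG : G.WF A D d I) (h : Rule R v p ps l) (hx : x ∈ ps)
    {i : ℕ} : HasTier x i ↔ HasTier l i := by
  have hok := hG.ok v
  cases h with
  | link h _ ht =>
    cases hx
    rw [HasTier, HasTier, ht]
    exact (hG.edgeTy_eq_fill_iff_of_link h).symm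
  | con _ he _ =>
    obtain ⟨j, rfl⟩ := hx
    simp only [HasTier, he, TyCtx.eq_fill_argAt, TyCtx.fill_arrows, Ty.arrows_inj]
  | dupL hv | box hv _ =>
    cases hx
    rw [hv] at hok
    simp [HasTier, hok.1]
  | dupR hv =>
    cases hx
    rw [hv] at hok
    simp [HasTier, hok.2.1]
  | condArg hv | recArg hv =>
    cases hx
    rw [hv] at hok
    simp only [HasTier, hok.2.1, TyCtx.eq_fill_argAt]

theorem IGraph.WF.exists_hasTier (hG : G.WF A D d I) (h : l ∈ derivable G) :
    ∃ i, HasTier l i := by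
  obtain ⟨k, hk⟩ := Set.mem_iUnion.mp h
  clear h
  induction k generalizing l with
  | zero => exact hk.elim
  | succ k ih =>
    obtain ⟨v, p, ps, hrule, hps⟩ := hk
    have of_premise {x} (hx : x ∈ ps) : ∃ i, HasTier l i :=
      (ih (hps hx)).imp fun _ => (hG.hasTier_iff_of_rule hrule hx).mp
    cases hrule with
    | @con _ _ _ i _ _ _ he _ =>
      exact ⟨i, by rw [HasTier, he, TyCtx.fill_arrows, TyCtx.fill]⟩
    | _ => exact of_premise rfl

/-- The tier of the recurrence argument of a recursion vertex (and `0` at other vertices). -/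
def IGraph.tier (G : IGraph Γ) (v : G.V) : ℕ :=
  match G.node v with
  | .recur _ e₀ _ _ => (G.edgeTy e₀).level
  | _ => 0

/-- The rest of the stack from the innermost box of tier at most `i` on. A rule for labels of tier
`i` only changes the entries above it. -/
def anchor (i : ℕ) (U : List (Entry G)) : List (Entry G) :=
  U.dropWhile fun x => decide (i < G.tier x.vtx)

section Anchor

variable {i : ℕ} {s : Entry G} {U : List (Entry G)}

theorem anchor_cons_of_lt (h : i < G.tier s.vtx) : anchor i (s :: U) = anchor i U := by
  simp [anchor, h]

theorem anchor_cons_of_le (h : G.tier s.vtx ≤ i) : anchor i (s :: U) = s :: U := by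
  simp [anchor, h]

theorem anchor_suffix_cons : anchor i U <:+ anchor i (s :: U) := by
  rcases lt_or_ge i (G.tier s.vtx) with h | h
  · rw [anchor_cons_of_lt h]
  · rw [anchor_cons_of_le h]
    exact (List.dropWhile_suffix _).trans (List.suffix_cons _ _)

end Anchor

theorem IGraph.WF.lt_tier_of_edgeTy_eq_fill (hG : G.WF A D d I) {a : Fin n} {e₀ g : G.Edge}
    {es : Fin (𝒜 a).k → G.Edge} {P : TyCtx 𝒜} {b : Fin n} {i : ℕ}
    (hv : G.node v = .recur a e₀ es g) (hg : G.edgeTy g = P.fill (.base b i)) :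
    i < G.tier v := by
  have hok := hG.ok v
  rw [hv] at hok
  obtain ⟨⟨m, hm, hlt, -⟩, -⟩ := hok
  calc i ≤ (G.edgeTy g).level := hg ▸ TyCtx.le_level_fill
    _ < m := hlt
    _ = G.tier v := by simp only [IGraph.tier, hv, hm, Ty.level]

theorem IGraph.WF.anchor_eq_of_wire (hG : G.WF A D d I) (h : Wire R v p y q z) {b : Fin n} {i : ℕ}
    (hy : G.edgeTy y.edge = y.ctx.fill (.base b i)) : anchor i y.stack = anchor i z.stack := by
  cases h with
  | recOut hv _ => exact (anchor_cons_of_lt (hG.lt_tier_of_edgeTy_eq_fill hv hy)).symm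
  | recCall hv _ _ =>
    have hok := hG.ok v
    rw [hv] at hok
    simp only [hok.2.1, TyCtx.fill_arrows, Ty.arrows_inj, TyCtx.eq_fill_argAt] at hy
    have hlt := hG.lt_tier_of_edgeTy_eq_fill hv hy
    exact (anchor_cons_of_lt hlt).trans (anchor_cons_of_lt hlt).symm
  | _ => rfl

theorem IGraph.WF.anchor_suffix_of_rule (hG : G.WF A D d I) (h : Rule R v p ps l) (hx : x ∈ ps)
    {i : ℕ} (hi : HasTier l i) : anchor i x.stack <:+ anchor i l.stack := by
  cases h with
  | link h _ _ =>
    cases hx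
    rcases h with h | h
    · exact (hG.anchor_eq_of_wire h hi).symm ▸ List.suffix_rfl
    · exact hG.anchor_eq_of_wire h ((hG.edgeTy_eq_fill_iff_of_wire h).mpr hi) ▸ List.suffix_rfl
  | dupL | dupR | condArg => cases hx; exact List.suffix_rfl
  | con => obtain ⟨j, rfl⟩ := hx; exact List.suffix_rfl
  | box | recArg => cases hx; exact anchor_suffix_cons

/-- The stacks of the derivable labels on the edges whose innermost box belongs to `o`: one entry
for each box around the edge, innermost first. -/
inductive StackValid (G : IGraph Γ) : Option G.V → List (Entry G) → Prop
  | nil : StackValid G none []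
  | cons {v e₀ b u t U} (hv : G.RecPremise v e₀)
      (hR : ⟨⟨b, AlgCtx.plug u t⟩, e₀, U, .hole⟩ ∈ derivable G)
      (h : StackValid G (G.boxPremise e₀) U) : StackValid G (some v) (⟨b, u, t, v⟩ :: U)

theorem IGraph.RecPremise.unique {e e' : G.Edge} (h : G.RecPremise v e)
    (h' : G.RecPremise v e') : e = e' := by
  obtain ⟨a, es, g, h⟩ := h
  obtain ⟨a', es', g', h'⟩ := h'
  cases h.symm.trans h'
  rfl

theorem StackValid.tail {s : Entry G} {U : List (Entry G)} (h : StackValid G (some v) (s :: U))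
    {e₀ : G.Edge} (hv : G.RecPremise v e₀) : StackValid G (G.boxPremise e₀) U := by
  cases h with
  | cons hv' _ h => exact hv.unique hv' ▸ h

theorem StackValid.length_eq {o : Option G.V} {U U' : List (Entry G)} (h : StackValid G o U)
    (h' : StackValid G o U') : U.length = U'.length := by
  induction h generalizing U' with
  | nil => cases h'; rfl
  | cons hv _ _ ih =>
    cases h' with
    | cons hv' _ h' => rw [List.length_cons, List.length_cons, ih (hv.unique hv' ▸ h')]

theorem IGraph.WF.stackValid_iff_of_wire (hG : G.WF A D d I) (h : Wire (derivable G) v p y q z) :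
    StackValid G (G.boxPremise y.edge) y.stack ↔ StackValid G (G.boxPremise z.edge) z.stack := by
  have hok := hG.ok v
  cases h with
  | lamVar hv | lamBody hv | appArg hv | appOut hv =>
    rw [hv] at hok
    simp [hok.2]
  | cond hv _ =>
    rw [hv] at hok
    simp [hok.2.2]
  | recOut hv hR =>
    rw [hv] at hok
    simp only [hok.2.2.2, ← hok.2.2.1]
    exact ⟨.cons ⟨_, _, _, hv⟩ hR, fun h => h.tail ⟨_, _, _, hv⟩⟩
  | recCall hv hR _ =>
    rw [hv] at hok
    simp only [hok.2.2.2]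
    refine ⟨fun h => .cons ⟨_, _, _, hv⟩ ?_ (h.tail ⟨_, _, _, hv⟩), fun h =>
      .cons ⟨_, _, _, hv⟩ hR (h.tail ⟨_, _, _, hv⟩)⟩
    rwa [AlgCtx.plug_comp, AlgCtx.plug_arg]

theorem StackOK.stackValid {o : Option G.V} {U : List (Entry G)} (h : StackOK R o U)
    (hR : R ⊆ derivable G) (hval : ∀ x ∈ R, StackValid G (G.boxPremise x.edge) x.stack) :
    StackValid G o U := by
  cases h with
  | nil => exact .nil
  | cons hv h => exact .cons hv (hR h) (hval _ h)

theorem IGraph.WF.stackValid_of_rule (hG : G.WF A D d I) (h : Rule R v p ps l)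
    (hps : ps ⊆ R) (hR : R ⊆ derivable G)
    (hval : ∀ x ∈ R, StackValid G (G.boxPremise x.edge) x.stack) :
    StackValid G (G.boxPremise l.edge) l.stack := by
  have hok := hG.ok v
  cases h with
  | link h _ _ =>
    rcases h.mono hR with h | h
    · exact (hG.stackValid_iff_of_wire h).mpr (hval _ (hps rfl))
    · exact (hG.stackValid_iff_of_wire h).mp (hval _ (hps rfl))
  | dupL hv | dupR hv =>
    rw [hv] at hok
    simpa only [hok.2.2.2] using hval _ (hps rfl)
  | box _ hU => exact hU.stackValid hR hval
  | @con a c _ _ _ _ _ _ hU =>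
    by_cases hc : (𝒜 a).arity c = 0
    · exact (hU hc).stackValid hR hval
    · have hx := hval _ (hps (Set.mem_range_self ⟨0, Nat.pos_of_ne_zero hc⟩))
      exact hx
  | condArg hv =>
    rw [hv] at hok
    simpa only [hok.2.2] using hval _ (hps rfl)
  | recArg hv =>
    rw [hv] at hok
    simp only [hok.2.2.2]
    exact .cons ⟨_, _, _, hv⟩ (hR (hps rfl)) (hval _ (hps rfl))

theorem IGraph.WF.stackValid (hG : G.WF A D d I) (h : l ∈ derivable G) :
    StackValid G (G.boxPremise l.edge) l.stack := by
  obtain ⟨k, hk⟩ := Set.mem_iUnion.mp h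
  clear h
  induction k generalizing l with
  | zero => exact hk.elim
  | succ k ih =>
    obtain ⟨v, p, ps, hrule, hps⟩ := hk
    exact hG.stackValid_of_rule hrule hps (derivableIn_subset_derivable k) fun x => ih

end Tiers

/-! ### Ancestors and consumers of a label -/

section Ancestors

variable {n : ℕ} {𝒜 : Fin n → FreeAlg} {Γ : Ctx 𝒜} {G : IGraph Γ}

/-- `Anc G x l`: the label `x` occurs in the derivation of `l`. -/
def Anc (G : IGraph Γ) (x l : Lab G) : Prop := Relation.ReflTransGen (Pred G) x l

/-- `Enters R v q x l`: the label `l` is derived from `x`, among others, at the vertex `v`, which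
the term of `x` enters through the port `q`. -/
inductive Enters (R : Set (Lab G)) : G.V → Port → Lab G → Lab G → Prop
  | link {v q p x l} (h : Link R v q x.cfg p l.cfg) (hq : x.ctx.positive = !q.isOut)
      (ht : l.term = x.term) : Enters R v q x l
  | dup {v e g h t U l} (hv : G.node v = .dup e g h) : Enters R v .dupIn ⟨t, h, U, .hole⟩ l
  | box {v a e g t U l} (hv : G.node v = .boxPrem a e g) : Enters R v .boxIn ⟨t, e, U, .hole⟩ l
  | con {v a c e i U ts j} (hv : G.node v = .con a c e)
      (he : G.edgeTy e = Ty.arrows ((𝒜 a).arity c) (.base a i) (.base a i)) :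
      Enters R v .con ⟨⟨a, ts j⟩, e, U, TyCtx.argAt (.base a i) j .hole (.base a i)⟩
        ⟨⟨a, .mk c ts⟩, e, U, TyCtx.arrows ((𝒜 a).arity c) (.base a i) .hole⟩
  | condArg {v a e₀ es g} {c : Fin (𝒜 a).k} {ts U} {j : Fin ((𝒜 a).arity c)}
      (hv : G.node v = .cond a e₀ es g) :
      Enters R v .condArg ⟨⟨a, .mk c ts⟩, e₀, U, .hole⟩
        ⟨⟨a, ts j⟩, es c, U, TyCtx.argAt (G.edgeTy e₀) j .hole (G.edgeTy g)⟩
  | recArg {v a e₀ es g} {c : Fin (𝒜 a).k} {ts U} {u : AlgCtx (𝒜 a)}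
      {j : Fin ((𝒜 a).arity c)} (hv : G.node v = .recur a e₀ es g) :
      Enters R v .recArg ⟨⟨a, u.plug (.mk c ts)⟩, e₀, U, .hole⟩
        ⟨⟨a, ts j⟩, es c, ⟨a, u, .mk c ts, v⟩ :: U, TyCtx.argAt (G.edgeTy e₀) j .hole
          (Ty.arrows ((𝒜 a).arity c) (G.edgeTy g) (G.edgeTy g))⟩

variable {A : Ty 𝒜} {D : Set (Ty 𝒜)} {d I i : ℕ} {R : Set (Lab G)} {v v' : G.V} {p q q' : Port}
  {x y l l' r : Lab G} {ps : Set (Lab G)}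

theorem Anc.mem_derivable (h : Anc G x l) (hl : l ∈ derivable G) : x ∈ derivable G := by
  cases h.cases_head with
  | inl h => exact h ▸ hl
  | inr h => exact h.choose_spec.1.left_mem_derivable

theorem IGraph.WF.rank_le (hG : G.WF A D d I) (h : Anc G x l) : rank x ≤ rank l := by
  induction h with
  | refl => exact le_rfl
  | tail _ h ih => exact ih.trans (hG.rank_lt h).le

theorem IGraph.WF.finite_anc (hG : G.WF A D d I) (hl : l ∈ derivable G) :
    {x | Anc G x l}.Finite := by
  induction hr : rank l using Nat.strong_induction_on generalizing l with
  | _ k ih =>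
    subst hr
    obtain ⟨v, p, ps, h, hps, hrank⟩ := exists_rule_of_mem_derivable hl
    refine ((Set.finite_singleton l).union (h.finite.biUnion fun x hx =>
      ih _ (hrank x hx) (hps hx) rfl)).subset fun x hx => ?_
    rcases Relation.ReflTransGen.cases_tail hx with rfl | ⟨y, hxy, hy⟩
    · exact Or.inl rfl
    · exact Or.inr (Set.mem_biUnion ((hG.pred_iff h hps).mp hy) hxy)

theorem Anc.term_fst_eq (h : Anc G x l) : x.term.1 = l.term.1 := by
  induction h with
  | refl => rfl
  | tail _ h ih =>
    obtain ⟨v, p, ps, hr, -, hx⟩ := h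
    exact ih.trans (hr.term_fst_eq hx)

theorem IGraph.WF.hasTier_iff_of_anc (hG : G.WF A D d I) (h : Anc G x l) :
    HasTier x i ↔ HasTier l i := by
  induction h with
  | refl => exact Iff.rfl
  | tail _ h ih =>
    obtain ⟨v, p, ps, hr, -, hx⟩ := h
    exact ih.trans (hG.hasTier_iff_of_rule hr hx)

theorem IGraph.WF.anchor_suffix_of_anc (hG : G.WF A D d I) (h : Anc G x l) (hl : HasTier l i) :
    anchor i x.stack <:+ anchor i l.stack := by
  induction h with
  | refl => exact List.suffix_rfl
  | tail _ h ih =>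
    obtain ⟨v, p, ps, hr, -, hx⟩ := h
    exact (ih ((hG.hasTier_iff_of_rule hr hx).mpr hl)).trans (hG.anchor_suffix_of_rule hr hx hl)

theorem Rule.exists_enters (h : Rule R v p ps l) (hx : x ∈ ps) : ∃ q, Enters R v q x l := by
  cases h with
  | link h hp ht =>
    cases hx
    exact ⟨_, .link h.symm (h.positive_eq_not_isOut hp) ht⟩
  | dupL hv | dupR hv => cases hx; exact ⟨_, .dup hv⟩
  | box hv _ => cases hx; exact ⟨_, .box hv⟩
  | con hv he _ => obtain ⟨j, rfl⟩ := hx; exact ⟨_, .con hv he⟩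
  | condArg hv => cases hx; exact ⟨_, .condArg hv⟩
  | recArg hv => cases hx; exact ⟨_, .recArg hv⟩

theorem Pred.exists_enters (h : Pred G x l) : ∃ v q, Enters (derivable G) v q x l := by
  obtain ⟨v, p, ps, hr, -, hx⟩ := h
  exact ⟨v, hr.exists_enters hx⟩

theorem Enters.at (h : Enters R v q x l) : (G.node v).At q x.edge := by
  cases h with
  | link h _ _ => exact h.at_left
  | _ => simp [Node.At, *]

theorem Enters.positive (h : Enters R v q x l) : x.ctx.positive = !q.isOut := by
  cases h with
  | link _ hq _ => exact hq
  | _ => simp [TyCtx.positive_argAt, TyCtx.positive, Port.isOut]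

theorem IGraph.WF.enters_port_unique (hG : G.WF A D d I) (h : Enters R v q x l)
    (h' : Enters R v' q' x l') : v = v' ∧ q = q' := by
  have hout : q.isOut = q'.isOut := Bool.not_inj (h.positive.symm.trans h'.positive)
  cases hG.uniq (z := .port v q) (z' := .port v' q') h.at h'.at hout
  exact ⟨rfl, rfl⟩

theorem Enters.term_eq_of_link {c : Cfg G} (h : Enters R v q x l) (hl : Link R v q x.cfg p c)
    (hR : R.InjOn Lab.cfg) : l.term = x.term ∧ l.cfg = c := by
  cases h with
  | link h _ ht => exact ⟨ht, (h.unique hR hl).2⟩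
  | _ => rcases hl with hl | hl <;> cases hl

theorem Link.port_ne {c c' : Cfg G} (h : Link R v p c q c') :
    p ≠ .con ∧ p ≠ .condArg ∧ p ≠ .recArg := by
  rcases h with h | h <;> cases h <;> simp

theorem Enters.eq_of_con (h : Enters R v .con x l) (h' : Enters R v .con x l')
    (hR : R.InjOn Lab.cfg) (hl : l ∈ R) (hl' : l' ∈ R) : l = l' := by
  generalize hx : x = x' at h'
  cases h with
  | link h _ _ => exact absurd rfl h.port_ne.1
  | con hv he =>
    cases h' with
    | link h _ _ => exact absurd rfl h.port_ne.1
    | con hv' he' =>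
      cases hv.symm.trans hv'
      obtain rfl := Ty.arrows_base_inj (he.symm.trans he')
      have hU := congrArg Lab.stack hx
      exact hR hl hl' (by cases hU; rfl)

/-- The number of the constructors of the term in a label. -/
def Lab.size (l : Lab G) : ℕ := l.term.2.size

theorem sum_size_le_of_enters_condArg {E : Finset (Lab G)}
    (hE : ∀ l ∈ E, Enters R v .condArg x l) : ∑ l ∈ E, l.size ≤ x.size := by
  classical
  obtain rfl | ⟨l₀, hl₀⟩ := E.eq_empty_or_nonempty
  · exact Nat.zero_le _
  cases hE l₀ hl₀ with
  | link h _ _ => exact absurd rfl h.port_ne.2.1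
  | @condArg a e₀ es g c ts U _ hv =>
    let f (j : Fin ((𝒜 a).arity c)) : Lab G :=
      ⟨⟨a, ts j⟩, es c, U, TyCtx.argAt (G.edgeTy e₀) j .hole (G.edgeTy g)⟩
    have hsub : E ⊆ Finset.univ.image f := by
      intro l hl
      generalize hx : (⟨⟨a, .mk c ts⟩, e₀, U, .hole⟩ : Lab G) = x at hE
      cases hE l hl with
      | link h _ _ => exact absurd rfl h.port_ne.2.1
      | condArg hv' =>
        cases hv.symm.trans hv'
        cases hx
        exact Finset.mem_image_of_mem f (Finset.mem_univ _)
    calc ∑ l ∈ E, l.size ≤ ∑ l ∈ Finset.univ.image f, l.size := Finset.sum_le_sum_of_subset hsub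
      _ ≤ ∑ j, (f j).size := Finset.sum_image_le_of_nonneg fun _ _ => Nat.zero_le _
      _ ≤ _ := AlgTerm.sum_size_lt.le

theorem sum_size_le_of_enters_recArg {E : Finset (Lab G)} {S : List (Entry G)}
    (hE : ∀ l ∈ E, Enters R v .recArg x l) (hS : ∀ l ∈ E, l.stack = S) :
    ∑ l ∈ E, l.size ≤ x.size := by
  classical
  obtain rfl | ⟨l₀, hl₀⟩ := E.eq_empty_or_nonempty
  · exact Nat.zero_le _
  have hS₀ := hS l₀ hl₀
  cases hE l₀ hl₀ with
  | link h _ _ => exact absurd rfl h.port_ne.2.2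
  | @recArg a e₀ es g c ts U u _ hv =>
    subst hS₀
    let f (j : Fin ((𝒜 a).arity c)) : Lab G :=
      ⟨⟨a, ts j⟩, es c, ⟨a, u, .mk c ts, v⟩ :: U, TyCtx.argAt (G.edgeTy e₀) j .hole
        (Ty.arrows ((𝒜 a).arity c) (G.edgeTy g) (G.edgeTy g))⟩
    have hsub : E ⊆ Finset.univ.image f := by
      intro l hl
      have hSl := hS l hl
      generalize hx : (⟨⟨a, u.plug (.mk c ts)⟩, e₀, U, .hole⟩ : Lab G) = x at hE
      cases hE l hl with
      | link h _ _ => exact absurd rfl h.port_ne.2.2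
      | recArg hv' =>
        cases hv.symm.trans hv'
        cases hSl
        exact Finset.mem_image_of_mem f (Finset.mem_univ _)
    calc ∑ l ∈ E, l.size ≤ ∑ l ∈ Finset.univ.image f, l.size := Finset.sum_le_sum_of_subset hsub
      _ ≤ ∑ j, (f j).size := Finset.sum_image_le_of_nonneg fun _ _ => Nat.zero_le _
      _ ≤ (AlgTerm.mk c ts).size := AlgTerm.sum_size_lt.le
      _ ≤ _ := AlgCtx.size_le_plug _ _

theorem IGraph.WF.edgeTy_eq_base_tier (hG : G.WF A D d I) {a : Fin n} {e₀ : G.Edge}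
    {es : Fin (𝒜 a).k → G.Edge} {g : G.Edge} (hv : G.node v = .recur a e₀ es g) :
    G.edgeTy e₀ = .base a (G.tier v) ∧ G.tier v ≤ I := by
  have hok := hG.ok v
  rw [hv] at hok
  obtain ⟨⟨m, hm, -, hmI⟩, -⟩ := hok
  simp only [IGraph.tier, hv, hm, Ty.level, hmI, and_self]

theorem IGraph.WF.stack_eq_of_enters_recArg (hG : G.WF A D d I) {α : List (Entry G)}
    (hx : HasTier x i) (h : Enters R v .recArg x l) (h' : Enters R v .recArg x l')
    (hl : anchor i l.stack <:+ α) (hl' : anchor i l'.stack <:+ α) : l.stack = l'.stack := by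
  generalize hxx' : x = x' at h'
  cases h with
  | link h _ _ => exact absurd rfl h.port_ne.2.2
  | recArg hv =>
    cases h' with
    | link h _ _ => exact absurd rfl h.port_ne.2.2
    | recArg hv' =>
      cases hv.symm.trans hv'
      have htier : G.tier v = i := (Ty.base.inj ((hG.edgeTy_eq_base_tier hv).1.symm.trans hx)).2
      rw [anchor_cons_of_le htier.le] at hl hl'
      have hU := congrArg Lab.stack hxx'
      have hlen := congrArg (fun U => List.length U + 1) hU
      exact (List.suffix_of_suffix_length_le hl hl' hlen.le).eq_of_length hlen

theorem sum_min_size_le_of_subsingleton {E : Finset (Lab G)}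
    (hE : (E : Set (Lab G)).Subsingleton) : ∑ l ∈ E, min x.size l.size ≤ x.size := by
  obtain rfl | ⟨l, hl⟩ := E.eq_empty_or_nonempty
  · exact Nat.zero_le _
  · obtain rfl : E = {l} := Finset.coe_injective (by simpa using hE.eq_singleton_of_mem hl)
    simp

theorem IGraph.WF.sum_min_size_le_of_notMem (hG : G.WF A D d I) {E : Finset (Lab G)}
    {α : List (Entry G)} (hx : HasTier x i) (hD : Ty.base x.term.1 i ∉ D)
    (hE : ∀ l ∈ E, Pred G x l) (hα : ∀ l ∈ E, anchor i l.stack <:+ α) :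
    ∑ l ∈ E, min x.size l.size ≤ x.size := by
  obtain rfl | ⟨l₀, hl₀⟩ := E.eq_empty_or_nonempty
  · exact Nat.zero_le _
  obtain ⟨v, q, h₀⟩ := (hE l₀ hl₀).exists_enters
  have hen (l) (hl : l ∈ E) : Enters (derivable G) v q x l := by
    obtain ⟨v', q', h⟩ := (hE l hl).exists_enters
    obtain ⟨rfl, rfl⟩ := hG.enters_port_unique h₀ h
    exact h
  have of_sum (h : ∑ l ∈ E, l.size ≤ x.size) : ∑ l ∈ E, min x.size l.size ≤ x.size :=
    (Finset.sum_le_sum fun _ _ => min_le_right _ _).trans h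
  have hok := hG.ok v
  have hinj := hG.injOn_cfg_derivable
  cases h₀ with
  | link h _ _ =>
    refine sum_min_size_le_of_subsingleton fun l hl l' hl' => ?_
    obtain ⟨ht, hc⟩ := (hen l hl).term_eq_of_link h hinj
    obtain ⟨ht', hc'⟩ := (hen l' hl').term_eq_of_link h hinj
    exact Lab.eq_of_term_of_cfg (ht.trans ht'.symm) (hc.trans hc'.symm)
  | con =>
    exact sum_min_size_le_of_subsingleton fun l hl l' hl' => (hen l hl).eq_of_con (hen l' hl') hinj
      (hE l hl).right_mem_derivable (hE l' hl').right_mem_derivable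
  | dup hv =>
    rw [hv] at hok
    exact absurd (Set.mem_of_eq_of_mem (Eq.symm hx) hok.2.2.1) hD
  | box hv =>
    rw [hv] at hok
    exact absurd (Set.mem_of_eq_of_mem (Eq.symm hx) (hok.1 ▸ hok.2.1)) hD
  | condArg => exact of_sum (sum_size_le_of_enters_condArg hen)
  | recArg =>
    exact of_sum (sum_size_le_of_enters_recArg hen fun l hl =>
      hG.stack_eq_of_enters_recArg hx (hen l hl) (hen _ hl₀) (hα l hl) (hα _ hl₀))

theorem IGraph.WF.pred_unique (hG : G.WF A D d I) (hw : (𝒜 l.term.1).IsWord) (hx : Pred G x l)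
    (hy : Pred G y l) : x = y := by
  obtain ⟨v, p, ps, h, hps, hx⟩ := hx
  rw [hG.pred_iff h hps] at hy
  cases h with
  | @con a c _ _ _ _ _ _ _ =>
    obtain ⟨j, rfl⟩ := hx
    obtain ⟨j', rfl⟩ := hy
    have hc := hw.arity_le c
    obtain rfl : j = j' := Fin.ext (by dsimp only at hc; omega)
    rfl
  | _ => exact hx.trans hy.symm

theorem IGraph.WF.anc_total (hG : G.WF A D d I) (hw : (𝒜 r.term.1).IsWord) (hx : Anc G x r)
    (hy : Anc G y r) : Anc G x y ∨ Anc G y x := by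
  induction hx using Relation.ReflTransGen.head_induction_on with
  | refl => exact .inr hy
  | @head x x' hxx' hx' ih =>
    rcases ih with ih | ih
    · exact .inl (.head hxx' ih)
    rcases Relation.ReflTransGen.cases_tail ih with rfl | ⟨z, hyz, hz⟩
    · exact .inl (.single hxx')
    · have hw' : (𝒜 x'.term.1).IsWord := Anc.term_fst_eq hx' ▸ hw
      exact .inr (hG.pred_unique hw' hz hxx' ▸ hyz)

theorem IGraph.WF.consumer_unique (hG : G.WF A D d I) (hw : (𝒜 r.term.1).IsWord)
    (hxl : Pred G x l) (hxl' : Pred G x l') (hl : Anc G l r) (hl' : Anc G l' r) : l = l' := by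
  wlog h : Anc G l l' generalizing l l'
  · exact (this hxl' hxl hl' hl ((hG.anc_total hw hl hl').resolve_left h)).symm
  rcases Relation.ReflTransGen.cases_tail h with h | ⟨z, hlz, hz⟩
  · exact h.symm
  · cases hG.pred_unique (hl'.term_fst_eq ▸ hw) hz hxl'
    exact absurd (hG.rank_lt hxl) (hG.rank_le hlz).not_gt

end Ancestors

/-! ### Counting constructor labels -/

theorem encard_biUnion_le_mul {α β : Type*} {s : Set α} {t : α → Set β} {N : ℕ∞}
    (h : ∀ a ∈ s, (t a).encard ≤ N) : (⋃ a ∈ s, t a).encard ≤ s.encard * N := by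
  rcases s.finite_or_infinite with hs | hs
  · calc (⋃ a ∈ s, t a).encard
        = (⋃ a ∈ hs.toFinset, t a).encard := by simp only [hs.mem_toFinset]
      _ ≤ ∑ a ∈ hs.toFinset, (t a).encard := Finset.set_encard_biUnion_le _ _
      _ ≤ hs.toFinset.card • N := Finset.sum_le_card_nsmul _ _ _ fun a ha =>
          h a (hs.mem_toFinset.mp ha)
      _ = s.encard * N := by rw [nsmul_eq_mul, hs.encard_eq_coe_toFinset_card]
  · obtain rfl | hN := eq_or_ne N 0
    · have hempty : ⋃ a ∈ s, t a = ∅ := by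
        simpa only [Set.iUnion_eq_empty, nonpos_iff_eq_zero, Set.encard_eq_zero] using h
      simp [hempty]
    · simp [hs.encard_eq, ENat.top_mul hN]

section ConstructorLabels

variable {n : ℕ} {𝒜 : Fin n → FreeAlg} {Γ : Ctx 𝒜} {G : IGraph Γ}

/-- The label `l` is derived at a constructor vertex. -/
def IsCon (G : IGraph Γ) (l : Lab G) : Prop := ∃ v ps, Rule (derivable G) v .con ps l

variable {A : Ty 𝒜} {D : Set (Ty 𝒜)} {d I i N : ℕ} {R : Set (Lab G)} {v : G.V} {p : Port}
  {x l r : Lab G} {ps : Set (Lab G)}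

theorem Rule.cfg_eq_of_con {ps' : Set (Lab G)} {l' : Lab G}
    (h : Rule R v .con ps l) (h' : Rule R v .con ps' l') (hU : l.stack = l'.stack) :
    l.cfg = l'.cfg := by
  cases h with
  | link h _ _ => exact absurd rfl h.port_ne.1
  | con hv he =>
    cases h' with
    | link h _ _ => exact absurd rfl h.port_ne.1
    | con hv' he' =>
      cases hv.symm.trans hv'
      obtain rfl := Ty.arrows_base_inj (he.symm.trans he')
      cases hU
      rfl

theorem Rule.node_eq_of_con (h : Rule R v .con ps l) :
    ∃ a c, G.node v = .con a c l.edge := by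
  cases h with
  | link h _ _ => exact absurd rfl h.port_ne.1
  | con hv => exact ⟨_, _, hv⟩

theorem Rule.exists_size_le (h : Rule R v p ps l) (hp : p ≠ .con) : ∃ x ∈ ps, l.size ≤ x.size := by
  cases h with
  | link _ _ ht => exact ⟨_, rfl, by rw [Lab.size, Lab.size, ht]⟩
  | con => exact absurd rfl hp
  | condArg => exact ⟨_, rfl, AlgTerm.arg_size_lt.le⟩
  | recArg => exact ⟨_, rfl, AlgTerm.arg_size_lt.le.trans (AlgCtx.size_le_plug _ _)⟩
  | _ => exact ⟨_, rfl, le_rfl⟩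

theorem Rule.size_le_of_con {F : Finset (Lab G)} (h : Rule R v .con ps l) (hF : ps ⊆ F) :
    l.size ≤ 1 + ∑ x ∈ F, min x.size l.size := by
  cases h with
  | link h _ _ => exact absurd rfl h.port_ne.1
  | @con a c e i U ts =>
    set l : Lab G := ⟨⟨a, .mk c ts⟩, e, U, TyCtx.arrows ((𝒜 a).arity c) (.base a i) .hole⟩
    let f : Fin ((𝒜 a).arity c) ↪ Lab G :=
      ⟨fun j => ⟨⟨a, ts j⟩, e, U, TyCtx.argAt (.base a i) j .hole (.base a i)⟩,
        fun j j' h => (TyCtx.argAt_inj (congrArg Lab.ctx h)).1⟩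
    have hsub : Finset.univ.map f ⊆ F := fun x hx => by
      obtain ⟨j, -, rfl⟩ := Finset.mem_map.mp hx
      exact hF ⟨j, rfl⟩
    calc l.size = 1 + ∑ j, (f j).size := by simp only [Lab.size, AlgTerm.size, f, l]; rfl
      _ = 1 + ∑ j, min (f j).size l.size :=
        congrArg (1 + ·) (Finset.sum_congr rfl fun j _ =>
          (min_eq_left (AlgTerm.arg_size_lt (ts := ts)).le).symm)
      _ = 1 + ∑ x ∈ Finset.univ.map f, min x.size l.size := by rw [Finset.sum_map]
      _ ≤ 1 + ∑ x ∈ F, min x.size l.size := by gcongr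

open Classical in
theorem IGraph.WF.size_le_sum_pred (hG : G.WF A D d I) {F : Finset (Lab G)}
    (hl : l ∈ derivable G) (hF : ∀ x, Pred G x l → x ∈ F) :
    l.size ≤ (if IsCon G l then 1 else 0) + ∑ x ∈ F with Pred G x l, min x.size l.size := by
  obtain ⟨v, p, ps, h, hps, -⟩ := exists_rule_of_mem_derivable hl
  have mem_filter {x} (hx : x ∈ ps) : x ∈ F.filter (Pred G · l) := by
    have hx := (hG.pred_iff h hps).mpr hx
    exact Finset.mem_filter.mpr ⟨hF x hx, hx⟩
  by_cases hp : p = .con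
  · subst hp
    rw [if_pos ⟨v, ps, h⟩]
    exact h.size_le_of_con fun x hx => mem_filter hx
  · obtain ⟨x, hx, hle⟩ := h.exists_size_le hp
    calc l.size = min x.size l.size := (min_eq_right hle).symm
      _ ≤ ∑ x ∈ F with Pred G x l, min x.size l.size :=
        Finset.single_le_sum (f := fun x => min x.size l.size) (fun _ _ => Nat.zero_le _)
          (mem_filter hx)
      _ ≤ _ := Nat.le_add_left _ _

open Classical in
theorem IGraph.WF.sum_consumers_le (hG : G.WF A D d I) (hD : D ⊆ wordTypes 𝒜)
    (hr : HasTier r i) (hx : Anc G x r) {F : Finset (Lab G)} (hF : ∀ l ∈ F, Anc G l r) :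
    ∑ l ∈ F with Pred G x l, min x.size l.size ≤ x.size := by
  by_cases hw : (𝒜 r.term.1).IsWord
  · refine sum_min_size_le_of_subsingleton fun l hl l' hl' => ?_
    rw [Finset.mem_coe, Finset.mem_filter] at hl hl'
    exact hG.consumer_unique hw hl.2 hl'.2 (hF l hl.1) (hF l' hl'.1)
  · have hx_tier : HasTier x i := (hG.hasTier_iff_of_anc hx).mpr hr
    have not_dup : Ty.base x.term.1 i ∉ D := by
      intro h
      obtain ⟨a, j, ha, h⟩ := hD h
      rw [hx.term_fst_eq] at h
      exact hw ((Ty.base.inj h).1 ▸ ha)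
    refine hG.sum_min_size_le_of_notMem hx_tier not_dup (α := anchor i r.stack)
      (fun l hl => (Finset.mem_filter.mp hl).2) fun l hl => ?_
    exact hG.anchor_suffix_of_anc (hF l (Finset.mem_filter.mp hl).1) hr

open Classical in
/-- Every label passes its size on to its consumers, at most once in total, and only constructor
labels add to what they receive. -/
theorem IGraph.WF.size_le_encard (hG : G.WF A D d I) (hD : D ⊆ wordTypes 𝒜)
    (hr : r ∈ derivable G) (hi : HasTier r i) :
    (r.size : ℕ∞) ≤ {l | Anc G l r ∧ IsCon G l}.encard := by
  set F := (hG.finite_anc hr).toFinset with hF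
  have mem_F {l} : l ∈ F ↔ Anc G l r := by simp [hF]
  have hrF : r ∈ F := mem_F.mpr .refl
  have size_le : ∀ l ∈ F,
      l.size ≤ (if IsCon G l then 1 else 0) + ∑ x ∈ F with Pred G x l, min x.size l.size :=
    fun l hl => hG.size_le_sum_pred ((mem_F.mp hl).mem_derivable hr) fun x hx =>
      mem_F.mpr (.head hx (mem_F.mp hl))
  have no_consumer : ∑ l ∈ F with Pred G r l, min r.size l.size = 0 := by
    refine Finset.sum_eq_zero fun l hl => ?_
    obtain ⟨hl, hrl⟩ := Finset.mem_filter.mp hl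
    exact absurd (hG.rank_lt hrl) (hG.rank_le (mem_F.mp hl)).not_gt
  have key : ∑ l ∈ F, l.size ≤ (F.filter (IsCon G)).card + ∑ x ∈ F.erase r, x.size :=
    calc ∑ l ∈ F, l.size
        ≤ ∑ l ∈ F, ((if IsCon G l then 1 else 0) +
            ∑ x ∈ F with Pred G x l, min x.size l.size) := Finset.sum_le_sum size_le
      _ = (F.filter (IsCon G)).card + ∑ x ∈ F, ∑ l ∈ F with Pred G x l, min x.size l.size := by
        rw [Finset.sum_add_distrib, ← Finset.card_filter]
        simp only [Finset.sum_filter]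
        rw [Finset.sum_comm]
      _ = (F.filter (IsCon G)).card +
            ∑ x ∈ F.erase r, ∑ l ∈ F with Pred G x l, min x.size l.size := by
        rw [← Finset.add_sum_erase F _ hrF, no_consumer, zero_add]
      _ ≤ _ := Nat.add_le_add_left (Finset.sum_le_sum fun x hx =>
        hG.sum_consumers_le hD hi (mem_F.mp (Finset.mem_of_mem_erase hx)) fun l => mem_F.mp) _
  have hcard : {l | Anc G l r ∧ IsCon G l} = (F.filter (IsCon G) : Set (Lab G)) := by
    ext l
    simp [mem_F]
  rw [hcard, Set.encard_coe_eq_coe_finsetCard, Nat.cast_le]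
  rw [← Finset.add_sum_erase F _ hrF] at key
  omega

end ConstructorLabels

section Tower

variable {n : ℕ} {𝒜 : Fin n → FreeAlg} {Γ : Ctx 𝒜} {G : IGraph Γ}

/-- The terms in the recurrence arguments of tier above `i` have size at most `N`. -/
def SizeBound (G : IGraph Γ) (i N : ℕ) : Prop :=
  ∀ ⦃v e₀ t U⦄, i < G.tier v → G.RecPremise v e₀ → ⟨t, e₀, U, .hole⟩ ∈ derivable G →
    t.2.size ≤ N

variable {A : Ty 𝒜} {D : Set (Ty 𝒜)} {d I i k N s : ℕ} {v : G.V} {o : Option G.V}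
  {e₀ : G.Edge} {l : Lab G} {U : List (Entry G)} {α : List (Entry G)}

theorem IGraph.WF.encard_entries_le (hG : G.WF A D d I) (hN : SizeBound G i N)
    (hv : i < G.tier v) (he₀ : G.RecPremise v e₀) :
    {x : Entry G | ∃ b u t, x = ⟨b, u, t, v⟩ ∧
      ⟨⟨b, u.plug t⟩, e₀, U, .hole⟩ ∈ derivable G}.encard ≤ N := by
  obtain h | ⟨_, b, u₀, t₀, -, h₀⟩ := Set.eq_empty_or_nonempty {x : Entry G | ∃ b u t,
    x = ⟨b, u, t, v⟩ ∧ ⟨⟨b, u.plug t⟩, e₀, U, .hole⟩ ∈ derivable G}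
  · simp [h]
  calc _ ≤ ((fun q => (⟨b, q.1, q.2, v⟩ : Entry G)) '' (u₀.plug t₀).decompositions).encard := by
        refine Set.encard_le_encard ?_
        rintro _ ⟨b', u, t, rfl, ht⟩
        obtain ⟨rfl, h⟩ := Sigma.mk.inj (congrArg Lab.term (hG.injOn_cfg_derivable ht h₀ rfl))
        exact ⟨(u, t), eq_of_heq h, rfl⟩
    _ ≤ (u₀.plug t₀).decompositions.encard := Set.encard_image_le _ _
    _ ≤ (u₀.plug t₀).size := AlgTerm.encard_decompositions_le _
    _ ≤ N := Nat.cast_le.mpr (hN hv he₀ h₀)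

theorem StackValid.subsingleton_of_tier_le (h : G.tier v ≤ i) :
    {U | StackValid G (some v) U ∧ anchor i U <:+ α}.Subsingleton := by
  rintro U ⟨hU, hα⟩ U' ⟨hU', hα'⟩
  have hlen := hU.length_eq hU'
  cases hU
  cases hU'
  rw [anchor_cons_of_le h] at hα hα'
  exact (List.suffix_of_suffix_length_le hα hα' hlen.le).eq_of_length hlen

theorem IGraph.WF.encard_stacks_le (hG : G.WF A D d I) (hN1 : 1 ≤ N) (hN : SizeBound G i N)
    (h : BoxDepth G k o) : {U | StackValid G o U ∧ anchor i U <:+ α}.encard ≤ N ^ k := by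
  have one_le {k : ℕ} : (1 : ℕ∞) ≤ N ^ k := one_le_pow₀ (Nat.one_le_cast.mpr hN1)
  induction h with
  | none =>
    refine (Set.encard_le_one_iff_subsingleton.mpr ?_).trans one_le
    rintro U ⟨⟨⟩, -⟩ U' ⟨⟨⟩, -⟩
    rfl
  | @some k v a e₀ es g hv _ ih =>
    rcases le_or_gt (G.tier v) i with hi | hi
    · exact (Set.encard_le_one_iff_subsingleton.mpr
        (StackValid.subsingleton_of_tier_le hi)).trans one_le
    have he₀ : G.RecPremise v e₀ := ⟨_, _, _, hv⟩
    calc {U | StackValid G (some v) U ∧ anchor i U <:+ α}.encard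
        ≤ (⋃ U ∈ {U | StackValid G (G.boxPremise e₀) U ∧ anchor i U <:+ α},
            (· :: U) '' {x : Entry G | ∃ b u t, x = ⟨b, u, t, v⟩ ∧
              ⟨⟨b, u.plug t⟩, e₀, U, .hole⟩ ∈ derivable G}).encard := by
          refine Set.encard_le_encard ?_
          rintro _ ⟨hU, hα⟩
          cases hU with | cons hv' hR hU =>
            obtain rfl := he₀.unique hv'
            rw [anchor_cons_of_lt hi] at hα
            exact Set.mem_biUnion ⟨hU, hα⟩ ⟨_, ⟨_, _, _, rfl, hR⟩, rfl⟩
      _ ≤ {U | StackValid G (G.boxPremise e₀) U ∧ anchor i U <:+ α}.encard * N :=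
          encard_biUnion_le_mul fun U _ =>
            (Set.encard_image_le _ _).trans (hG.encard_entries_le hN hi he₀)
      _ ≤ N ^ (k + 1) := by rw [pow_succ]; gcongr

theorem IGraph.WF.encard_isCon_le (hG : G.WF A D d I) (hN1 : 1 ≤ N) (hN : SizeBound G i N) :
    {l | IsCon G l ∧ l ∈ derivable G ∧ anchor i l.stack <:+ α}.encard ≤
      G.conVertices.encard * N ^ d := by
  refine le_trans (Set.encard_le_encard ?_) (encard_biUnion_le_mul
    (t := fun v => {l | l ∈ derivable G ∧ anchor i l.stack <:+ α ∧
      ∃ ps, Rule (derivable G) v .con ps l}) fun v ⟨a, c, e, hv⟩ => ?_)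
  · rintro l ⟨⟨v, ps, h⟩, hl, hα⟩
    obtain ⟨a, c, hv⟩ := h.node_eq_of_con
    exact Set.mem_biUnion ⟨a, c, l.edge, hv⟩ ⟨hl, hα, ps, h⟩
  · refine (Set.encard_le_encard_of_injOn (f := Lab.stack) ?_ ?_).trans
      (hG.encard_stacks_le (α := α) hN1 hN (hG.depth e))
    · rintro l ⟨hl, hα, ps, h⟩
      obtain ⟨a', c', hv'⟩ := h.node_eq_of_con
      cases hv.symm.trans hv'
      exact ⟨hG.stackValid hl, hα⟩
    · rintro l ⟨hl, -, ps, h⟩ l' ⟨hl', -, ps', h'⟩ hU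
      exact hG.injOn_cfg_derivable hl hl' (h.cfg_eq_of_con h' hU)

theorem IGraph.WF.size_le_mul (hG : G.WF A D d I) (hD : D ⊆ wordTypes 𝒜) (hN1 : 1 ≤ N)
    (hN : SizeBound G i N) (hl : l ∈ derivable G) (hi : HasTier l i) :
    (l.size : ℕ∞) ≤ G.conVertices.encard * N ^ d :=
  calc (l.size : ℕ∞) ≤ {x | Anc G x l ∧ IsCon G x}.encard := hG.size_le_encard hD hl hi
    _ ≤ {x | IsCon G x ∧ x ∈ derivable G ∧ anchor i x.stack <:+ anchor i l.stack}.encard :=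
      Set.encard_le_encard fun _ hx =>
        ⟨hx.2, hx.1.mem_derivable hl, hG.anchor_suffix_of_anc hx.1 hi⟩
    _ ≤ G.conVertices.encard * N ^ d := hG.encard_isCon_le hN1 hN

theorem IGraph.WF.size_le_pow (hG : G.WF A D d I) (hD : D ⊆ wordTypes 𝒜) (hs : 1 ≤ s)
    (hGs : G.conVertices.encard ≤ s) (hl : l ∈ derivable G) (hi : HasTier l i) (hk : I ≤ i + k) :
    l.size ≤ s ^ (1 + d) ^ k := by
  induction k generalizing i l with
  | zero =>
    have no_higher : SizeBound G i 1 := fun v e₀ t U hv ⟨a, es, g, he₀⟩ _ =>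
      absurd ((hG.edgeTy_eq_base_tier he₀).2.trans hk) hv.not_ge
    have h := (hG.size_le_mul hD le_rfl no_higher hl hi).trans (mul_le_mul_left hGs _)
    simpa using h
  | succ k ih =>
    have sizeBound : SizeBound G i (s ^ (1 + d) ^ k) := by
      intro v e₀ t U hv ⟨a, es, g, he₀⟩ ht
      obtain ⟨j, hj⟩ := hG.exists_hasTier ht
      have tier_eq : G.tier v = j :=
        (Ty.base.inj ((hG.edgeTy_eq_base_tier he₀).1.symm.trans hj)).2
      exact ih ht hj (by omega)
    have one_le : 1 ≤ (1 + d) ^ k := Nat.one_le_pow _ _ (by omega)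
    have h := (hG.size_le_mul hD (Nat.one_le_pow _ _ hs) sizeBound hl hi).trans
      (mul_le_mul_left hGs _)
    calc l.size ≤ s * (s ^ (1 + d) ^ k) ^ d := by exact_mod_cast h
      _ = s ^ ((1 + d) ^ k * d + 1) := by rw [← pow_mul, ← pow_succ']
      _ ≤ s ^ (1 + d) ^ (k + 1) := Nat.pow_le_pow_right hs (by rw [pow_succ]; linarith)

end Tower

end LinRec

theorem mainTheorem3_general {n : ℕ} {𝒜 : Fin n → LinRec.FreeAlg} {S : LinRec.System 𝒜}
    (hram : S.ramified) (hdup : S.dup ⊆ LinRec.wordTypes 𝒜) {Γ : LinRec.Ctx 𝒜}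
    {M : LinRec.Term 𝒜} {A : LinRec.Ty 𝒜} (π : LinRec.Deriv S Γ M A)
    {T : LinRec.Tree π.graph} (hT : T ∈ LinRec.trees π.graph) :
    T.value.2.size ≤ M.size ^ (1 + π.recDepth) ^ π.highTier := by
  have hG := π.graph_wf hram
  have hl := hG.label_mem_derivable hT
  obtain ⟨i, hi⟩ := hG.exists_hasTier hl
  exact hG.size_le_pow hdup M.one_le_size π.encard_conVertices_le hl hi (Nat.le_add_left _ _)

theorem mainTheorem3 {n : ℕ} (𝒜 : Fin n → LinRec.FreeAlg) :
    ∃ p : ℕ → ℕ → Polynomial ℕ,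
      ∀ (Γ : LinRec.Ctx 𝒜) (M : LinRec.Term 𝒜) (A : LinRec.Ty 𝒜)
        (π : LinRec.Deriv (LinRec.RH (LinRec.wordTypes 𝒜)) Γ M A),
        ∀ T ∈ LinRec.trees π.graph,
          T.value.2.size ≤ (p π.highTier π.recDepth).eval M.size :=
  ⟨fun d e => Polynomial.X ^ (1 + e) ^ d, fun Γ M A π T hT => by
    rw [Polynomial.eval_pow, Polynomial.eval_X]
    exact mainTheorem3_general trivial subset_rfl π hT⟩
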